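/- **Setting.** Let $(G,\mathcal P)$, $\mathcal P=\{P_1,\dots,P_n\}$, be a group together with finitely many subgroups, acting geometrically on a pair $(X,\mathcal A)$: $X$ is a connected simplicial graph on which $G$ acts properly and cocompactly, and $\mathcal A=\{A_1,\dots,A_n\}$ are connected subgraphs such that $P_i$ preserves $A_i$ and acts on it cocompactly. Let $\widehat X$ be the combinatorial cusped graph, obtained from $X$ by gluing, for each $i$ and each coset $gP_i$, the combinatorial horoball over $gA_i$ (vertices $(v,m)$ with $v\in gA_i$, $m\ge 0$, of *depth* $m$; vertical edges between $(v,m)$ and $(v,m+1)$; horizontal edges between $(v,m)$ and $(w,m)$ whenever $0<d_{gA_i}(v,w)\le 2^m$) along $gA_i=gA_i\times\{0\}$. Vertices of $X$ have depth $0$. Assume that $\widehat X$ is Gromov hyperbolic (so $G$ is hyperbolic relative to $\mathcal P$) and that $G$ is one-ended. Fix a globally stable bicombing $q$ on $\widehat X$, i.e. a map assigning to each pair of vertices a rational simplicial $1$-chain $q(x,y)$ such that $\partial q(x,y)=y-x$, $q(x,x)=0$, $q(gx,gy)=g\,q(x,y)$, $q(x,y)=-q(y,x)$, and, for some constant $\delta$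 and all vertices $x,y,z$: $\operatorname{supp}q(x,y)$ lies in the $\delta$-neighbourhood of every geodesic from $x$ to $y$, $\|q(x,y)\|_1\le\delta\, d(x,y)$, and $\|q(x,y)+q(y,z)+q(z,x)\|_1\le\delta$. Here $\operatorname{supp}$ of a chain is the set of its edges, oriented so that their coefficients are positive. **Patterns.** A *singular pattern* on a $2$-dimensional simplicial complex $K$ is a graph $\mathcal F$ whose vertices (*connectors*) are points in interiors of edges (*regular* connectors) or of $2$-simplices (*singular* connectors) of $K$ and whose edges (*segments*) are straight segments with interior in the interior of a $2$-simplex, such that: a segment with a singular endpoint has a regular other endpoint and meets no other segment in the interior of its $2$-simplex; each simplex has finitely many connectors and segments; and each connector is an endpoint of exactly one segment in each $2$-simplex whose closure contains it. Segments joining two regular connectors are called *regular*. A pattern is *weighted* if its connectors carry weights $\mathbf w\ge 0$, with weight $0$ at singular connectors. *Tracks* are connected components of the pattern; the weight of a track is the maximal weight of its connectors, and the *total weight* is the sum of the weights of the tracks. **Resolutions.** Suppose that $G$ acts simplicially on $K$, and let $\Phi:K^0\to X^0$ be a $G$-equivariant map. For an oriented edge $e$ of $K$ from $e_-$ to $e_+$,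 put $q(e)=q(\Phi(e_-),\Phi(e_+))$. A *resolution of $q$ to $K$ via $\Phi$* is a $G$-invariant weighted singular pattern $(\mathcal F,\mathbf w)$ on $K$ with, for each oriented edge $e$, a bijection $\mathbf c(e,\cdot)$ from $\operatorname{supp}q(e)$ to the set of regular connectors on $e$, such that 1. $\mathbf c(-e,-f)=\mathbf c(e,f)$; 2. $g\,\mathbf c(e,f)=\mathbf c(ge,gf)$ for all $g\in G$; 3. if $f,f'\in\operatorname{supp}q(e)$ and $d(\Phi(e_-),f)<d(\Phi(e_-),f')-\delta_0$, then $\mathbf c(e,f)$ precedes $\mathbf c(e,f')$ on $e$, where $\delta_0$ is a constant depending only on $\widehat X$ and $q$; 4. $\mathbf w(\mathbf c(e,f))$ is the coefficient of $f$ in $q(e)$; 5. two regular connectors $\mathbf c,\mathbf c'$ on the boundary of a $2$-simplex $\Delta$ are joined by a regular segment if and only if $\mathbf c=\mathbf c(e,f)$ and $\mathbf c'=\mathbf c(e',-f)$ where $\partial\Delta=e+e'+e''$, $f\in\operatorname{supp}q(e)$, $-f\in\operatorname{supp}q(e')$ and $\pm f\notin\operatorname{supp}q(e'')$. It induces a resolution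 $\bar{\mathcal F}=\mathcal F/G$ on $\bar K=K/G$. For $R\in\mathbb R$, $\bar{\mathcal F}_{\le R}$ is the part of $\bar{\mathcal F}$ whose connectors are induced by edges of $\widehat X$ with both endpoints of depth at most $R$ (a singular connector being induced by the same edge as the regular connector it is joined to). Let $\operatorname{vol}(\bar K)$ be the number of cells of $\bar K$, i.e. of $G$-orbits of simplices of $K$. **Proposition.** In this setting there are a constant $\delta_0$ and constants $\boldsymbol\delta_R>0$ ($R\in\mathbb R$), independent of $K$, such that for every simply connected $2$-dimensional simplicial complex $K$ with a free cocompact simplicial action of $G$ there are a $G$-equivariant map $\Phi:K^0\to X^0$ and a resolution of $q$ to $K$ via $\Phi$, with constant $\delta_0$ in condition 3, whose quotient $\bar{\mathcal F}$ on $\bar K=K/G$ satisfies, for every $R\in\mathbb R$, $$\mathbf w(\bar{\mathcal F}_{\le R})\le\boldsymbol\delta_R\cdot\operatorname{vol}(\bar K).$$ -/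

import Mathlib

open scoped NNReal ENNReal Pointwise

universe u v w x y

/-! ### One-ended groups and hyperbolic graphs -/

/-- A (finitely generated) group is one-ended if its Cayley graph with respect to some finite
generating set has exactly one end. (The number of ends does not depend on the generating set.) -/
def IsOneEnded (G : Type u) [Group G] : Prop :=
  ∃ S : Finset G, Subgroup.closure (S : Set G) = ⊤ ∧
    ∃! e, e ∈ (SimpleGraph.mulCayley (S : Set G)).end

/-- A walk in a graph is geodesic if its length is the distance between its endpoints. -/
def IsGeodesicWalk {Y : Type y} {Γ : SimpleGraph Y} {a b : Y} (p : Γ.Walk a b) : Prop :=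
  p.length = Γ.dist a b

/-- A graph is hyperbolic if it is connected and, for some `δ > 0`, all its geodesic triangles are
`δ`-thin: every point of a side is within `δ` of the union of the other two sides. (Up to changing
`δ`, it is enough to look at triangles made of edge paths and at their vertices.) -/
def IsHyperbolicGraph {Y : Type y} (Γ : SimpleGraph Y) : Prop :=
  Γ.Connected ∧ ∃ δ : ℝ, 0 < δ ∧
    ∀ (a b c : Y) (p : Γ.Walk a b) (q : Γ.Walk b c) (r : Γ.Walk c a),
      IsGeodesicWalk p → IsGeodesicWalk q → IsGeodesicWalk r →
      ∀ m ∈ p.support, ∃ n, (n ∈ q.support ∨ n ∈ r.support) ∧ (Γ.dist m n : ℝ) ≤ δ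

/-! ### Geometric actions of group pairs and the combinatorial cusped graph -/

section Cusped

variable {G : Type u} [Group G] {ι : Type x} {V : Type v} [MulAction G V]

/-- The pair `(G, P)` acts geometrically on the graph pair `(X, A)`: `X` is connected, each `A i`
is a connected subgraph, `G` acts on `X` by graph automorphisms, properly (finite vertex
stabilizers) and cocompactly (finitely many orbits of vertices and of edges), and `P i` preserves
`A i` and acts on it cocompactly (properness being inherited from the action on `X`). -/
structure IsGeometricPair (P : ι → Subgroup G) (X : SimpleGraph V) (A : ι → X.Subgraph) :
    Prop where
  connected : X.Connected
  adj_smul : ∀ (g : G) (a b : V), X.Adj a b → X.Adj (g • a) (g • b)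
  finite_stabilizer : ∀ a : V, (MulAction.stabilizer G a : Set G).Finite
  cocompact_vertices : ∃ F : Set V, F.Finite ∧ ∀ a, ∃ g : G, g • a ∈ F
  cocompact_edges : ∃ F : Set (V × V), F.Finite ∧ ∀ a b, X.Adj a b → ∃ g : G, g • (a, b) ∈ F
  sub_connected : ∀ i, (A i).Connected
  sub_verts_smul : ∀ i, ∀ p ∈ P i, ∀ a ∈ (A i).verts, p • a ∈ (A i).verts
  sub_adj_smul : ∀ i, ∀ p ∈ P i, ∀ a b, (A i).Adj a b → (A i).Adj (p • a) (p • b)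
  sub_cocompact_vertices : ∀ i, ∃ F : Set V, F.Finite ∧
    ∀ a ∈ (A i).verts, ∃ p ∈ P i, p • a ∈ F
  sub_cocompact_edges : ∀ i, ∃ F : Set (V × V), F.Finite ∧
    ∀ a b, (A i).Adj a b → ∃ p ∈ P i, p • (a, b) ∈ F

/-- The vertex set of the translate `g A_i`, for a coset `c = g P_i`. -/
def translateVerts (P : ι → Subgroup G) {X : SimpleGraph V} (A : ι → X.Subgraph)
    (c : (i : ι) × (G ⧸ P i)) : Set V :=
  {a | ∃ g : G, (g : G ⧸ P c.1) = c.2 ∧ g⁻¹ • a ∈ (A c.1).verts}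

/-- The edges of the translate `g A_i`, for a coset `c = g P_i`, as a graph on all of `V` (so that
the vertices outside `g A_i` are isolated). -/
def translateGraph (P : ι → Subgroup G) {X : SimpleGraph V} (A : ι → X.Subgraph)
    (c : (i : ι) × (G ⧸ P i)) : SimpleGraph V where
  Adj a b := ∃ g : G, (g : G ⧸ P c.1) = c.2 ∧ (A c.1).Adj (g⁻¹ • a) (g⁻¹ • b)
  symm := ⟨fun _ _ ⟨g, hg, h⟩ => ⟨g, hg, h.symm⟩⟩
  loopless := ⟨fun _ ⟨_, _, h⟩ => (A c.1).loopless.irrefl _ h⟩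

/-- A vertex of positive depth of the cusped graph: a coset `c = g P_i`, a vertex `pt` of
`g A_i`, and a depth `lev + 1`. The vertices of depth `0` of the horoball based at `g A_i` are
glued to `X`, so they do not appear here. -/
@[ext]
structure HoroVertex (P : ι → Subgroup G) {X : SimpleGraph V} (A : ι → X.Subgraph) where
  base : (i : ι) × (G ⧸ P i)
  pt : V
  mem : pt ∈ translateVerts P A base
  lev : ℕ

/-- The vertices of the cusped graph: those of `X`, and those of positive depth. -/
abbrev CuspedVertex (P : ι → Subgroup G) {X : SimpleGraph V} (A : ι → X.Subgraph) :=
  V ⊕ HoroVertex P A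

instance (P : ι → Subgroup G) {X : SimpleGraph V} (A : ι → X.Subgraph) :
    MulAction G (HoroVertex P A) where
  smul g a :=
    { base := g • a.base
      pt := g • a.pt
      mem := by
        obtain ⟨h, hh, hm⟩ := a.mem
        refine ⟨g * h, ?_, ?_⟩
        · change ((g * h : G) : G ⧸ P a.base.1) = g • a.base.2
          rw [← hh]; rfl
        · change (g * h)⁻¹ • (g • a.pt) ∈ (A a.base.1).verts
          simpa [mul_smul] using hm
      lev := a.lev }
  one_smul a := HoroVertex.ext (one_smul G a.base) (one_smul G a.pt) rfl
  mul_smul g h a := HoroVertex.ext (mul_smul g h a.base) (mul_smul g h a.pt) rfl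

/-- The depth of a vertex of the cusped graph. -/
def cuspedDepth {P : ι → Subgroup G} {X : SimpleGraph V} {A : ι → X.Subgraph} :
    CuspedVertex P A → ℕ
  | Sum.inl _ => 0
  | Sum.inr a => a.lev + 1

/-- Adjacency in the cusped graph: the edges of `X`, the vertical edges (between consecutive depths
over the same vertex of the same translate `g A_i`), and at depth `m ≥ 1` the horizontal edges
between distinct vertices of `g A_i` at distance at most `2 ^ m` in `g A_i`. (The horizontal edges
of depth `0` are edges of `g A_i`, hence edges of `X`.) -/
def cuspedAdj (P : ι → Subgroup G) (X : SimpleGraph V) (A : ι → X.Subgraph) :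
    CuspedVertex P A → CuspedVertex P A → Prop
  | Sum.inl a, Sum.inl b => X.Adj a b
  | Sum.inl a, Sum.inr b => b.lev = 0 ∧ b.pt = a
  | Sum.inr a, Sum.inl b => a.lev = 0 ∧ a.pt = b
  | Sum.inr a, Sum.inr b => a.base = b.base ∧
      ((a.pt = b.pt ∧ (a.lev + 1 = b.lev ∨ b.lev + 1 = a.lev)) ∨
       (a.pt ≠ b.pt ∧ a.lev = b.lev ∧
        (translateGraph P A a.base).edist a.pt b.pt ≤ ((2 ^ (a.lev + 1) : ℕ) : ℕ∞)))

/-- The combinatorial cusped graph of `(X, A)`: the graph `X` with a combinatorial horoball glued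
along each translate `g A_i`, one for each `i` and each coset `g P_i`. -/
def cuspedGraph (P : ι → Subgroup G) (X : SimpleGraph V) (A : ι → X.Subgraph) :
    SimpleGraph (CuspedVertex P A) where
  Adj := cuspedAdj P X A
  symm := ⟨by
    rintro (a | a) (b | b) h
    · exact X.symm.symm _ _ h
    · exact h
    · exact h
    · obtain ⟨hb, h⟩ := h
      refine ⟨hb.symm, ?_⟩
      rcases h with ⟨h1, h2⟩ | ⟨h1, h2, h3⟩
      · exact Or.inl ⟨h1.symm, h2.symm⟩
      · refine Or.inr ⟨h1.symm, h2.symm, ?_⟩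
        rw [← hb, ← h2, SimpleGraph.edist_comm]
        exact h3⟩
  loopless := ⟨by
    rintro (a | a) h
    · exact X.loopless.irrefl _ h
    · rcases h with ⟨_, ⟨_, h | h⟩ | ⟨h, _⟩⟩
      · omega
      · omega
      · exact h rfl⟩

end Cusped

/-! ### Rational 1-chains and globally stable bicombings -/

section Bicombing

variable {Y : Type y}

/-- The rational simplicial 1-chains of a graph, as antisymmetric finitely supported functions on
ordered pairs of vertices, supported on the oriented edges: `a f` is the coefficient in `a` of the
oriented edge `f`, and the opposite edge `f.swap` represents `-f`. -/
def IsOneChain (Γ : SimpleGraph Y) (a : Y × Y →₀ ℚ) : Prop :=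
  (∀ f, a f.swap = - a f) ∧ ∀ f, a f ≠ 0 → Γ.Adj f.1 f.2

/-- The boundary of a 1-chain. Each unoriented edge is counted once in each direction, whence the
factor `1 / 2`. -/
noncomputable def chainBoundary (a : Y × Y →₀ ℚ) : Y →₀ ℚ :=
  a.sum fun f t => (t / 2) • (Finsupp.single f.2 1 - Finsupp.single f.1 1)

/-- The `ℓ¹`-norm of a 1-chain: the sum over unoriented edges of the absolute values of the
coefficients. -/
noncomputable def chainNorm (a : Y × Y →₀ ℚ) : ℚ :=
  a.sum fun _ t => |t| / 2

/-- The support of a 1-chain, each edge being oriented so that its coefficient is positive. -/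
def chainSupp (a : Y × Y →₀ ℚ) : Set (Y × Y) := {f | 0 < a f}

/-- `q` is a globally stable bicombing on the graph `Γ` with an action of `G`. -/
structure IsGloballyStableBicombing (G : Type u) [Group G] [MulAction G Y] (Γ : SimpleGraph Y)
    (q : Y → Y → (Y × Y →₀ ℚ)) : Prop where
  isOneChain : ∀ a b, IsOneChain Γ (q a b)
  boundary : ∀ a b, chainBoundary (q a b) = Finsupp.single b 1 - Finsupp.single a 1
  self : ∀ a, q a a = 0
  quasigeodesic : ∃ δ : ℝ, ∀ a b,
    (∀ p : Γ.Walk a b, IsGeodesicWalk p → ∀ f ∈ chainSupp (q a b), ∃ z ∈ p.support,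
      (Γ.dist f.1 z : ℝ) ≤ δ ∧ (Γ.dist f.2 z : ℝ) ≤ δ) ∧
    (chainNorm (q a b) : ℝ) ≤ δ * Γ.dist a b
  equivariant : ∀ (g : G) (a b : Y) (f : Y × Y), q (g • a) (g • b) (g • f) = q a b f
  antisymmetric : ∀ a b, q a b = - q b a
  bounded_defect : ∃ δ : ℝ, ∀ a b c, (chainNorm (q a b + q b c + q c a) : ℝ) ≤ δ

end Bicombing

/-! ### Simplicial complexes with a free cocompact action -/

section Complexes

variable {W : Type w} [DecidableEq W]

/-- The 1-skeleton of a simplicial complex, as a graph. -/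
def oneSkeleton (K : AbstractSimplicialComplex W) : SimpleGraph W where
  Adj a b := a ≠ b ∧ ({a, b} : Finset W) ∈ K.faces
  symm := ⟨fun a b h => ⟨h.1.symm, by rw [Finset.pair_comm]; exact h.2⟩⟩
  loopless := ⟨fun _ h => h.1 rfl⟩

/-- Homotopy (with fixed endpoints) of edge paths in a simplicial complex: the congruence on edge
paths generated by removing a backtrack and by replacing two sides of a 2-simplex by the third. -/
inductive EdgeHomotopic (K : AbstractSimplicialComplex W) :
    {a b : W} → (oneSkeleton K).Walk a b → (oneSkeleton K).Walk a b → Prop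
  | refl {a b : W} (p : (oneSkeleton K).Walk a b) : EdgeHomotopic K p p
  | symm {a b : W} {p q : (oneSkeleton K).Walk a b} :
      EdgeHomotopic K p q → EdgeHomotopic K q p
  | trans {a b : W} {p q r : (oneSkeleton K).Walk a b} :
      EdgeHomotopic K p q → EdgeHomotopic K q r → EdgeHomotopic K p r
  | cons {a b c : W} (h : (oneSkeleton K).Adj a b) {p q : (oneSkeleton K).Walk b c} :
      EdgeHomotopic K p q →
      EdgeHomotopic K (SimpleGraph.Walk.cons h p) (SimpleGraph.Walk.cons h q)
  | backtrack {a b c : W} (h : (oneSkeleton K).Adj a b) (h' : (oneSkeleton K).Adj b a)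
      (p : (oneSkeleton K).Walk a c) :
      EdgeHomotopic K (SimpleGraph.Walk.cons h (SimpleGraph.Walk.cons h' p)) p
  | triangle {a b c d : W} (hab : (oneSkeleton K).Adj a b) (hbc : (oneSkeleton K).Adj b c)
      (hac : (oneSkeleton K).Adj a c) (hface : ({a, b, c} : Finset W) ∈ K.faces)
      (p : (oneSkeleton K).Walk c d) :
      EdgeHomotopic K (SimpleGraph.Walk.cons hab (SimpleGraph.Walk.cons hbc p))
        (SimpleGraph.Walk.cons hac p)

/-- A simplicial complex is simply connected if it is connected and its edge-path group (which is
the fundamental group of its realization) is trivial. -/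
def IsSimplyConnectedComplex (K : AbstractSimplicialComplex W) : Prop :=
  (oneSkeleton K).Connected ∧
    ∀ (a : W) (p : (oneSkeleton K).Walk a a), EdgeHomotopic K p SimpleGraph.Walk.nil

/-- The set of cells of `K / G`, i.e. the `G`-orbits of simplices of `K`. -/
def quotientCells (G : Type u) [Group G] [MulAction G W] (K : AbstractSimplicialComplex W) :
    Set (MulAction.orbitRel.Quotient G (Finset W)) :=
  (Quotient.mk (MulAction.orbitRel G (Finset W))) '' K.faces

/-- The action of `G` on `K` is simplicial, free on the realization of `K` (no nontrivial element
maps a simplex to itself, for it would fix the barycenter), and cocompact. -/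
structure IsFreeCocompactAction (G : Type u) [Group G] [MulAction G W]
    (K : AbstractSimplicialComplex W) : Prop where
  simplicial : ∀ (g : G), ∀ s ∈ K.faces, g • s ∈ K.faces
  free : ∀ (g : G), ∀ s ∈ K.faces, g • s = s → g = 1
  cocompact : (quotientCells G K).Finite

/-- The volume of `K / G`: its number of cells. -/
noncomputable def quotientVolume (G : Type u) [Group G] [MulAction G W]
    (K : AbstractSimplicialComplex W) : ℕ :=
  (quotientCells G K).ncard

/-! ### Weighted singular patterns

Points of the realization of a complex are given by their barycentric coordinates, so that the
support of a point is the simplex whose interior contains it. -/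

/-- The interior of the simplex with vertex set `s`. -/
def openSimplex (s : Finset W) : Set (W →₀ ℝ) :=
  {c | c.support = s ∧ (∀ a, 0 ≤ c a) ∧ (c.sum fun _ t => t) = 1}

/-- The action of `G` on points in barycentric coordinates. -/
noncomputable def pointSMul {G : Type u} [Group G] [MulAction G W] (g : G) (c : W →₀ ℝ) :
    W →₀ ℝ :=
  Finsupp.equivMapDomain (MulAction.toPerm g) c

/-- A point in the interior of an edge. Connectors of this kind are called regular. -/
def IsRegularPoint (c : W →₀ ℝ) : Prop := c.support.card = 2

/-- A point in the interior of a 2-simplex. Connectors of this kind are called singular. -/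
def IsSingularPoint (c : W →₀ ℝ) : Prop := c.support.card = 3

/-- A singular pattern on `K`: a graph whose vertices (the connectors) are points in the interiors
of edges and 2-simplices of `K`, and whose edges (the segments) are straight segments with interior
in the interior of a 2-simplex. Two connectors are joined by at most one segment, so segments are
given by the adjacency relation between connectors. -/
structure SingularPattern (K : AbstractSimplicialComplex W) where
  connectors : Set (W →₀ ℝ)
  graph : SimpleGraph (W →₀ ℝ)
  mem_of_adj : ∀ c d, graph.Adj c d → c ∈ connectors ∧ d ∈ connectors
  connector_mem : ∀ c ∈ connectors,
    ∃ s ∈ K.faces, (s.card = 2 ∨ s.card = 3) ∧ c ∈ openSimplex s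
  segment_interior : ∀ c d, graph.Adj c d →
    ∃ s ∈ K.faces, s.card = 3 ∧ openSegment ℝ c d ⊆ openSimplex s
  /-- a singular segment has a regular endpoint -/
  regular_of_singular : ∀ c d, graph.Adj c d → IsSingularPoint c → IsRegularPoint d
  /-- a singular segment does not meet any other segment in the interior of a 2-simplex -/
  singular_disjoint : ∀ c d, graph.Adj c d → IsSingularPoint c →
    ∀ c' d', graph.Adj c' d' → s(c, d) ≠ s(c', d') →
      ∀ p ∈ segment ℝ c d, p ∈ segment ℝ c' d' → ¬ IsSingularPoint p
  /-- each simplex has finitely many connectors (and therefore finitely many segments) -/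
  finite_connectors : ∀ s ∈ K.faces, {c ∈ connectors | c.support = s}.Finite
  /-- each connector is an endpoint of exactly one segment in each 2-simplex whose closure
  contains it -/
  unique_segment : ∀ c ∈ connectors, ∀ s ∈ K.faces, s.card = 3 → c.support ⊆ s →
    ∃! d, graph.Adj c d ∧ d.support ⊆ s

/-- A weighted singular pattern: connectors have nonnegative weights, and singular connectors have
weight zero. (The values of `weight` away from the connectors are irrelevant.) -/
structure WeightedSingularPattern (K : AbstractSimplicialComplex W) extends SingularPattern K where
  weight : (W →₀ ℝ) → ℝ≥0
  weight_singular : ∀ c ∈ connectors, IsSingularPoint c → weight c = 0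

/-- A weighted singular pattern is `G`-invariant. -/
structure WeightedSingularPattern.IsInvariant (G : Type u) [Group G] [MulAction G W]
    {K : AbstractSimplicialComplex W} (F : WeightedSingularPattern K) : Prop where
  connectors : ∀ (g : G), ∀ c ∈ F.connectors, pointSMul g c ∈ F.connectors
  segments : ∀ (g : G) (c d : W →₀ ℝ), F.graph.Adj c d →
    F.graph.Adj (pointSMul g c) (pointSMul g d)
  weight : ∀ (g : G), ∀ c ∈ F.connectors, F.weight (pointSMul g c) = F.weight c

/-- For a set `S` of connectors, the equivalence relation on `S` generated by being joined by a
segment and by being in the same `G`-orbit. Its classes are the tracks of the pattern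
on `K / G` whose connectors are the images of those in `S`, i.e. the connected components of the
quotient graph. -/
def WeightedSingularPattern.quotientTracks (G : Type u) [Group G] [MulAction G W]
    {K : AbstractSimplicialComplex W} (F : WeightedSingularPattern K) (S : Set (W →₀ ℝ)) :
    Setoid S :=
  Relation.EqvGen.setoid fun c d =>
    F.graph.Adj c.1 d.1 ∨ ∃ g : G, pointSMul g c.1 = d.1

/-- The total weight of the pattern induced on `K / G` by the connectors in `S`: the sum over its
tracks of the maximal weight of the connectors of the track. The sum and the maximum are taken in
`[0, ∞]`, so they need no finiteness assumption. -/
noncomputable def WeightedSingularPattern.quotientTotalWeight (G : Type u) [Group G]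
    [MulAction G W] {K : AbstractSimplicialComplex W} (F : WeightedSingularPattern K)
    (S : Set (W →₀ ℝ)) : ℝ≥0∞ :=
  ∑' t : Quotient (F.quotientTracks G S),
    ⨆ c : S, ⨆ _ : Quotient.mk (F.quotientTracks G S) c = t, (F.weight c.1 : ℝ≥0∞)

/-! ### Resolutions -/

variable {Y : Type y}

/-- The distance in a graph from a vertex to an edge. -/
noncomputable def distToEdge (Γ : SimpleGraph Y) (a : Y) (f : Y × Y) : ℕ :=
  min (Γ.dist a f.1) (Γ.dist a f.2)

/-- A resolution of the bicombing `q` on `Γ` to `K` via the map `Φ` from the vertices of `K` to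
those of `Γ`, with constant `δ₀` in the quasi-order condition. For an oriented edge `e = (a, b)`
of `K`, `q(e)` is `q (Φ a) (Φ b)`, and `conn a b f` is the connector on `e` attached to the edge
`f` of the support of `q(e)`. -/
structure Resolution (G : Type u) [Group G] [MulAction G W] [MulAction G Y] (Γ : SimpleGraph Y)
    (q : Y → Y → (Y × Y →₀ ℚ)) (K : AbstractSimplicialComplex W) (Φ : W → Y) (δ₀ : ℝ)
    extends WeightedSingularPattern K where
  invariant : toWeightedSingularPattern.IsInvariant G
  conn : W → W → Y × Y → (W →₀ ℝ)
  conn_bijOn : ∀ a b, (oneSkeleton K).Adj a b →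
    Set.BijOn (conn a b) (chainSupp (q (Φ a) (Φ b))) {c ∈ connectors | c.support = {a, b}}
  conn_symm : ∀ a b, (oneSkeleton K).Adj a b → ∀ f ∈ chainSupp (q (Φ a) (Φ b)),
    conn b a f.swap = conn a b f
  conn_equivariant : ∀ a b, (oneSkeleton K).Adj a b → ∀ f ∈ chainSupp (q (Φ a) (Φ b)),
    ∀ g : G, pointSMul g (conn a b f) = conn (g • a) (g • b) (g • f)
  /-- The order on the edge from `a` to `b` is that of the barycentric coordinate at `b`. -/
  quasi_ordered : ∀ a b, (oneSkeleton K).Adj a b →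
    ∀ f ∈ chainSupp (q (Φ a) (Φ b)), ∀ f' ∈ chainSupp (q (Φ a) (Φ b)),
      (distToEdge Γ (Φ a) f : ℝ) < distToEdge Γ (Φ a) f' - δ₀ → conn a b f b < conn a b f' b
  weight_conn : ∀ a b, (oneSkeleton K).Adj a b → ∀ f ∈ chainSupp (q (Φ a) (Φ b)),
    (weight (conn a b f) : ℝ) = (q (Φ a) (Φ b) f : ℝ)
  /-- Two regular connectors on the boundary of a 2-simplex `s` are joined by a segment if and only
  if they are the connectors on two edges `a → b`, `b → d` attached to `f` and `-f` respectively,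
  for some `f` which, in either orientation, is not in the support over the third edge `d → a`. -/
  adj_iff : ∀ s ∈ K.faces, s.card = 3 → ∀ c ∈ connectors, ∀ c' ∈ connectors,
    IsRegularPoint c → IsRegularPoint c' → c.support ⊆ s → c'.support ⊆ s →
    (graph.Adj c c' ↔ ∃ (a b d : W) (f : Y × Y), s = {a, b, d} ∧
      f ∈ chainSupp (q (Φ a) (Φ b)) ∧ f.swap ∈ chainSupp (q (Φ b) (Φ d)) ∧
      f ∉ chainSupp (q (Φ d) (Φ a)) ∧ f.swap ∉ chainSupp (q (Φ d) (Φ a)) ∧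
      c = conn a b f ∧ c' = conn b d f.swap)

/-- The connectors of a resolution that are induced by edges of `Γ` of depth at most `R`: the
regular connectors attached to such edges, and the singular connectors joined to them. -/
def Resolution.connectorsLE {G : Type u} [Group G] [MulAction G W] [MulAction G Y]
    {Γ : SimpleGraph Y} {q : Y → Y → (Y × Y →₀ ℚ)} {K : AbstractSimplicialComplex W} {Φ : W → Y}
    {δ₀ : ℝ} (F : Resolution G Γ q K Φ δ₀) (depth : Y → ℕ) (R : ℝ) : Set (W →₀ ℝ) :=
  {c | ∃ (a b : W) (f : Y × Y), (oneSkeleton K).Adj a b ∧ f ∈ chainSupp (q (Φ a) (Φ b)) ∧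
    (depth f.1 : ℝ) ≤ R ∧ (depth f.2 : ℝ) ≤ R ∧
    (c = F.conn a b f ∨ (IsSingularPoint c ∧ F.graph.Adj c (F.conn a b f)))}

end Complexes

/-! Among all equivariant maps `Φ`, take one that minimises the sum of `N ^ length` over
representatives of the edges of `K`, the lengths being measured in the cusped graph and `N` being so
large that the longest edges dominate. Any resolution via this map satisfies the estimate. A
resolution exists for every equivariant map (`exists_isPositioning`, `nonempty_resolution`):
connectors are placed along each edge in order of distance from its origin, and a connector without
a regular partner in a 2-simplex gets a short segment towards the barycentre. Since `G` acts freely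
on the simplices, all choices can be made equivariantly.

Every weight is at most a constant `δ` depending only on `q`: cut a geodesic on both sides of an
edge, use stability, and only a piece of bounded length contributes (`exists_isUniformBicombing`).
It remains to charge each track of depth at most `R` to cells of `K / G`, at bounded total cost per
cell. There are three kinds of tracks.

A track without singular connectors is two-sided, so its edges form a cocycle; as `K` is simply
connected they are the edges leaving a vertex set `S` (`exists_cut`), and as `G` is one-ended `S`
can be taken finite after reversing `f` if necessary (`exists_finTrack`). If every inner endpoint of
the track were mapped far from its edge `f`, collapsing all translates of `S` to points near the
translates of `f` would lower the energy (`FinTrack.exists_exit_near`). The delicate case is an edge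
joining two translates: when their types are far apart the translates are disjoint and crossed in
the right order (`FinTrack.disjoint_of_far`), so the edge gets shorter. Thus some inner vertex is
mapped close to `f`, the pair of this vertex and `f` determines the track (`IsInnerVertex.eq`), and
balls about vertices of depth `0` have bounded size.

In a track meeting a 2-simplex in which `f` lies over all three sides, `f` is near the centre of the
corresponding triangle; for one 2-simplex all such edges are within `7 * δ` of each other
(`IsTriple.dist_le`), so at bounded depth there are boundedly many.

In any other track with a singular connector, the weight is zero there and changes along each
segment by at most the defect of `q` in the 2-simplex. Hence the maximal weight is at most the sum
of the defects along the track (`weight_le_sum_defect`), and the defects in one 2-simplex add up to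
at most `δ`. Summing the three charges gives `quotientTotalWeight_le`. -/

/-! ### Points near geodesics -/

section Geodesics

variable {Y : Type y} {Γ : SimpleGraph Y}

/-- The point `p` lies within `δ` of every geodesic from `a` to `b`. -/
def IsNearGeodesics (Γ : SimpleGraph Y) (δ : ℕ) (a b p : Y) : Prop :=
  ∀ w : Γ.Walk a b, IsGeodesicWalk w → ∃ z ∈ w.support, Γ.dist p z ≤ δ

theorem IsNearGeodesics.symm {δ : ℕ} {a b p : Y} (h : IsNearGeodesics Γ δ a b p) :
    IsNearGeodesics Γ δ b a p := by
  intro w hw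
  obtain ⟨z, hz, hd⟩ := h w.reverse (by
    unfold IsGeodesicWalk at *; rw [SimpleGraph.Walk.length_reverse, hw, SimpleGraph.dist_comm])
  exact ⟨z, by simpa using hz, hd⟩

theorem dist_add_dist_of_mem_geodesic (hΓ : Γ.Connected) {a b z : Y} {w : Γ.Walk a b}
    (hw : IsGeodesicWalk w) (hz : z ∈ w.support) : Γ.dist a z + Γ.dist z b = Γ.dist a b := by
  classical
  have h1 := congrArg SimpleGraph.Walk.length (w.take_spec hz)
  rw [SimpleGraph.Walk.length_append, hw] at h1
  have h2 := SimpleGraph.dist_le (w.takeUntil z hz)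
  have h3 := SimpleGraph.dist_le (w.dropUntil z hz)
  have h4 := hΓ.dist_triangle (u := a) (v := z) (w := b)
  omega

theorem IsNearGeodesics.dist_add_dist_le (hΓ : Γ.Connected) {δ : ℕ} {a b p : Y}
    (h : IsNearGeodesics Γ δ a b p) : Γ.dist a p + Γ.dist p b ≤ Γ.dist a b + 2 * δ := by
  obtain ⟨w, hw⟩ := hΓ.exists_walk_length_eq_dist a b
  obtain ⟨z, hz, hd⟩ := h w hw
  have h1 := dist_add_dist_of_mem_geodesic hΓ hw hz
  have h2 := hΓ.dist_triangle (u := a) (v := z) (w := p)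
  have h3 := hΓ.dist_triangle (u := p) (v := z) (w := b)
  rw [Γ.dist_comm (u := z) (v := p)] at h2
  omega

theorem dist_getVert_le (hΓ : Γ.Connected) {a b : Y} (w : Γ.Walk a b) (i k : ℕ) :
    Γ.dist (w.getVert i) (w.getVert (i + k)) ≤ k := by
  induction k with
  | zero => simp
  | succ k ih =>
    have h := hΓ.dist_triangle (u := w.getVert i) (v := w.getVert (i + k))
      (w := w.getVert (i + (k + 1)))
    have h1 : Γ.dist (w.getVert (i + k)) (w.getVert (i + (k + 1))) ≤ 1 := by
      rcases lt_or_ge (i + k) w.length with hl | hl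
      · exact (SimpleGraph.dist_eq_one_iff_adj.mpr (w.adj_getVert_succ hl)).le
      · rw [w.getVert_of_length_le hl, w.getVert_of_length_le (by omega)]; simp
    omega

theorem IsGeodesicWalk.dist_getVert (hΓ : Γ.Connected) {a b : Y} {w : Γ.Walk a b}
    (hw : IsGeodesicWalk w) {i : ℕ} (hi : i ≤ w.length) : Γ.dist a (w.getVert i) = i := by
  have h1 := dist_getVert_le hΓ w 0 i
  have h2 := dist_getVert_le hΓ w i (w.length - i)
  rw [Nat.add_sub_cancel' hi, w.getVert_length] at h2
  rw [w.getVert_zero, zero_add] at h1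
  have h3 := hΓ.dist_triangle (u := a) (v := w.getVert i) (w := b)
  unfold IsGeodesicWalk at hw
  omega

theorem dist_of_mem_geodesic (hΓ : Γ.Connected) {a b z z' : Y} {w : Γ.Walk a b}
    (hw : IsGeodesicWalk w) (hz : z ∈ w.support) (hz' : z' ∈ w.support) :
    Γ.dist z z' ≤ (Γ.dist a z - Γ.dist a z') + (Γ.dist a z' - Γ.dist a z) := by
  obtain ⟨i, rfl, hi⟩ := SimpleGraph.Walk.mem_support_iff_exists_getVert.mp hz
  obtain ⟨j, rfl, hj⟩ := SimpleGraph.Walk.mem_support_iff_exists_getVert.mp hz'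
  rw [hw.dist_getVert hΓ hi, hw.dist_getVert hΓ hj]
  rcases le_total i j with h | h
  · have := dist_getVert_le hΓ w i (j - i)
    rw [Nat.add_sub_cancel' h] at this
    omega
  · have := dist_getVert_le hΓ w j (i - j)
    rw [Nat.add_sub_cancel' h] at this
    rw [SimpleGraph.dist_comm]
    omega

/-- Project both points to one common geodesic, where distance is the difference of the distances
from `a`; the two projections are used twice each, whence `4 * δ`. The sum of the two truncated
differences is an absolute value. -/
theorem IsNearGeodesics.dist_le (hΓ : Γ.Connected) {δ : ℕ} {a b p p' : Y}
    (h : IsNearGeodesics Γ δ a b p) (h' : IsNearGeodesics Γ δ a b p') :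
    Γ.dist p p' ≤ (Γ.dist a p - Γ.dist a p') + (Γ.dist a p' - Γ.dist a p) + 4 * δ := by
  obtain ⟨w, hw⟩ := hΓ.exists_walk_length_eq_dist a b
  obtain ⟨z, hz, hd⟩ := h w hw
  obtain ⟨z', hz', hd'⟩ := h' w hw
  have h0 := dist_of_mem_geodesic hΓ hw hz hz'
  have h1 := hΓ.dist_triangle (u := p) (v := z) (w := p')
  have h2 := hΓ.dist_triangle (u := z) (v := z') (w := p')
  have h3 := hΓ.dist_triangle (u := a) (v := z) (w := p)
  have h4 := hΓ.dist_triangle (u := a) (v := z') (w := p')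
  have h5 := hΓ.dist_triangle (u := a) (v := p) (w := z)
  have h6 := hΓ.dist_triangle (u := a) (v := p') (w := z')
  rw [Γ.dist_comm (u := z) (v := p)] at h3
  rw [Γ.dist_comm (u := z') (v := p')] at h2 h4
  omega

theorem dist_smul_smul {G : Type u} [Group G] [MulAction G Y]
    (hadj : ∀ (g : G) (a b : Y), Γ.Adj a b → Γ.Adj (g • a) (g • b)) (g : G) (a b : Y) :
    Γ.dist (g • a) (g • b) = Γ.dist a b := by
  have key : ∀ (g : G) (a b : Y), Γ.Reachable a b → Γ.dist (g • a) (g • b) ≤ Γ.dist a b := by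
    intro g a b hr
    obtain ⟨w, hw⟩ := hr.exists_walk_length_eq_dist
    let φ : Γ →g Γ := ⟨fun z => g • z, fun h => hadj g _ _ h⟩
    have := SimpleGraph.dist_le (w.map φ)
    rw [SimpleGraph.Walk.length_map, hw] at this
    exact this
  have hreach : ∀ (g : G) (a b : Y), Γ.Reachable a b → Γ.Reachable (g • a) (g • b) := by
    intro g a b hr
    let φ : Γ →g Γ := ⟨fun z => g • z, fun h => hadj g _ _ h⟩
    exact hr.map φ
  by_cases hr : Γ.Reachable a b
  · refine le_antisymm (key g a b hr) ?_
    have := key g⁻¹ _ _ (hreach g a b hr)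
    simpa using this
  · have hr' : ¬ Γ.Reachable (g • a) (g • b) := fun h => hr (by simpa using hreach g⁻¹ _ _ h)
    rw [SimpleGraph.dist_eq_zero_of_not_reachable hr, SimpleGraph.dist_eq_zero_of_not_reachable hr']

end Geodesics

/-! ### Uniform bounds for a bicombing -/

section Chains

variable {Y : Type y} {Γ : SimpleGraph Y}

/-- The factor `2` appears because `chainNorm` gives each ordered pair half of its absolute value,
whereas `F` may contain both orientations of an edge. -/
theorem sum_abs_le_chainNorm (a : Y × Y →₀ ℚ) (F : Finset (Y × Y)) :
    ∑ f ∈ F, |a f| ≤ 2 * chainNorm a := by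
  classical
  have h1 : 2 * chainNorm a = ∑ f ∈ a.support, |a f| := by
    unfold chainNorm Finsupp.sum
    rw [Finset.mul_sum]
    exact Finset.sum_congr rfl fun _ _ => by ring
  rw [h1, ← Finset.sum_filter_ne_zero F]
  refine Finset.sum_le_sum_of_subset_of_nonneg ?_ fun _ _ _ => abs_nonneg _
  intro f hf
  simpa using (Finset.mem_filter.mp hf).2

theorem abs_le_chainNorm (a : Y × Y →₀ ℚ) (f : Y × Y) : |a f| ≤ 2 * chainNorm a := by
  simpa using sum_abs_le_chainNorm a {f}

theorem chainSupp_finite (a : Y × Y →₀ ℚ) : (chainSupp a).Finite :=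
  a.support.finite_toSet.subset fun f hf => by
    have : 0 < a f := hf
    simp [this.ne']

/-- A bicombing with uniform natural constants, and the consequences of stability which are
used to count tracks. -/
structure IsUniformBicombing (G : Type u) [Group G] [MulAction G Y] (Γ : SimpleGraph Y)
    (q : Y → Y → (Y × Y →₀ ℚ)) (δ : ℕ) : Prop where
  connected : Γ.Connected
  adj_smul : ∀ (g : G) (a b : Y), Γ.Adj a b → Γ.Adj (g • a) (g • b)
  adj : ∀ a b, ∀ f ∈ chainSupp (q a b), Γ.Adj f.1 f.2
  swap : ∀ a b f, q a b f.swap = - q a b f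
  symm : ∀ a b f, q b a f = - q a b f
  smul : ∀ (g : G) a b f, q (g • a) (g • b) (g • f) = q a b f
  near_fst : ∀ a b, ∀ f ∈ chainSupp (q a b), IsNearGeodesics Γ δ a b f.1
  near_snd : ∀ a b, ∀ f ∈ chainSupp (q a b), IsNearGeodesics Γ δ a b f.2
  bounded : ∀ a b f, |q a b f| ≤ δ
  defect : ∀ a b c (F : Finset (Y × Y)), ∑ f ∈ F, |q a b f + q b c f + q c a f| ≤ δ

/-- The point is the uniform bound on coefficients, since `‖q a b‖` itself grows with the distance.
By stability, the coefficient at `f` agrees up to a constant with that of a subsegment of bounded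
length around `f`. -/
theorem exists_isUniformBicombing {G : Type u} [Group G] [MulAction G Y]
    {q : Y → Y → (Y × Y →₀ ℚ)} (hΓ : Γ.Connected)
    (hadj : ∀ (g : G) (a b : Y), Γ.Adj a b → Γ.Adj (g • a) (g • b))
    (hq : IsGloballyStableBicombing G Γ q) : ∃ δ, IsUniformBicombing G Γ q δ := by
  obtain ⟨δ₁, h₁⟩ := hq.quasigeodesic
  obtain ⟨δ₂, h₂⟩ := hq.bounded_defect
  obtain ⟨n, hn⟩ := exists_nat_ge (max δ₁ δ₂)
  have hn1 : δ₁ ≤ n := (le_max_left _ _).trans hn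
  have hn2 : δ₂ ≤ n := (le_max_right _ _).trans hn
  have near : ∀ a b, ∀ f ∈ chainSupp (q a b), ∀ w : Γ.Walk a b, IsGeodesicWalk w →
      ∃ z ∈ w.support, Γ.dist f.1 z ≤ n ∧ Γ.dist f.2 z ≤ n := by
    intro a b f hf w hw
    obtain ⟨z, hz, h1, h2⟩ := (h₁ a b).1 w hw f hf
    exact ⟨z, hz, by exact_mod_cast h1.trans hn1, by exact_mod_cast h2.trans hn1⟩
  have norm_le : ∀ a b, chainNorm (q a b) ≤ (n : ℚ) * Γ.dist a b := by
    intro a b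
    have h := (h₁ a b).2
    have : (chainNorm (q a b) : ℝ) ≤ (n : ℝ) * Γ.dist a b :=
      h.trans (mul_le_mul_of_nonneg_right hn1 (Nat.cast_nonneg _))
    exact_mod_cast this
  have defect_le : ∀ a b c, chainNorm (q a b + q b c + q c a) ≤ (n : ℚ) := by
    intro a b c
    have h := (h₂ a b c).trans hn2
    exact_mod_cast h
  have hsymm : ∀ a b f, q b a f = - q a b f := by
    intro a b f
    rw [hq.antisymmetric b a]; rfl
  have hdef : ∀ a b c f, |q a b f + q b c f + q c a f| ≤ 2 * n := by
    intro a b c f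
    have h := (abs_le_chainNorm (q a b + q b c + q c a) f).trans
      (mul_le_mul_of_nonneg_left (defect_le a b c) (by norm_num))
    simpa using h
  -- edges far from a geodesic have coefficient zero
  have hzero : ∀ a b f (w : Γ.Walk a b), IsGeodesicWalk w →
      (∀ z ∈ w.support, n < Γ.dist f.1 z) → q a b f = 0 := by
    intro a b f w hw hfar
    rcases lt_trichotomy (q a b f) 0 with h | h | h
    · have hf : f.swap ∈ chainSupp (q a b) := by
        change 0 < q a b f.swap
        rw [(hq.isOneChain a b).1 f]; linarith
      obtain ⟨z, hz, _, h2⟩ := near a b _ hf w hw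
      exact absurd h2 (not_le.mpr (hfar z hz))
    · exact h
    · obtain ⟨z, hz, h2, _⟩ := near a b f h w hw
      exact absurd h2 (not_le.mpr (hfar z hz))
  -- A point of the geodesic at distance at least `2 * n + 1` from a point within `n` of `f` is more
  -- than `n` from `f`, so `hzero` applies to the two outer pieces.
  let L := 2 * n + 1
  have bound_pos : ∀ a b f, f ∈ chainSupp (q a b) → |q a b f| ≤ 2 * (n * (2 * L)) + 4 * n := by
    intro a b f hf
    obtain ⟨w, hw'⟩ := hΓ.exists_walk_length_eq_dist a b
    have hw : IsGeodesicWalk w := hw'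
    obtain ⟨z, hz, hd, _⟩ := near a b f hf w hw
    obtain ⟨i, rfl, hi⟩ := SimpleGraph.Walk.mem_support_iff_exists_getVert.mp hz
    -- cut the geodesic at distance `L` on both sides of the point closest to `f`
    set z₁ := w.getVert (i - L) with hz₁
    set z₂ := w.getVert (i + L) with hz₂
    have hd12 : Γ.dist z₁ z₂ ≤ 2 * L := by
      have h := dist_getVert_le hΓ w (i - L) ((i + L) - (i - L))
      rw [Nat.add_sub_cancel' (by omega)] at h
      exact h.trans (by omega)
    have hmid : |q z₁ z₂ f| ≤ 2 * (n * (2 * L)) := by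
      refine (abs_le_chainNorm _ f).trans (mul_le_mul_of_nonneg_left ?_ (by norm_num))
      refine (norm_le _ _).trans (mul_le_mul_of_nonneg_left ?_ (Nat.cast_nonneg _))
      exact_mod_cast hd12
    -- If the truncated index `i - L` is `0`, the piece is trivial and `q a a = 0`; likewise at the
    -- other end, where `getVert` stays at `b` beyond the length.
    have hfst : q a z₁ f = 0 := by
      rcases le_or_gt i L with h | h
      · have : z₁ = a := by rw [hz₁, Nat.sub_eq_zero_of_le h, w.getVert_zero]
        rw [this, hq.self]; rfl
      · have hg : IsGeodesicWalk (w.take (i - L)) := by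
          unfold IsGeodesicWalk
          rw [hw.dist_getVert hΓ (by omega), SimpleGraph.Walk.take_length]
          omega
        refine hzero _ _ f _ hg fun y hy => ?_
        obtain ⟨j, rfl, hj⟩ := SimpleGraph.Walk.mem_support_iff_exists_getVert.mp hy
        rw [SimpleGraph.Walk.take_length] at hj
        have e : (w.take (i - L)).getVert j = w.getVert j := by
          rw [SimpleGraph.Walk.take_getVert]; congr 1; omega
        rw [e]
        have h1 := hw.dist_getVert hΓ hi
        have h2 := hw.dist_getVert hΓ (i := j) (by omega)
        have h3 := hΓ.dist_triangle (u := a) (v := w.getVert j) (w := w.getVert i)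
        have h4 := hΓ.dist_triangle (u := w.getVert j) (v := f.1) (w := w.getVert i)
        rw [Γ.dist_comm (u := w.getVert j) (v := f.1)] at h4
        omega
    have hsnd : q z₂ b f = 0 := by
      rcases le_or_gt w.length (i + L) with h | h
      · have : z₂ = b := w.getVert_of_length_le h
        rw [this, hq.self]; rfl
      · have hg : IsGeodesicWalk (w.drop (i + L)) := by
          unfold IsGeodesicWalk
          rw [SimpleGraph.Walk.drop_length]
          have h1 := hw.dist_getVert hΓ (i := i + L) h.le
          have h2 := hΓ.dist_triangle (u := a) (v := w.getVert (i + L)) (w := b)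
          have h3 := SimpleGraph.dist_le (w.drop (i + L))
          rw [SimpleGraph.Walk.drop_length] at h3
          unfold IsGeodesicWalk at hw
          omega
        refine hzero _ _ f _ hg fun y hy => ?_
        obtain ⟨j, rfl, hj⟩ := SimpleGraph.Walk.mem_support_iff_exists_getVert.mp hy
        rw [SimpleGraph.Walk.drop_length] at hj
        rw [SimpleGraph.Walk.drop_getVert]
        have h1 := hw.dist_getVert hΓ hi
        have h2 := hw.dist_getVert hΓ (i := i + L + j) (by omega)
        have h3 := hΓ.dist_triangle (u := a) (v := w.getVert i) (w := w.getVert (i + L + j))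
        have h4 := hΓ.dist_triangle (u := w.getVert i) (v := f.1) (w := w.getVert (i + L + j))
        rw [Γ.dist_comm (u := w.getVert i) (v := f.1)] at h4
        omega
    -- Two triangles express the coefficient over `a b` by those over the three pieces, at the cost
    -- of one defect `2 * n` each.
    have d1 := hdef a z₁ z₂ f
    have d2 := hdef a z₂ b f
    rw [hsymm a z₂ f] at d1
    rw [hsymm a b f] at d2
    rw [hfst] at d1
    rw [hsnd] at d2
    rw [abs_le] at *
    constructor <;> linarith [d1.1, d1.2, d2.1, d2.2, hmid.1, hmid.2]
  have bound : ∀ a b f, |q a b f| ≤ 2 * (n * (2 * L)) + 4 * n := by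
    intro a b f
    rcases lt_trichotomy (q a b f) 0 with h | h | h
    · have hf : f.swap ∈ chainSupp (q a b) := by
        change 0 < q a b f.swap
        rw [(hq.isOneChain a b).1 f]; linarith
      have := bound_pos a b _ hf
      rwa [(hq.isOneChain a b).1 f, abs_neg] at this
    · rw [h, abs_zero]; positivity
    · exact bound_pos a b f h
  have mono : ∀ {a b p : Y} {m : ℕ}, n ≤ m → IsNearGeodesics Γ n a b p →
      IsNearGeodesics Γ m a b p := fun hm h w hw => by
    obtain ⟨z, hz, hd⟩ := h w hw
    exact ⟨z, hz, hd.trans hm⟩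
  refine ⟨2 * (n * (2 * L)) + 4 * n, hΓ, hadj, fun a b f hf => ?_, fun a b => (hq.isOneChain a b).1,
    hsymm, hq.equivariant, fun a b f hf => mono (by omega) fun w hw => ?_,
    fun a b f hf => mono (by omega) fun w hw => ?_, fun a b f => by exact_mod_cast bound a b f,
    fun a b c F => ?_⟩
  · have : 0 < q a b f := hf
    exact (hq.isOneChain a b).2 f this.ne'
  · obtain ⟨z, hz, h, _⟩ := near a b f hf w hw
    exact ⟨z, hz, h⟩
  · obtain ⟨z, hz, _, h⟩ := near a b f hf w hw
    exact ⟨z, hz, h⟩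
  · have h := (sum_abs_le_chainNorm (q a b + q b c + q c a) F).trans
      (mul_le_mul_of_nonneg_left (defect_le a b c) (by norm_num))
    refine le_trans (by simpa using h) ?_
    push_cast
    have : (0 : ℚ) ≤ n * (2 * L) := by positivity
    linarith [(Nat.cast_nonneg n : (0 : ℚ) ≤ n)]

end Chains

/-! ### Local finiteness and proper actions -/

section LocallyFinite

variable {Y : Type y} {Γ : SimpleGraph Y}

theorem finite_walk_ball (h : ∀ a, {b | Γ.Adj a b}.Finite) (n : ℕ) (a : Y) :
    {b | ∃ w : Γ.Walk a b, w.length ≤ n}.Finite := by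
  induction n generalizing a with
  | zero =>
    refine (Set.finite_singleton a).subset ?_
    rintro b ⟨w, hw⟩
    exact (SimpleGraph.Walk.eq_of_length_eq_zero (Nat.le_zero.mp hw)).symm
  | succ n ih =>
    refine ((Set.finite_singleton a).union ((h a).biUnion fun c _ => ih c)).subset ?_
    rintro b ⟨w, hw⟩
    cases w with
    | nil => exact Or.inl rfl
    | cons hadj p =>
      refine Or.inr (Set.mem_biUnion hadj ⟨p, ?_⟩)
      rw [SimpleGraph.Walk.length_cons] at hw
      omega

theorem finite_ball (hΓ : Γ.Connected) (h : ∀ a, {b | Γ.Adj a b}.Finite) (n : ℕ) (a : Y) :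
    {b | Γ.dist a b ≤ n}.Finite := by
  refine (finite_walk_ball h n a).subset fun b hb => ?_
  obtain ⟨w, hw⟩ := hΓ.exists_walk_length_eq_dist a b
  exact ⟨w, hw.le.trans hb⟩

theorem finite_edist_ball (h : ∀ a, {b | Γ.Adj a b}.Finite) (n : ℕ) (a : Y) :
    {b | Γ.edist a b ≤ n}.Finite := by
  refine (finite_walk_ball h n a).subset fun b hb => ?_
  have hne : Γ.edist a b ≠ ⊤ := ne_top_of_le_ne_top (ENat.natCast_ne_top n) hb
  obtain ⟨w, hw⟩ := SimpleGraph.exists_walk_of_edist_ne_top hne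
  refine ⟨w, ?_⟩
  have hb' : Γ.edist a b ≤ n := hb
  rw [← hw] at hb'
  exact_mod_cast hb'

theorem finite_smul_eq {G : Type u} [Group G] {V : Type v} [MulAction G V] {a : V}
    (h : (MulAction.stabilizer G a : Set G).Finite) (b : V) : {g : G | g • a = b}.Finite := by
  rcases Set.eq_empty_or_nonempty {g : G | g • a = b} with he | ⟨g₀, hg₀⟩
  · rw [he]; exact Set.finite_empty
  · refine (h.image fun g => g₀ * g).subset fun g hg => ⟨g₀⁻¹ * g, ?_, by simp⟩
    have h1 : g • a = b := hg
    have h2 : g₀ • a = b := hg₀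
    change (g₀⁻¹ * g) • a = a
    rw [mul_smul, h1, ← h2, inv_smul_smul]

theorem finite_inv_smul_mem {G : Type u} [Group G] {V : Type v} [MulAction G V] {a : V}
    (h : (MulAction.stabilizer G a : Set G).Finite) {F : Set V} (hF : F.Finite) :
    {g : G | g⁻¹ • a ∈ F}.Finite := by
  have h1 : {g : G | g • a ∈ F}.Finite := by
    refine (hF.biUnion fun b _ => finite_smul_eq h b).subset fun g hg => ?_
    exact Set.mem_biUnion (x := g • a) hg rfl
  refine (h1.image fun g => g⁻¹).subset fun g hg => ⟨g⁻¹, hg, inv_inv g⟩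

end LocallyFinite

/-! ### The group action and balls in the cusped graph -/

section CuspedFacts

variable {G : Type u} [Group G] {ι : Type x} {V : Type v} [MulAction G V]
  {P : ι → Subgroup G} {X : SimpleGraph V} {A : ι → X.Subgraph}

theorem translateGraph_smul (c : (i : ι) × (G ⧸ P i)) (g : G) (a b : V) :
    (translateGraph P A c).Adj a b → (translateGraph P A (g • c)).Adj (g • a) (g • b) := by
  rintro ⟨h, hc, hadj⟩
  refine ⟨g * h, ?_, ?_⟩
  · change ((g * h : G) : G ⧸ P c.1) = g • c.2
    rw [← hc]; rfl
  · change (A c.1).Adj _ _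
    simpa [mul_smul] using hadj

theorem translateGraph_edist_smul (c : (i : ι) × (G ⧸ P i)) (g : G) (a b : V) :
    (translateGraph P A (g • c)).edist (g • a) (g • b) ≤ (translateGraph P A c).edist a b := by
  by_cases h : (translateGraph P A c).edist a b = ⊤
  · rw [h]; exact le_top
  · obtain ⟨w, hw⟩ := SimpleGraph.exists_walk_of_edist_ne_top h
    let φ : translateGraph P A c →g translateGraph P A (g • c) :=
      ⟨fun z => g • z, fun h => translateGraph_smul c g _ _ h⟩
    rw [← hw, ← SimpleGraph.Walk.length_map φ]
    exact SimpleGraph.edist_le _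

theorem cuspedGraph_adj_smul (hgeom : IsGeometricPair P X A) (g : G) (a b : CuspedVertex P A) :
    (cuspedGraph P X A).Adj a b → (cuspedGraph P X A).Adj (g • a) (g • b) := by
  rcases a with a | a <;> rcases b with b | b
  · exact hgeom.adj_smul g a b
  · rintro ⟨h1, h2⟩
    exact ⟨h1, congrArg (g • ·) h2⟩
  · rintro ⟨h1, h2⟩
    exact ⟨h1, congrArg (g • ·) h2⟩
  · rintro ⟨hb, h⟩
    refine ⟨congrArg (g • ·) hb, ?_⟩
    rcases h with ⟨h1, h2⟩ | ⟨h1, h2, h3⟩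
    · exact Or.inl ⟨congrArg (g • ·) h1, h2⟩
    · exact Or.inr ⟨fun h => h1 (MulAction.injective g h), h2,
        (translateGraph_edist_smul a.base g a.pt b.pt).trans h3⟩

theorem cusped_stabilizer_finite (hgeom : IsGeometricPair P X A) (a : CuspedVertex P A) :
    (MulAction.stabilizer G a : Set G).Finite := by
  rcases a with a | a
  · refine (hgeom.finite_stabilizer a).subset fun g hg => ?_
    exact Sum.inl_injective hg
  · refine (hgeom.finite_stabilizer a.pt).subset fun g hg => ?_
    have h : g • a = a := Sum.inr_injective hg
    exact congrArg HoroVertex.pt h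

theorem finite_neighbors_of_geometric (hgeom : IsGeometricPair P X A) (a : V) :
    {b | X.Adj a b}.Finite := by
  obtain ⟨F, hF, h⟩ := hgeom.cocompact_edges
  have : ∀ p ∈ F, {b | ∃ g : G, g • a = p.1 ∧ g • b = p.2}.Finite := by
    intro p _
    refine ((finite_smul_eq (hgeom.finite_stabilizer a) p.1).image fun g => g⁻¹ • p.2).subset ?_
    rintro b ⟨g, h1, h2⟩
    exact ⟨g, h1, by simp [← h2]⟩
  refine (hF.biUnion this).subset fun b hb => ?_
  obtain ⟨g, hg⟩ := h a b hb
  exact Set.mem_biUnion hg ⟨g, rfl, rfl⟩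

/-- Cocompactness of `P i` on `A i` lets the coset representative `g` be changed so that `g⁻¹ • a`
lies in a fixed finite set; properness leaves finitely many such `g`. -/
theorem finite_translates_through [Finite ι] (hgeom : IsGeometricPair P X A) (a : V) :
    {c | a ∈ translateVerts P A c}.Finite := by
  choose F hF h using hgeom.sub_cocompact_vertices
  have : ∀ i, ((fun g : G => (⟨i, g⟩ : (i : ι) × (G ⧸ P i))) '' {g | g⁻¹ • a ∈ F i}).Finite :=
    fun i => (finite_inv_smul_mem (hgeom.finite_stabilizer a) (hF i)).image _
  refine (Set.finite_iUnion this).subset ?_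
  rintro ⟨i, c⟩ ⟨g, hg, hm⟩
  obtain ⟨p, hp, hpF⟩ := h i _ hm
  refine Set.mem_iUnion.mpr ⟨i, g * p⁻¹, ?_, ?_⟩
  · change (g * p⁻¹)⁻¹ • a ∈ F i
    simpa [mul_smul] using hpF
  · have : ((g * p⁻¹ : G) : G ⧸ P i) = c := by
      have hg' : (g : G ⧸ P i) = c := hg
      rw [← hg', QuotientGroup.eq]
      simpa using hp
    rw [← this]

theorem translateGraph_le (hgeom : IsGeometricPair P X A) (c : (i : ι) × (G ⧸ P i)) {a b : V}
    (h : (translateGraph P A c).Adj a b) : X.Adj a b := by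
  obtain ⟨g, _, h⟩ := h
  simpa using hgeom.adj_smul g _ _ ((A c.1).adj_sub h)

/-- Over a vertex of `X` only finitely many horoballs are glued. Inside one horoball, horizontal
neighbours lie in a ball of a subgraph of the locally finite `X`, and vertical ones over the same
point at an adjacent level. -/
theorem finite_cusped_neighbors [Finite ι] (hgeom : IsGeometricPair P X A)
    (a : CuspedVertex P A) : {b | (cuspedGraph P X A).Adj a b}.Finite := by
  let key : HoroVertex P A → ((i : ι) × (G ⧸ P i)) × V × ℕ := fun b => (b.base, b.pt, b.lev)
  have hkey : Function.Injective key := fun b b' h => by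
    simp only [key, Prod.mk.injEq] at h
    exact HoroVertex.ext h.1 h.2.1 h.2.2
  have split : ∀ S : Set (CuspedVertex P A), {b | Sum.inl b ∈ S}.Finite →
      {b | Sum.inr b ∈ S}.Finite → S.Finite := by
    intro S h1 h2
    refine ((h1.image Sum.inl).union (h2.image Sum.inr)).subset ?_
    rintro (b | b) hb
    · exact Or.inl ⟨b, hb, rfl⟩
    · exact Or.inr ⟨b, hb, rfl⟩
  rcases a with a | a
  · refine split _ (finite_neighbors_of_geometric hgeom a) ?_
    refine Set.Finite.of_finite_image (f := key) ?_ hkey.injOn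
    refine ((finite_translates_through hgeom a).prod
      ((Set.finite_singleton a).prod (Set.finite_singleton 0))).subset ?_
    rintro _ ⟨b, ⟨h1, h2⟩, rfl⟩
    refine ⟨?_, h2, h1⟩
    have := b.mem
    rwa [h2] at this
  · refine split _ ((Set.finite_singleton a.pt).subset fun b hb => hb.2.symm) ?_
    refine Set.Finite.of_finite_image (f := key) ?_ hkey.injOn
    have hball : {b | (translateGraph P A a.base).edist a.pt b ≤
        ((2 ^ (a.lev + 1) : ℕ) : ℕ∞)}.Finite :=
      finite_edist_ball (Γ := translateGraph P A a.base)
        (fun c => (finite_neighbors_of_geometric hgeom c).subset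
          fun d hd => translateGraph_le hgeom a.base hd) _ _
    refine ((Set.finite_singleton a.base).prod (((Set.finite_singleton a.pt).union hball).prod
      (Set.finite_Iic (a.lev + 1)))).subset ?_
    rintro _ ⟨b, ⟨hb, h⟩, rfl⟩
    refine ⟨hb.symm, ?_, ?_⟩
    · rcases h with ⟨h1, _⟩ | ⟨_, _, h3⟩
      · exact Or.inl h1.symm
      · exact Or.inr h3
    · change b.lev ≤ a.lev + 1
      rcases h with ⟨_, h2⟩ | ⟨_, h2, _⟩ <;> omega

/-- The balls of given radius centred at the vertices of depth `0` have bounded size. -/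
theorem exists_ball_bound [Finite ι] (hgeom : IsGeometricPair P X A)
    (hconn : (cuspedGraph P X A).Connected) (D : ℕ) : ∃ B : ℕ, ∀ a : V,
      {b | (cuspedGraph P X A).dist (Sum.inl a) b ≤ D}.Finite ∧
      {b | (cuspedGraph P X A).dist (Sum.inl a) b ≤ D}.ncard ≤ B := by
  obtain ⟨F, hF, h⟩ := hgeom.cocompact_vertices
  have hfin : ∀ a : V, {b | (cuspedGraph P X A).dist (Sum.inl a) b ≤ D}.Finite :=
    fun a => finite_ball hconn (finite_cusped_neighbors hgeom) D _
  obtain ⟨B, hB⟩ := (hF.image fun a =>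
    {b | (cuspedGraph P X A).dist (Sum.inl a) b ≤ D}.ncard).bddAbove
  refine ⟨B, fun a => ⟨hfin a, ?_⟩⟩
  obtain ⟨g, hg⟩ := h a
  -- Translation by `g` embeds the ball about `a` in the ball of the same radius about the
  -- representative `g • a`.
  refine le_trans ?_ (hB ⟨g • a, hg, rfl⟩)
  refine Set.ncard_le_ncard_of_injOn (fun b => g • b) ?_ (MulAction.injective g).injOn (hfin _)
  intro b hb
  have := dist_smul_smul (cuspedGraph_adj_smul hgeom) g (Sum.inl a) b
  change (cuspedGraph P X A).dist (g • Sum.inl a) (g • b) ≤ D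
  rw [this]; exact hb

theorem exists_dist_le_depth (hconn : (cuspedGraph P X A).Connected) (b : CuspedVertex P A) :
    ∃ a : V, (cuspedGraph P X A).dist (Sum.inl a) b ≤ cuspedDepth b := by
  rcases b with b | b
  · exact ⟨b, by simp⟩
  · refine ⟨b.pt, ?_⟩
    have key : ∀ n : ℕ, (cuspedGraph P X A).dist (Sum.inl b.pt)
        (Sum.inr ⟨b.base, b.pt, b.mem, n⟩) ≤ n + 1 := by
      intro n
      induction n with
      | zero =>
        refine (SimpleGraph.dist_eq_one_iff_adj.mpr ?_).le
        exact ⟨rfl, rfl⟩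
      | succ n ih =>
        have hadj : (cuspedGraph P X A).Adj (Sum.inr ⟨b.base, b.pt, b.mem, n⟩)
            (Sum.inr ⟨b.base, b.pt, b.mem, n + 1⟩) := ⟨rfl, Or.inl ⟨rfl, Or.inl rfl⟩⟩
        have h1 := SimpleGraph.dist_eq_one_iff_adj.mpr hadj
        have h2 := hconn.dist_triangle (u := Sum.inl b.pt)
          (v := Sum.inr ⟨b.base, b.pt, b.mem, n⟩) (w := Sum.inr ⟨b.base, b.pt, b.mem, n + 1⟩)
        omega
    exact key b.lev

end CuspedFacts

/-! ### Ends and finite coboundaries -/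

section Ends

/-- In a connected locally finite infinite graph, every infinite component of the complement of a
finite set is chosen by some end. -/
theorem exists_end_of_infinite {V : Type v} (Γ : SimpleGraph V) [Γ.LocallyFinite]
    (hΓ : Γ.Preconnected) [Infinite V] (K : Finset V) (C : Γ.ComponentCompl (K : Set V))
    (hC : C.supp.Infinite) :
    ∃ e : Γ.end, (e : (j : (Finset V)ᵒᵖ) → Γ.componentComplFunctor.obj j) (Opposite.op K) = C := by
  have : Fact Γ.Preconnected := ⟨hΓ⟩
  let F := Γ.componentComplFunctor
  have hfin : ∀ j, Finite (F.obj j) := fun j => SimpleGraph.componentCompl_finite j.unop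
  have hne : ∀ j, Nonempty (F.obj j) := fun j =>
    SimpleGraph.componentCompl_nonempty_of_infinite Γ j.unop
  have hML : F.IsMittagLeffler :=
    F.isMittagLeffler_of_exists_finite_range fun j =>
      ⟨j, CategoryTheory.CategoryStruct.id j, Set.toFinite _⟩
  have := fun j => F.toEventualRanges_nonempty hML j
  -- Infinite components are exactly the elements in the image of every later stage of the inverse
  -- system. The stages are finite and nonempty, so such an element extends to a section, that is,
  -- to an end.
  have hmem : C ∈ F.eventualRange (Opposite.op K) :=
    (Γ.infinite_iff_in_eventualRange (K := Opposite.op K) C).mp hC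
  obtain ⟨s, hs⟩ := F.toEventualRanges.eval_section_surjective_of_surjective
    (F.surjective_toEventualRanges hML) (Opposite.op K) ⟨C, hmem⟩
  refine ⟨F.toEventualRangesSectionsEquiv s, ?_⟩
  exact congrArg Subtype.val hs

/-- If the complement of a finite set has an infinite set of vertices in it which is a union of
components, then one of these components is infinite. -/
theorem exists_infinite_component {V : Type v} (Γ : SimpleGraph V) [Γ.LocallyFinite]
    (hΓ : Γ.Preconnected) (K : Finset V) (A : Set V) (hA : A.Infinite)
    (hK : ∀ a b, Γ.Adj a b → a ∉ K → b ∉ K → (a ∈ A ↔ b ∈ A)) :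
    ∃ C : Γ.ComponentCompl (K : Set V), C.supp.Infinite ∧ C.supp ⊆ A := by
  have : Fact Γ.Preconnected := ⟨hΓ⟩
  have := SimpleGraph.componentCompl_finite (G := Γ) K
  have hconst : ∀ C : Γ.ComponentCompl (K : Set V), C.supp ⊆ A ∨ Disjoint C.supp A := by
    have key : ∀ a b : (((K : Set V)ᶜ : Set V) : Type v), (Γ.induce (K : Set V)ᶜ).Reachable a b →
        (a.1 ∈ A ↔ b.1 ∈ A) := by
      rintro a b ⟨w⟩
      induction w with
      | nil => exact Iff.rfl
      | @cons a b _ h _ ih => exact (hK _ _ h a.2 b.2).trans ih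
    intro C
    by_cases h : ∃ a ∈ C.supp, a ∈ A
    · obtain ⟨a, ⟨ha, hC⟩, haA⟩ := h
      left
      rintro b ⟨hb, hC'⟩
      have : (Γ.induce (K : Set V)ᶜ).Reachable ⟨a, ha⟩ ⟨b, hb⟩ :=
        SimpleGraph.ConnectedComponent.exact (hC.trans hC'.symm)
      exact (key _ _ this).mp haA
    · right
      rw [Set.disjoint_left]
      exact fun a ha haA => h ⟨a, ha, haA⟩
  by_contra hcon
  push Not at hcon
  refine hA ?_
  have hfin : ∀ C : Γ.ComponentCompl (K : Set V), (C.supp ∩ A).Finite := by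
    intro C
    rcases hconst C with h | h
    · by_contra hinf
      exact hcon C (Set.Infinite.mono Set.inter_subset_left hinf) h
    · rw [h.inter_eq]; exact Set.finite_empty
  refine (K.finite_toSet.union (Set.finite_iUnion hfin)).subset fun a ha => ?_
  by_cases haK : a ∈ (K : Set V)
  · exact Or.inl haK
  · exact Or.inr (Set.mem_iUnion.mpr
      ⟨Γ.componentComplMk haK, Γ.componentComplMk_mem haK, ha⟩)

/-- Delete the finitely many inner endpoints of boundary edges. What is left of `A` and of its
complement are unions of components; if both are infinite, each contains an infinite component, and
these give two different ends. -/
theorem finite_or_finite_compl_of_end {V : Type v} (Γ : SimpleGraph V) [Γ.LocallyFinite]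
    (hΓ : Γ.Preconnected) (hend : ∃! e, e ∈ Γ.end) (A : Set V)
    (hA : {p : V × V | Γ.Adj p.1 p.2 ∧ p.1 ∈ A ∧ p.2 ∉ A}.Finite) : A.Finite ∨ Aᶜ.Finite := by
  classical
  by_contra! hcon
  have h1 : A.Infinite := hcon.1
  have h2 : Aᶜ.Infinite := hcon.2
  have : Infinite V := Set.infinite_univ_iff.mp (h1.mono (Set.subset_univ _))
  let K : Finset V := (hA.image Prod.fst).toFinset
  have hK : ∀ a b, Γ.Adj a b → a ∉ K → b ∉ K → (a ∈ A ↔ b ∈ A) := by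
    have : ∀ a b, Γ.Adj a b → a ∉ K → a ∈ A → b ∈ A := by
      intro a b hab ha haA
      by_contra hb
      exact ha ((Set.Finite.mem_toFinset _).mpr ⟨(a, b), ⟨hab, haA, hb⟩, rfl⟩)
    exact fun a b hab ha hb => ⟨this a b hab ha, this b a hab.symm hb⟩
  obtain ⟨C₁, hi₁, hs₁⟩ := exists_infinite_component Γ hΓ K A h1 hK
  obtain ⟨C₂, hi₂, hs₂⟩ := exists_infinite_component Γ hΓ K Aᶜ h2
    fun a b hab ha hb => not_congr (hK a b hab ha hb)
  obtain ⟨e₁, he₁⟩ := exists_end_of_infinite Γ hΓ K C₁ hi₁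
  obtain ⟨e₂, he₂⟩ := exists_end_of_infinite Γ hΓ K C₂ hi₂
  have he : e₁ = e₂ := Subtype.ext (hend.unique e₁.2 e₂.2)
  have hC : C₁ = C₂ := by rw [← he₁, he, he₂]
  obtain ⟨a, ha⟩ := hi₁.nonempty
  exact hs₂ (hC ▸ ha) (hs₁ ha)

end Ends

/-! ### Finite coboundaries under a one-ended group -/

section OneEnded

variable {G : Type u} [Group G]

theorem mulCayley_neighborSet_finite (S : Finset G) (a : G) :
    ((SimpleGraph.mulCayley (S : Set G)).neighborSet a).Finite := by
  refine ((S.finite_toSet.image fun s => a * s).union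
    (S.finite_toSet.image fun s => a * s⁻¹)).subset ?_
  intro b hb
  rw [SimpleGraph.mem_neighborSet, SimpleGraph.mulCayley_adj'] at hb
  obtain ⟨_, g, hg, h | h⟩ := hb
  · exact Or.inl ⟨g, hg, h⟩
  · exact Or.inr ⟨g, hg, by simp [h]⟩

theorem mulCayley_preconnected (S : Finset G) (hS : Subgroup.closure (S : Set G) = ⊤) :
    (SimpleGraph.mulCayley (S : Set G)).Preconnected := by
  have step : ∀ s ∈ S, ∀ a : G, (SimpleGraph.mulCayley (S : Set G)).Reachable a (a * s) := by
    intro s hs a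
    by_cases h : a = a * s
    · rw [← h]
    · exact SimpleGraph.Adj.reachable
        ((SimpleGraph.mulCayley_adj' _ _ _).mpr ⟨h, s, hs, Or.inl rfl⟩)
  have key : ∀ g ∈ Subgroup.closure (S : Set G), ∀ a : G,
      (SimpleGraph.mulCayley (S : Set G)).Reachable a (a * g) := by
    intro g hg
    induction hg using Subgroup.closure_induction with
    | mem s hs => exact step s hs
    | one => intro a; rw [mul_one]
    | mul g h _ _ ihg ihh => intro a; rw [← mul_assoc]; exact (ihg a).trans (ihh _)
    | inv g _ ih => intro a; simpa using (ih (a * g⁻¹)).symm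
  intro a b
  have := key (a⁻¹ * b) (by rw [hS]; trivial) a
  rwa [mul_inv_cancel_left] at this

/-- An end would have to choose a nonempty component of the complement of the whole of a finite
group. -/
theorem IsOneEnded.infinite (h : IsOneEnded G) : Infinite G := by
  obtain ⟨S, _, e, he, _⟩ := h
  by_contra hfin
  rw [not_infinite_iff_finite] at hfin
  have := Fintype.ofFinite G
  obtain ⟨v, hv⟩ := SimpleGraph.ComponentCompl.nonempty (e (Opposite.op Finset.univ))
  exact (e (Opposite.op Finset.univ)).notMem_of_mem hv (by simp)

/-- A set of vertices with finite coboundary, in a connected graph on which a one-ended group acts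
freely and with finitely many orbits of vertices, is finite or cofinite. -/
theorem IsOneEnded.finite_or_finite_compl (h : IsOneEnded G) {W : Type w} [MulAction G W]
    (Δ : SimpleGraph W) (hΔ : Δ.Connected)
    (hadj : ∀ (g : G) (a b : W), Δ.Adj a b → Δ.Adj (g • a) (g • b))
    (hfree : ∀ (g : G) (a : W), g • a = a → g = 1)
    (hcoc : ∃ F : Set W, F.Finite ∧ ∀ a, ∃ g : G, g • a ∈ F) (A : Set W)
    (hA : {p : W × W | Δ.Adj p.1 p.2 ∧ p.1 ∈ A ∧ p.2 ∉ A}.Finite) : A.Finite ∨ Aᶜ.Finite := by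
  obtain ⟨S, hS, hend⟩ := h
  have hinj : ∀ (a : W) (g g' : G), g • a = g' • a → g = g' := by
    intro a g g' h
    have := hfree (g'⁻¹ * g) a (by rw [mul_smul, h, inv_smul_smul])
    rwa [inv_mul_eq_one, eq_comm] at this
  -- few translates of a given walk cross the coboundary
  have hcross : ∀ a b : W, {g : G | g • a ∈ A ∧ g • b ∉ A}.Finite := by
    intro a b
    obtain ⟨w⟩ := hΔ.preconnected a b
    induction w with
    | nil => exact Set.finite_empty.subset fun g hg => hg.2 hg.1
    | @cons a c b hac _ ih =>
      have h1 : {g : G | g • a ∈ A ∧ g • c ∉ A}.Finite := by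
        refine Set.Finite.of_finite_image (f := fun g => (g • a, g • c)) (hA.subset ?_) ?_
        · rintro _ ⟨g, hg, rfl⟩
          exact ⟨hadj g _ _ hac, hg.1, hg.2⟩
        · intro g _ g' _ hgg
          exact hinj a g g' (Prod.mk.inj hgg).1
      refine (h1.union ih).subset fun g hg => ?_
      by_cases hc : g • c ∈ A
      · exact Or.inr ⟨hc, hg.2⟩
      · exact Or.inl ⟨hg.1, hc⟩
  obtain ⟨a₀⟩ := hΔ.nonempty
  -- Pull `A` back to the Cayley graph along the orbit map at `a₀`; by `hcross` each generator
  -- contributes finitely many boundary edges.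
  let A' : Set G := {g | g • a₀ ∈ A}
  have : (SimpleGraph.mulCayley (S : Set G)).LocallyFinite := fun a =>
    (mulCayley_neighborSet_finite S a).fintype
  have hA' : A'.Finite ∨ A'ᶜ.Finite := by
    refine finite_or_finite_compl_of_end _ (mulCayley_preconnected S hS) hend A' ?_
    have hfin : (⋃ s ∈ S, ((fun g => (g, g * s)) '' {g : G | g • a₀ ∈ A ∧ g • (s • a₀) ∉ A} ∪
        (fun g => (g, g * s⁻¹)) '' {g : G | g • a₀ ∈ A ∧ g • (s⁻¹ • a₀) ∉ A})).Finite :=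
      S.finite_toSet.biUnion fun s _ => ((hcross _ _).image _).union ((hcross _ _).image _)
    refine hfin.subset ?_
    rintro ⟨g, g'⟩ ⟨hadj', hg, hg'⟩
    rw [SimpleGraph.mulCayley_adj'] at hadj'
    obtain ⟨_, s, hs, h | h⟩ := hadj'
    · refine Set.mem_biUnion hs (Or.inl ⟨g, ⟨hg, ?_⟩, Prod.ext rfl h⟩)
      rw [← mul_smul]
      change (g * s) • a₀ ∉ A
      rw [show g * s = g' from h]
      exact hg'
    · have h' : g * s⁻¹ = g' := by rw [show g = g' * s from h]; simp
      refine Set.mem_biUnion hs (Or.inr ⟨g, ⟨hg, ?_⟩, Prod.ext rfl h'⟩)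
      rw [← mul_smul, h']
      exact hg'
  obtain ⟨F, hF, hFc⟩ := hcoc
  -- Finiteness of a vertex set can be tested on the finitely many orbits, and by `hcross` any orbit
  -- may be compared with that of `a₀` up to finitely many elements.
  have hcover : ∀ B : Set W, (∀ b ∈ F, {g : G | g • b ∈ B}.Finite) → B.Finite := by
    intro B hB
    refine (hF.biUnion fun b hb => (hB b hb).image fun g => g • b).subset fun a ha => ?_
    obtain ⟨g, hg⟩ := hFc a
    refine Set.mem_biUnion hg ⟨g⁻¹, ?_, inv_smul_smul g a⟩
    change g⁻¹ • (g • a) ∈ B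
    rwa [inv_smul_smul]
  rcases hA' with hA' | hA'
  · left
    refine hcover A fun b _ => (hA'.union (hcross b a₀)).subset fun g hg => ?_
    by_cases hg' : g • a₀ ∈ A
    · exact Or.inl hg'
    · exact Or.inr ⟨hg, hg'⟩
  · right
    refine hcover Aᶜ fun b _ => (hA'.union (hcross a₀ b)).subset fun g hg => ?_
    by_cases hg' : g • a₀ ∈ A
    · exact Or.inr ⟨hg', hg⟩
    · exact Or.inl hg'

end OneEnded

/-! ### Cocycles on a simply connected complex -/

section Cuts

variable {W : Type w} [DecidableEq W] {K : AbstractSimplicialComplex W}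

/-- The sum of a function on oriented edges along an edge path. -/
def walkSum (η : W → W → ℤ) : {a b : W} → (oneSkeleton K).Walk a b → ℤ
  | _, _, .nil => 0
  | a, _, .cons (v := b) _ p => η a b + walkSum η p

theorem walkSum_append (η : W → W → ℤ) {a b c : W} (p : (oneSkeleton K).Walk a b)
    (r : (oneSkeleton K).Walk b c) : walkSum η (p.append r) = walkSum η p + walkSum η r := by
  induction p with
  | nil => simp [walkSum]
  | cons h p ih => simp [walkSum, ih, add_assoc]

theorem walkSum_eq_of_edgeHomotopic {η : W → W → ℤ} (hanti : ∀ a b, η b a = - η a b)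
    (hcoc : ∀ a b c, (oneSkeleton K).Adj a b → (oneSkeleton K).Adj b c → (oneSkeleton K).Adj a c →
      {a, b, c} ∈ K.faces → η a b + η b c = η a c)
    {a b : W} {p r : (oneSkeleton K).Walk a b} (h : EdgeHomotopic K p r) :
    walkSum η p = walkSum η r := by
  induction h with
  | refl => rfl
  | symm _ ih => exact ih.symm
  | trans _ _ ih₁ ih₂ => exact ih₁.trans ih₂
  | cons _ _ ih => simp [walkSum, ih]
  | @backtrack a b c h h' p => simp [walkSum, hanti a b]
  | @triangle a b c d hab hbc hac hf p =>
    simp only [walkSum]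
    linarith [hcoc a b c hab hbc hac hf]

/-- A 1-cocycle on a simply connected complex is a coboundary. -/
theorem exists_potential (hK : IsSimplyConnectedComplex K) {η : W → W → ℤ}
    (hanti : ∀ a b, η b a = - η a b)
    (hcoc : ∀ a b c, (oneSkeleton K).Adj a b → (oneSkeleton K).Adj b c → (oneSkeleton K).Adj a c →
      {a, b, c} ∈ K.faces → η a b + η b c = η a c) :
    ∃ h : W → ℤ, ∀ a b, (oneSkeleton K).Adj a b → h b = h a + η a b := by
  obtain ⟨hconn, hsc⟩ := hK
  obtain ⟨a₀⟩ := hconn.nonempty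
  let w : ∀ a, (oneSkeleton K).Walk a₀ a := fun a => (hconn.preconnected a₀ a).some
  have hclosed : ∀ (a : W) (p : (oneSkeleton K).Walk a a), walkSum η p = 0 := fun a p => by
    rw [walkSum_eq_of_edgeHomotopic hanti hcoc (hsc a p)]; rfl
  refine ⟨fun a => walkSum η (w a), fun a b hab => ?_⟩
  have h1 := hclosed _ (((w a).append (.cons hab .nil)).append (w b).reverse)
  -- This identifies the sum along the reversed path with minus the sum along the path, so that `h1`
  -- becomes the potential equation.
  have h2 := hclosed _ ((w b).append (w b).reverse)
  rw [walkSum_append] at h1 h2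
  rw [walkSum_append] at h1
  simp only [walkSum] at h1
  linarith

end Cuts

/-! ### Finite tracks: uniqueness and mutual position -/

section Tracks

variable {G : Type u} [Group G] {Y : Type y} [MulAction G Y] {Γ : SimpleGraph Y}
  {q : Y → Y → (Y × Y →₀ ℚ)} {δ : ℕ} {W : Type w} [DecidableEq W]
  {K : AbstractSimplicialComplex W}

/-- The edge from `a` to `b` leaves the set `S` of vertices of `K`. -/
def IsExit (K : AbstractSimplicialComplex W) (S : Set W) (a b : W) : Prop :=
  (oneSkeleton K).Adj a b ∧ a ∈ S ∧ b ∉ S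

/-- The vertices `a`, `b`, `d` span a 2-simplex. -/
def IsTriangle (K : AbstractSimplicialComplex W) (a b d : W) : Prop :=
  (oneSkeleton K).Adj a b ∧ (oneSkeleton K).Adj b d ∧ (oneSkeleton K).Adj a d ∧
    ({a, b, d} : Finset W) ∈ K.faces

/-- The edges leaving the finite set `S` form a track without singular connectors, all of whose
connectors are attached to `f`, oriented outwards. -/
structure FinTrack (q : Y → Y → (Y × Y →₀ ℚ)) (K : AbstractSimplicialComplex W) (Φ : W → Y)
    (f : Y × Y) (S : Set W) : Prop where
  finite : S.Finite
  nonempty : ∃ a b, IsExit K S a b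
  cross : ∀ a b, IsExit K S a b → f ∈ chainSupp (q (Φ a) (Φ b))
  -- Connectedness as an induction principle: a property of exit edges that passes through every
  -- regular segment, from one side of a 2-simplex to another, holds everywhere once it holds
  -- somewhere.
  connected : ∀ Q : W → W → Prop,
    (∀ a b d, IsTriangle K a b d → IsExit K S a b →
      (d ∉ S → f ∉ chainSupp (q (Φ b) (Φ d)) → f.swap ∉ chainSupp (q (Φ b) (Φ d)) →
        Q a b → Q a d) ∧
      (d ∈ S → f ∉ chainSupp (q (Φ a) (Φ d)) → f.swap ∉ chainSupp (q (Φ a) (Φ d)) →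
        Q a b → Q d b)) →
    ∀ a b a' b', IsExit K S a b → IsExit K S a' b' → Q a b → Q a' b'

theorem eq_empty_or_univ_of_no_exit (hK : (oneSkeleton K).Connected) {Z : Set W}
    (h : ∀ a b, ¬ IsExit K Z a b) : Z = ∅ ∨ Z = Set.univ := by
  rcases Set.eq_empty_or_nonempty Z with he | ⟨a, ha⟩
  · exact Or.inl he
  · right
    refine Set.eq_univ_of_forall fun b => ?_
    obtain ⟨p⟩ := hK.preconnected a b
    induction p with
    | nil => exact ha
    | @cons a c b hac _ ih => exact ih (by_contra fun hc => h a c ⟨hac, ha, hc⟩)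

/-- Used repeatedly for unions, intersections and differences of inner sets: a nonempty finite set
of vertices of an infinite connected graph must have an exit edge. -/
theorem false_of_no_exit [Infinite W] (hK : (oneSkeleton K).Connected) {Z : Set W}
    (hfin : Z.Finite) (hne : Z.Nonempty) (h : ∀ a b, ¬ IsExit K Z a b) : False := by
  rcases eq_empty_or_univ_of_no_exit hK h with he | he
  · exact hne.ne_empty he
  · exact Set.infinite_univ (he ▸ hfin)

theorem IsUniformBicombing.mem_swap_iff (hq : IsUniformBicombing G Γ q δ) {a b : Y}
    {f : Y × Y} : f.swap ∈ chainSupp (q b a) ↔ f ∈ chainSupp (q a b) := by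
  change 0 < q b a f.swap ↔ 0 < q a b f
  rw [hq.swap, hq.symm a b, neg_neg]

theorem IsUniformBicombing.swap_notMem (hq : IsUniformBicombing G Γ q δ) {a b : Y}
    {f : Y × Y} (h : f ∈ chainSupp (q a b)) : f ∉ chainSupp (q b a) := by
  intro h'
  have h1 : 0 < q a b f := h
  have h2 : 0 < q b a f := h'
  rw [hq.symm a b] at h2
  linarith

theorem IsUniformBicombing.smul_mem_iff (hq : IsUniformBicombing G Γ q δ) (g : G) {a b : Y}
    {f : Y × Y} : g • f ∈ chainSupp (q (g • a) (g • b)) ↔ f ∈ chainSupp (q a b) := by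
  change 0 < q (g • a) (g • b) (g • f) ↔ 0 < q a b f
  rw [hq.smul]

/-- Two tracks of the same type with a common inner vertex coincide. -/
theorem FinTrack.exit_of_exit [Infinite W] (hq : IsUniformBicombing G Γ q δ)
    (hK : (oneSkeleton K).Connected) {Φ : W → Y} {f : Y × Y} {S S' : Set W}
    (hS : FinTrack q K Φ f S) (hS' : FinTrack q K Φ f S') {x y z : W}
    (hy : IsExit K S x y) (hz : IsExit K S' x z) : IsExit K S' x y := by
  -- a track having an edge in common with another one is contained in it
  have key : ∀ {S S' : Set W}, FinTrack q K Φ f S → FinTrack q K Φ f S' →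
      (∃ a b, IsExit K S a b ∧ IsExit K S' a b) → ∀ a b, IsExit K S a b → IsExit K S' a b := by
    rintro S S' hS hS' ⟨a₀, b₀, h₀, h₀'⟩ a b hab
    refine hS.connected (IsExit K S') ?_ a₀ b₀ a b h₀ hab h₀'
    intro a b d ⟨_, hbd, had, _⟩ _
    refine ⟨fun _ h1 h2 h => ⟨had, h.2.1, fun hd => ?_⟩, fun _ h1 h2 h => ⟨hbd.symm, ?_, h.2.2⟩⟩
    · exact h2 (hq.mem_swap_iff.mpr (hS'.cross d b ⟨hbd.symm, hd, h.2.2⟩))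
    · by_contra hd
      exact h1 (hS'.cross a d ⟨had, h.2.1, hd⟩)
  -- tracks without common edge do not cross
  have key2 : ∀ {S S' : Set W}, FinTrack q K Φ f S → FinTrack q K Φ f S' →
      (∀ a b, IsExit K S a b → ¬ IsExit K S' a b) → (∃ a b, IsExit K S a b ∧ a ∈ S') →
      ∀ a b, IsExit K S a b → a ∈ S' ∧ b ∈ S' := by
    rintro S S' hS hS' hdis ⟨a₀, b₀, h₀, h₀'⟩ a b hab
    have hmem : ∀ a b, IsExit K S a b → a ∈ S' → b ∈ S' := fun a b hab ha =>
      by_contra fun hb => hdis a b hab ⟨hab.1, ha, hb⟩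
    refine hS.connected (fun a b => a ∈ S' ∧ b ∈ S') ?_ a₀ b₀ a b h₀ hab ⟨h₀', hmem _ _ h₀ h₀'⟩
    intro a b d ⟨_, hbd, had, _⟩ hab
    refine ⟨fun hd _ _ h => ⟨h.1, hmem a d ⟨had, hab.2.1, hd⟩ h.1⟩,
      fun hd h1 _ h => ⟨by_contra fun hd' => ?_, h.2⟩⟩
    exact h1 (hS'.cross a d ⟨had, h.1, hd'⟩)
  by_contra hcon
  have hdis : ∀ a b, IsExit K S a b → ¬ IsExit K S' a b := fun a b h h' =>
    hcon (key hS hS' ⟨a, b, h, h'⟩ x y hy)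
  have h1 := key2 hS hS' hdis ⟨x, y, hy, hz.2.1⟩
  have h2 := key2 hS' hS (fun a b h h' => hdis a b h' h) ⟨x, z, hz, hy.2.1⟩
  -- With no common edge, each track lies entirely inside the inner set of the other, as both inner
  -- sets contain `x`. Then nothing leaves their union.
  refine false_of_no_exit hK (hS.finite.union hS'.finite) ⟨x, Or.inl hy.2.1⟩ ?_
  rintro a b ⟨hab, ha | ha, hb⟩
  · exact hb (Or.inr (h1 a b ⟨hab, ha, fun h => hb (Or.inl h)⟩).2)
  · exact hb (Or.inl (h2 a b ⟨hab, ha, fun h => hb (Or.inr h)⟩).2)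

/-- The translate of a track. -/
theorem FinTrack.smul [MulAction G W] (hq : IsUniformBicombing G Γ q δ) {Φ : W → Y}
    (hΦ : ∀ (g : G) a, Φ (g • a) = g • Φ a)
    (hsimp : ∀ (g : G), ∀ s ∈ K.faces, g • s ∈ K.faces) {f : Y × Y} {S : Set W}
    (hS : FinTrack q K Φ f S) (g : G) : FinTrack q K Φ (g • f) (g • S) := by
  have hadj : ∀ (g : G) a b, (oneSkeleton K).Adj a b → (oneSkeleton K).Adj (g • a) (g • b) :=
    fun g a b h => ⟨fun he => h.1 (MulAction.injective g he), by
      have := hsimp g _ h.2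
      rwa [Finset.smul_finset_insert, Finset.smul_finset_singleton] at this⟩
  have hexit : ∀ a b, IsExit K (g • S) a b ↔ IsExit K S (g⁻¹ • a) (g⁻¹ • b) := by
    intro a b
    unfold IsExit
    rw [Set.mem_smul_set_iff_inv_smul_mem, Set.mem_smul_set_iff_inv_smul_mem]
    refine and_congr_left fun _ => ⟨hadj g⁻¹ a b, fun h => by simpa using hadj g _ _ h⟩
  have htri : ∀ a b d, IsTriangle K a b d → IsTriangle K (g⁻¹ • a) (g⁻¹ • b) (g⁻¹ • d) :=
    fun a b d h => ⟨hadj _ _ _ h.1, hadj _ _ _ h.2.1, hadj _ _ _ h.2.2.1, by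
      have := hsimp g⁻¹ _ h.2.2.2
      rwa [Finset.smul_finset_insert, Finset.smul_finset_insert,
        Finset.smul_finset_singleton] at this⟩
  have hmem : ∀ a b (f : Y × Y), g • f ∈ chainSupp (q (Φ a) (Φ b)) ↔
      f ∈ chainSupp (q (Φ (g⁻¹ • a)) (Φ (g⁻¹ • b))) := by
    intro a b f
    rw [← hq.smul_mem_iff g (f := f), ← hΦ, ← hΦ, smul_inv_smul g a, smul_inv_smul g b]
  have hswap : (g • f).swap = g • f.swap := rfl
  refine ⟨hS.finite.smul_set, ?_, ?_, ?_⟩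
  · obtain ⟨a, b, h⟩ := hS.nonempty
    exact ⟨g • a, g • b, (hexit _ _).mpr (by simpa using h)⟩
  · intro a b h
    exact (hmem _ _ _).mpr (hS.cross _ _ ((hexit _ _).mp h))
  · intro Q hQ a b a' b' h h' hab
    have := hS.connected (fun a b => Q (g • a) (g • b)) ?_ _ _ _ _ ((hexit _ _).mp h)
      ((hexit _ _).mp h') (by simpa using hab)
    · simpa using this
    · intro a b d ht he
      have h1 := hQ (g • a) (g • b) (g • d) (by
        refine ⟨hadj _ _ _ ht.1, hadj _ _ _ ht.2.1, hadj _ _ _ ht.2.2.1, ?_⟩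
        have := hsimp g _ ht.2.2.2
        rwa [Finset.smul_finset_insert, Finset.smul_finset_insert,
          Finset.smul_finset_singleton] at this) ((hexit _ _).mpr (by simpa using he))
      simp only [hswap, hmem, inv_smul_smul, Set.smul_mem_smul_set_iff] at h1
      exact h1

/-- For an edge from `a` to `b` at distances `u`, `u'` from points `p`, `p'` on it, and a set `S'`
which this edge can only leave or enter at `p'`, this says that `p` is inside `S'`. -/
def InsideAt (u u' : W → ℕ) (S' : Set W) (a b : W) : Prop :=
  (a ∈ S' ∧ b ∈ S') ∨ (a ∈ S' ∧ b ∉ S' ∧ u a < u' a) ∨ (a ∉ S' ∧ b ∈ S' ∧ u' a < u a)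

/-- A track of type `f` cannot pass from one side of a track of type `f'` to the other when the
types are far apart. Where both cross the same edge, their order along it is unambiguous, and this
order is preserved across a 2-simplex. -/
theorem FinTrack.insideAt_of_insideAt (hq : IsUniformBicombing G Γ q δ) {Φ : W → Y}
    {f f' : Y × Y} {S S' : Set W} (hS : FinTrack q K Φ f S) (hS' : FinTrack q K Φ f' S')
    (hfar : 20 * δ < Γ.dist f.1 f'.1) {a b a' b' : W} (h : IsExit K S a b)
    (h' : IsExit K S a' b')
    (hab : InsideAt (fun a => Γ.dist (Φ a) f.1) (fun a => Γ.dist (Φ a) f'.1) S' a b) :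
    InsideAt (fun a => Γ.dist (Φ a) f.1) (fun a => Γ.dist (Φ a) f'.1) S' a' b' := by
  let u : W → ℕ := fun a => Γ.dist (Φ a) f.1
  let u' : W → ℕ := fun a => Γ.dist (Φ a) f'.1
  let l : W → W → ℕ := fun a b => Γ.dist (Φ a) (Φ b)
  have lsymm : ∀ a b, l a b = l b a := fun a b => Γ.dist_comm
  have ltri : ∀ a b, l a b ≤ u a + u b := fun a b => by
    have := hq.connected.dist_triangle (u := Φ a) (v := f.1) (w := Φ b)
    rwa [Γ.dist_comm (u := f.1)] at this
  have ltri' : ∀ a b, l a b ≤ u' a + u' b := fun a b => by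
    have := hq.connected.dist_triangle (u := Φ a) (v := f'.1) (w := Φ b)
    rwa [Γ.dist_comm (u := f'.1)] at this
  have hu : ∀ a b, IsExit K S a b → u a + u b ≤ l a b + 2 * δ := fun a b h => by
    have := (hq.near_fst _ _ _ (hS.cross a b h)).dist_add_dist_le hq.connected
    rwa [Γ.dist_comm (u := f.1)] at this
  have hu' : ∀ a b, (oneSkeleton K).Adj a b → a ∈ S' → b ∉ S' → u' a + u' b ≤ l a b + 2 * δ :=
    fun a b h ha hb => by
      have := (hq.near_fst _ _ _ (hS'.cross a b ⟨h, ha, hb⟩)).dist_add_dist_le hq.connected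
      rwa [Γ.dist_comm (u := f'.1)] at this
  -- On an edge crossed by both tracks, the distances of the two points from `a` differ by at least
  -- their mutual distance minus `4 * δ`; this is what leaves `16 * δ` of the `20 * δ`.
  have hgap : ∀ a b, IsExit K S a b → (a ∈ S' ∧ b ∉ S') ∨ (a ∉ S' ∧ b ∈ S') →
      u a + 16 * δ < u' a ∨ u' a + 16 * δ < u a := by
    intro a b h hor
    have h1 := hq.near_fst _ _ _ (hS.cross a b h)
    have h2 : IsNearGeodesics Γ δ (Φ a) (Φ b) f'.1 := by
      rcases hor with ⟨ha, hb⟩ | ⟨ha, hb⟩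
      · exact hq.near_fst _ _ _ (hS'.cross a b ⟨h.1, ha, hb⟩)
      · exact (hq.near_fst _ _ _ (hS'.cross b a ⟨h.1.symm, hb, ha⟩)).symm
    have := h1.dist_le hq.connected h2
    change _ ≤ (u a - u' a) + (u' a - u a) + 4 * δ at this
    omega
  -- Across one 2-simplex, the eight possibilities for which of `a`, `b`, `d` lie in `S'` are each
  -- settled by the triangle inequalities, the near-geodesic bounds and the gap.
  refine hS.connected (InsideAt u u' S') ?_ a b a' b' h h' hab
  intro a b d ⟨hab, hbd, had, _⟩ he
  have e1 := ltri a b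
  have e2 := ltri b d
  have e3 := ltri a d
  have e1' := ltri' a b
  have e2' := ltri' b d
  have e3' := ltri' a d
  have f1 := hu a b he
  have f1' := hu' a b hab
  have f2' := hu' b d hbd
  have f3' := hu' a d had
  have g1' := hu' b a hab.symm
  have g2' := hu' d b hbd.symm
  have g3' := hu' d a had.symm
  rw [lsymm b a] at g1'
  rw [lsymm d b] at g2'
  rw [lsymm d a] at g3'
  have gp1 := hgap a b he
  constructor
  · intro hd _ _ hin
    have f2 := hu a d ⟨had, he.2.1, hd⟩
    have gp2 := hgap a d ⟨had, he.2.1, hd⟩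
    unfold InsideAt at hin ⊢
    by_cases ha' : a ∈ S' <;> by_cases hb' : b ∈ S' <;> by_cases hd' : d ∈ S' <;>
      simp only [ha', hb', hd', true_and, false_and, and_false, and_true, or_true,
        or_false, false_or, not_true_eq_false, not_false_eq_true, forall_true_left,
        false_imp_iff] at * <;> omega
  · intro hd _ _ hin
    have f2 := hu d b ⟨hbd.symm, hd, he.2.2⟩
    rw [lsymm d b] at f2
    have gp2 := hgap d b ⟨hbd.symm, hd, he.2.2⟩
    unfold InsideAt at hin ⊢
    by_cases ha' : a ∈ S' <;> by_cases hb' : b ∈ S' <;> by_cases hd' : d ∈ S' <;>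
      simp only [ha', hb', hd', true_and, false_and, and_false, and_true, or_true,
        or_false, false_or, not_true_eq_false, not_false_eq_true, forall_true_left,
        false_imp_iff] at * <;> omega

/-- Two tracks of distant types and with inner sets of the same size have disjoint inner sets,
and an edge crossing both of them crosses first the one around its origin. -/
theorem FinTrack.disjoint_of_far [Infinite W] (hq : IsUniformBicombing G Γ q δ)
    (hK : (oneSkeleton K).Connected) {Φ : W → Y}
    {f f' : Y × Y} {S S' : Set W} (hS : FinTrack q K Φ f S) (hS' : FinTrack q K Φ f' S')
    (hfar : 20 * δ < Γ.dist f.1 f'.1) (hcard : S.ncard = S'.ncard)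
    (h₁ : S = S' → ¬ ∀ a b, IsExit K S a b → Γ.dist (Φ a) f.1 < Γ.dist (Φ a) f'.1)
    (h₂ : S = S' → ¬ ∀ a b, IsExit K S a b → Γ.dist (Φ a) f'.1 < Γ.dist (Φ a) f.1) :
    Disjoint S S' ∧ ∀ a b, (oneSkeleton K).Adj a b → a ∈ S → b ∈ S' →
      Γ.dist (Φ a) f.1 < Γ.dist (Φ a) f'.1 := by
  have hfar' : 20 * δ < Γ.dist f'.1 f.1 := by rwa [Γ.dist_comm]
  let u : W → ℕ := fun a => Γ.dist (Φ a) f.1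
  let u' : W → ℕ := fun a => Γ.dist (Φ a) f'.1
  have hI : ∀ a b a' b', IsExit K S a b → IsExit K S a' b' → InsideAt u u' S' a b →
      InsideAt u u' S' a' b' := fun a b a' b' h h' => hS.insideAt_of_insideAt hq hS' hfar h h'
  have hI' : ∀ a b a' b', IsExit K S' a b → IsExit K S' a' b' → InsideAt u' u S a b →
      InsideAt u' u S a' b' := fun a b a' b' h h' => hS'.insideAt_of_insideAt hq hS hfar' h h'
  obtain ⟨a₀, b₀, h₀⟩ := hS.nonempty
  obtain ⟨a₁, b₁, h₁'⟩ := hS'.nonempty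
  -- By the preceding lemma each track is entirely inside or entirely outside the inner set of the
  -- other, which gives four configurations.
  have hor : (∀ a b, IsExit K S a b → InsideAt u u' S' a b) ∨
      ∀ a b, IsExit K S a b → ¬ InsideAt u u' S' a b := by
    by_cases h : InsideAt u u' S' a₀ b₀
    · exact Or.inl fun a b hab => hI _ _ _ _ h₀ hab h
    · exact Or.inr fun a b hab hin => h (hI _ _ _ _ hab h₀ hin)
  have hor' : (∀ a b, IsExit K S' a b → InsideAt u' u S a b) ∨
      ∀ a b, IsExit K S' a b → ¬ InsideAt u' u S a b := by
    by_cases h : InsideAt u' u S a₁ b₁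
    · exact Or.inl fun a b hab => hI' _ _ _ _ h₁' hab h
    · exact Or.inr fun a b hab hin => h (hI' _ _ _ _ hab h₁' hin)
  -- points on an edge leaving one of the sets and entering the other
  have hturn : ∀ a b, IsExit K S a b → IsExit K S' b a →
      (u a < u' a ↔ u' b < u b) ∧ u a ≠ u' a ∧ u b ≠ u' b := by
    intro a b h h'
    have n1 := hq.near_fst _ _ _ (hS.cross a b h)
    have n2 := (hq.near_fst _ _ _ (hS'.cross b a h')).symm
    have e1 := n1.dist_le hq.connected n2
    have e2 := n1.symm.dist_le hq.connected n2.symm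
    have e3 := n1.dist_add_dist_le hq.connected
    have e4 := n2.dist_add_dist_le hq.connected
    have e5 := hq.connected.dist_triangle (u := Φ a) (v := f.1) (w := Φ b)
    have e6 := hq.connected.dist_triangle (u := Φ a) (v := f'.1) (w := Φ b)
    rw [Γ.dist_comm (u := f.1) (v := Φ b)] at e3 e5
    rw [Γ.dist_comm (u := f'.1) (v := Φ b)] at e4 e6
    change _ ≤ (u a - u' a) + (u' a - u a) + 4 * δ at e1
    change _ ≤ (u b - u' b) + (u' b - u b) + 4 * δ at e2
    change u a + u b ≤ _ at e3
    change u' a + u' b ≤ _ at e4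
    change _ ≤ u a + u b at e5
    change _ ≤ u' a + u' b at e6
    omega
  -- If the track of `S` is inside `S'` and that of `S'` outside `S`, then `S \ S'` has no exit
  -- edge, so `S ⊆ S'`. Equal cardinalities force equality of the two sets, with one track strictly
  -- closer to all inner endpoints; this is what `h₁` and `h₂` forbid.
  have nested : ∀ {S S' : Set W} {u u' : W → ℕ}, S.Finite → S'.Finite → S.ncard = S'.ncard →
      (∀ a b, IsExit K S a b → InsideAt u u' S' a b) →
      (∀ a b, IsExit K S' a b → ¬ InsideAt u' u S a b) →
      (∀ a b, IsExit K S a b → IsExit K S' b a → (u a < u' a ↔ u' b < u b) ∧ u a ≠ u' a ∧ u b ≠ u' b) →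
      S = S' ∧ ∀ a b, IsExit K S a b → u a < u' a := by
    intro S S' u u' hf hf' hcard hin hout hturn
    have hsub : S ⊆ S' := by
      by_contra hsub
      obtain ⟨z, hz, hz'⟩ := Set.not_subset.mp hsub
      refine false_of_no_exit hK (hf.subset Set.sdiff_subset) (Z := S \ S') ⟨z, hz, hz'⟩ ?_
      rintro a b ⟨hab, ⟨ha, ha'⟩, hb⟩
      by_cases hbS : b ∈ S
      · have hbS' : b ∈ S' := by_contra fun h => hb ⟨hbS, h⟩
        exact hout b a ⟨hab.symm, hbS', ha'⟩ (Or.inl ⟨hbS, ha⟩)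
      · rcases hin a b ⟨hab, ha, hbS⟩ with h | h | h
        · exact ha' h.1
        · exact ha' h.1
        · have ht := hturn a b ⟨hab, ha, hbS⟩ ⟨hab.symm, h.2.1, ha'⟩
          refine hout b a ⟨hab.symm, h.2.1, ha'⟩ (Or.inr (Or.inr ⟨hbS, ha, ?_⟩))
          have := h.2.2
          omega
    have heq : S = S' := Set.eq_of_subset_of_ncard_le hsub hcard.ge hf'
    subst heq
    refine ⟨rfl, fun a b h => ?_⟩
    rcases hin a b h with h' | h' | h'
    · exact absurd h'.2 h.2.2
    · exact h'.2.2
    · exact absurd h.2.1 h'.1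
  -- If both tracks are inside, no edge leaves `S ∪ S'`; the two mixed cases are `nested`; if both
  -- are outside, no edge leaves `S ∩ S'`, which is therefore empty.
  have hdisj : Disjoint S S' ∧ (∀ a b, IsExit K S a b → ¬ InsideAt u u' S' a b) := by
    rcases hor with hin | hout <;> rcases hor' with hin' | hout'
    · exfalso
      refine false_of_no_exit hK (hS.finite.union hS'.finite) ⟨a₀, Or.inl h₀.2.1⟩ ?_
      rintro a b ⟨hab, ha, hb⟩
      have hbS : b ∉ S := fun h => hb (Or.inl h)
      have hbS' : b ∉ S' := fun h => hb (Or.inr h)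
      by_cases haS : a ∈ S
      · rcases hin a b ⟨hab, haS, hbS⟩ with h | h | h
        · exact hbS' h.2
        · rcases hin' a b ⟨hab, h.1, hbS'⟩ with k | k | k
          · exact hbS k.2
          · exact absurd h.2.2 (by omega)
          · exact hbS k.2.1
        · exact hbS' h.2.1
      · have haS' : a ∈ S' := ha.resolve_left haS
        rcases hin' a b ⟨hab, haS', hbS'⟩ with k | k | k
        · exact hbS k.2
        · exact haS k.1
        · exact hbS k.2.1
    · exfalso
      obtain ⟨he, hlt⟩ := nested hS.finite hS'.finite hcard hin hout' hturn
      exact h₁ he hlt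
    · exfalso
      obtain ⟨he, hlt⟩ := nested hS'.finite hS.finite hcard.symm hin' hout fun a b h h' => by
        have := hturn b a h' h
        omega
      exact h₂ he.symm fun a b h => hlt a b (he ▸ h)
    · refine ⟨?_, hout⟩
      rw [Set.disjoint_iff_inter_eq_empty]
      by_contra hne
      refine false_of_no_exit hK (hS.finite.subset Set.inter_subset_left)
        (Set.nonempty_iff_ne_empty.mpr hne) ?_
      rintro a b ⟨hab, ⟨ha, ha'⟩, hb⟩
      by_cases hbS : b ∈ S
      · have hbS' : b ∉ S' := fun h => hb ⟨hbS, h⟩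
        exact hout' a b ⟨hab, ha', hbS'⟩ (Or.inl ⟨ha, hbS⟩)
      · by_cases hbS' : b ∈ S'
        · exact hout a b ⟨hab, ha, hbS⟩ (Or.inl ⟨ha', hbS'⟩)
        · have n1 := hq.near_fst _ _ _ (hS.cross a b ⟨hab, ha, hbS⟩)
          have n2 := hq.near_fst _ _ _ (hS'.cross a b ⟨hab, ha', hbS'⟩)
          have e1 := n1.dist_le hq.connected n2
          change _ ≤ (u a - u' a) + (u' a - u a) + 4 * δ at e1
          rcases lt_or_ge (u a) (u' a) with hlt | hge
          · exact hout a b ⟨hab, ha, hbS⟩ (Or.inr (Or.inl ⟨ha', hbS', hlt⟩))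
          · exact hout' a b ⟨hab, ha', hbS'⟩ (Or.inr (Or.inl ⟨ha, hbS, by omega⟩))
  refine ⟨hdisj.1, fun a b hab ha hb => ?_⟩
  have ha' : a ∉ S' := Set.disjoint_left.mp hdisj.1 ha
  have hb' : b ∉ S := Set.disjoint_right.mp hdisj.1 hb
  have h := hdisj.2 a b ⟨hab, ha, hb'⟩
  have hne := (hturn a b ⟨hab, ha, hb'⟩ ⟨hab.symm, hb, ha'⟩).2.1
  change u a < u' a
  by_contra hlt
  exact h (Or.inr (Or.inr ⟨ha', hb, by omega⟩))

end Tracks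

/-! ### Equivariant choices and symmetric functions -/

section Equivariance

variable {G : Type u} [Group G]

/-- A choice of group elements, equivariant on the points with trivial stabilizer. -/
theorem exists_equivariant_choice (G : Type u) [Group G] (Ω : Type w) [MulAction G Ω] :
    ∃ γ : Ω → G, ∀ ω, (∀ g : G, g • ω = ω → g = 1) → ∀ g : G, γ (g • ω) = g * γ ω := by
  have h : ∀ ω : Ω, ∃ g : G, g • (Quotient.mk (MulAction.orbitRel G Ω) ω).out = ω := fun ω => by
    have := Quotient.exact (s := MulAction.orbitRel G Ω)
      (Quotient.out_eq (Quotient.mk (MulAction.orbitRel G Ω) ω))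
    exact MulAction.mem_orbit_iff.mp ((MulAction.orbitRel G Ω).symm this)
  choose γ hγ using h
  refine ⟨γ, fun ω hω g => ?_⟩
  have h1 := hγ (g • ω)
  have h2 : Quotient.mk (MulAction.orbitRel G Ω) (g • ω) = Quotient.mk _ ω :=
    Quotient.sound (MulAction.orbitRel_apply.mpr (MulAction.mem_orbit _ _))
  rw [h2] at h1
  have h3 := hω (g⁻¹ * γ (g • ω) * (γ ω)⁻¹) (by
    have h4 : (γ ω)⁻¹ • ω = (Quotient.mk (MulAction.orbitRel G Ω) ω).out :=
      inv_smul_eq_iff.mpr (hγ ω).symm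
    rw [mul_smul, mul_smul, h4, h1, inv_smul_smul])
  rw [mul_inv_eq_one, inv_mul_eq_iff_eq_mul] at h3
  exact h3

/-- The element `h` permutes the finite set `Z` and carries `u` to `u'`, so both functions have the
same sum over `Z`. This serves for two translates of a track having the same inner set. -/
theorem not_forall_lt_of_smul_eq {Ω : Type w} [MulAction G Ω] {Z : Set Ω} (hfin : Z.Finite)
    (hne : Z.Nonempty) (h : G) (hZ : ∀ a ∈ Z, h • a ∈ Z) (u u' : Ω → ℕ)
    (hu : ∀ a, u' (h • a) = u a) :
    (¬ ∀ a ∈ Z, u a < u' a) ∧ ¬ ∀ a ∈ Z, u' a < u a := by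
  classical
  have hinj : Set.InjOn (fun a => h • a) (hfin.toFinset : Set Ω) := (MulAction.injective h).injOn
  have himg : hfin.toFinset.image (fun a => h • a) = hfin.toFinset := by
    refine Finset.eq_of_subset_of_card_le (fun b hb => ?_) ?_
    · obtain ⟨a, ha, rfl⟩ := Finset.mem_image.mp hb
      exact hfin.mem_toFinset.mpr (hZ a (hfin.mem_toFinset.mp ha))
    · rw [Finset.card_image_of_injOn hinj]
  have hsum : ∑ a ∈ hfin.toFinset, u' a = ∑ a ∈ hfin.toFinset, u a := by
    conv_lhs => rw [← himg]
    rw [Finset.sum_image hinj]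
    exact Finset.sum_congr rfl fun a _ => hu a
  have hne' : hfin.toFinset.Nonempty := by simpa using hne
  constructor <;> intro hlt
  · have := Finset.sum_lt_sum_of_nonempty hne' fun a ha => hlt a (hfin.mem_toFinset.mp ha)
    omega
  · have := Finset.sum_lt_sum_of_nonempty hne' fun a ha => hlt a (hfin.mem_toFinset.mp ha)
    omega

end Equivariance

/-! ### Minimal energy and the position of finite tracks -/

section Energy

/-- With base `E₀.card + 2`, one exponent dropping from `m + 1` to at most `m` saves more than all
the other terms can gain, since any exponent that grows stays at most `L ≤ m`. -/
theorem sum_pow_lt_sum_pow {E : Type*} [DecidableEq E] (E₀ : Finset E) (old new : E → ℕ) (L : ℕ)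
    (hle : ∀ e ∈ E₀, new e ≤ old e ∨ new e ≤ L) {e₀ : E} (he₀ : e₀ ∈ E₀)
    (hlt : new e₀ < old e₀) (hL : L < old e₀) :
    ∑ e ∈ E₀, (E₀.card + 2) ^ new e < ∑ e ∈ E₀, (E₀.card + 2) ^ old e := by
  set N := E₀.card + 2 with hN
  obtain ⟨m, hm⟩ : ∃ m, old e₀ = m + 1 := ⟨old e₀ - 1, by omega⟩
  have hN1 : 1 ≤ N := by omega
  rw [← Finset.add_sum_erase _ _ he₀, ← Finset.add_sum_erase _ (fun e => N ^ old e) he₀]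
  have h1 : N ^ new e₀ ≤ N ^ m := Nat.pow_le_pow_right hN1 (by omega)
  have h2 : ∑ e ∈ E₀.erase e₀, N ^ new e ≤ ∑ e ∈ E₀.erase e₀, (N ^ old e + N ^ m) := by
    refine Finset.sum_le_sum fun e he => ?_
    rcases hle e (Finset.mem_of_mem_erase he) with h | h
    · exact (Nat.pow_le_pow_right hN1 h).trans (Nat.le_add_right _ _)
    · exact (Nat.pow_le_pow_right hN1 (by omega)).trans (Nat.le_add_left _ _)
  rw [Finset.sum_add_distrib, Finset.sum_const, smul_eq_mul] at h2
  have h3 : (E₀.erase e₀).card ≤ E₀.card := Finset.card_le_card (Finset.erase_subset _ _)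
  have h4 : (E₀.erase e₀).card * N ^ m ≤ E₀.card * N ^ m := Nat.mul_le_mul_right _ h3
  have h5 : N ^ old e₀ = E₀.card * N ^ m + 2 * N ^ m := by
    rw [hm, pow_succ]; nth_rewrite 2 [hN]; ring
  have h6 : 0 < N ^ m := Nat.pow_pos hN1
  omega

variable {G : Type u} [Group G] {Y : Type y} {Γ : SimpleGraph Y} {W : Type w} [MulAction G W]
  {V : Type v} [MulAction G V] {j : V → Y}

/-- The energy of a map from the vertices of a complex to those of a graph; the longest edges
dominate. -/
noncomputable def mapEnergy (Γ : SimpleGraph Y) (j : V → Y) (E₀ : Finset (W × W)) (Φ : W → V) :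
    ℕ :=
  ∑ e ∈ E₀, (E₀.card + 2) ^ Γ.dist (j (Φ e.1)) (j (Φ e.2))

/-- Equivariant maps exist because the action on vertices is free, and the energy is a natural
number, so a minimum is attained. -/
theorem exists_minimal_energy [Nonempty V] (hfree : ∀ (g : G) (a : W), g • a = a → g = 1)
    (Γ : SimpleGraph Y) (j : V → Y) (E₀ : Finset (W × W)) :
    ∃ Φ : W → V, (∀ (g : G) a, Φ (g • a) = g • Φ a) ∧
      ∀ Φ' : W → V, (∀ (g : G) a, Φ' (g • a) = g • Φ' a) →
        mapEnergy Γ j E₀ Φ ≤ mapEnergy Γ j E₀ Φ' := by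
  obtain ⟨γ, hγ⟩ := exists_equivariant_choice G W
  obtain ⟨v₀⟩ := ‹Nonempty V›
  have hne : {Φ : W → V | ∀ (g : G) a, Φ (g • a) = g • Φ a}.Nonempty :=
    ⟨fun a => γ a • v₀, fun g a => by simp only [hγ a (fun g => hfree g a), mul_smul]⟩
  obtain ⟨Φ, hΦ, hmin⟩ := (measure (mapEnergy Γ j E₀ (W := W))).wf.has_min _ hne
  exact ⟨Φ, hΦ, fun Φ' hΦ' => not_lt.mp (hmin Φ' hΦ')⟩

variable [MulAction G Y] {q : Y → Y → (Y × Y →₀ ℚ)} {δ : ℕ} [DecidableEq W]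
  {K : AbstractSimplicialComplex W}

/-- For a map of minimal energy, the tracks without singular connectors have an inner vertex close
to the edge they are attached to. -/
theorem FinTrack.exists_exit_near [Infinite W] (hq : IsUniformBicombing G Γ q δ)
    (hK : (oneSkeleton K).Connected) (hsimp : ∀ (g : G), ∀ s ∈ K.faces, g • s ∈ K.faces)
    (hfree : ∀ (g : G) (a : W), g • a = a → g = 1)
    (hj : ∀ (g : G) (a : V), j (g • a) = g • j a) {E₀ : Finset (W × W)}
    (hE₀ : ∀ a b, (oneSkeleton K).Adj a b → ∃ g : G, (g • a, g • b) ∈ E₀)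
    (hE₁ : ∀ e ∈ E₀, (oneSkeleton K).Adj e.1 e.2) {Φ : W → V}
    (hΦ : ∀ (g : G) a, Φ (g • a) = g • Φ a)
    (hmin : ∀ Φ' : W → V, (∀ (g : G) a, Φ' (g • a) = g • Φ' a) →
      mapEnergy Γ j E₀ Φ ≤ mapEnergy Γ j E₀ Φ') {f : Y × Y} {S : Set W}
    (hS : FinTrack q K (fun a => j (Φ a)) f S) {R : ℕ} {v : V} (hv : Γ.dist (j v) f.1 ≤ R) :
    ∃ a b, IsExit K S a b ∧ Γ.dist (j (Φ a)) f.1 ≤ 4 * R + 40 * δ + 10 := by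
  classical
  -- Otherwise the map is improved by sending every translate `g • S` to the point `g • v`, which is
  -- within `R` of `g • f.1`. Edges meeting these translates become shorter or have length at most
  -- `2 * R + 20 * δ`.
  by_contra! hfar
  have hdist : ∀ (g : G) (a b : Y), Γ.dist (g • a) (g • b) = Γ.dist a b :=
    dist_smul_smul hq.adj_smul
  have hjΦ : ∀ (g : G) a, j (Φ (g • a)) = g • j (Φ a) := fun g a => by rw [hΦ, hj]
  have hadj : ∀ (g : G) a b, (oneSkeleton K).Adj a b → (oneSkeleton K).Adj (g • a) (g • b) :=
    fun g a b h => ⟨fun he => h.1 (MulAction.injective g he), by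
      have := hsimp g _ h.2
      rwa [Finset.smul_finset_insert, Finset.smul_finset_singleton] at this⟩
  have htrack : ∀ g : G, FinTrack q K (fun a => j (Φ a)) (g • f) (g • S) :=
    fun g => hS.smul hq hjΦ hsimp g
  have hexit : ∀ (g : G) a b, IsExit K (g • S) a b → IsExit K S (g⁻¹ • a) (g⁻¹ • b) := by
    rintro g a b ⟨h1, h2, h3⟩
    rw [Set.mem_smul_set_iff_inv_smul_mem] at h2 h3
    exact ⟨hadj _ _ _ h1, h2, h3⟩
  have hfar' : ∀ (g : G) a b, IsExit K (g • S) a b →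
      4 * R + 40 * δ + 10 < Γ.dist (j (Φ a)) (g • f.1) := by
    intro g a b h
    have := hfar _ _ (hexit g a b h)
    rwa [← hdist g, hjΦ, smul_inv_smul] at this
  -- equivariant choice of a translate of `S` containing a given point
  obtain ⟨γ, hγ⟩ := exists_equivariant_choice G W
  let M : Set W := {a | ∃ g : G, a ∈ g • S}
  have hM : ∀ (g : G) a, g • a ∈ M ↔ a ∈ M := by
    have : ∀ (g : G) a, a ∈ M → g • a ∈ M := by
      rintro g a ⟨h, ha⟩
      exact ⟨g * h, by rw [mul_smul]; exact Set.smul_mem_smul_set ha⟩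
    exact fun g a => ⟨fun h => by simpa using this g⁻¹ _ h, this g a⟩
  have hk₀ : ∀ a, ∃ g : G, a ∈ M → a ∈ g • S := fun a => by
    by_cases h : a ∈ M
    · obtain ⟨g, hg⟩ := h; exact ⟨g, fun _ => hg⟩
    · exact ⟨1, fun h' => absurd h' h⟩
  choose k₀ hk₀ using hk₀
  obtain ⟨k, hk, hkS⟩ : ∃ k : W → G, (∀ (g : G) a, k (g • a) = g * k a) ∧
      ∀ a ∈ M, a ∈ k a • S := by
    -- The point `(γ a)⁻¹ • a` depends only on the orbit of `a`, so the arbitrary choice `k₀` is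
    -- made once per orbit and then transported.
    refine ⟨fun a => γ a * k₀ ((γ a)⁻¹ • a), fun g a => ?_, fun a ha => ?_⟩
    · simp only [hγ a (fun g => hfree g a), mul_inv_rev, mul_smul, inv_smul_smul, mul_assoc]
    · have := hk₀ ((γ a)⁻¹ • a) ((hM _ _).mpr ha)
      rw [mul_smul, Set.mem_smul_set_iff_inv_smul_mem]
      exact this
  let Φ' : W → V := fun a => if a ∈ M then k a • v else Φ a
  have hΦ' : ∀ (g : G) a, Φ' (g • a) = g • Φ' a := fun g a => by
    by_cases h : a ∈ M
    · simp only [Φ', (hM g a).mpr h, h, if_true, hk, mul_smul]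
    · have h' : g • a ∉ M := fun h' => h ((hM g a).mp h')
      simp only [Φ', h', h, if_false, hΦ]
  let old : W → W → ℕ := fun a b => Γ.dist (j (Φ a)) (j (Φ b))
  let new : W → W → ℕ := fun a b => Γ.dist (j (Φ' a)) (j (Φ' b))
  have hnear : ∀ a ∈ M, Γ.dist (j (Φ' a)) (k a • f.1) ≤ R := fun a ha => by
    simp only [Φ', ha, if_true]
    rw [hj, hdist]
    exact hv
  -- The old edge passes within `δ` of `k a • f.1`, far from `j (Φ a)`; moving the endpoint `a` to
  -- within `R` of that point shortens it.
  have case_out : ∀ a b, (oneSkeleton K).Adj a b → a ∈ M → b ∉ M → new a b < old a b := by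
    intro a b hab ha hb
    have he : IsExit K (k a • S) a b := ⟨hab, hkS a ha, fun h => hb ⟨_, h⟩⟩
    have h1 := (hq.near_fst _ _ _ ((htrack (k a)).cross a b he)).dist_add_dist_le hq.connected
    have h2 := hfar' _ a b he
    have h3 := hnear a ha
    have h4 := hq.connected.dist_triangle (u := j (Φ' a)) (v := k a • f.1) (w := j (Φ' b))
    have h5 : Φ' b = Φ b := by simp only [Φ', hb, if_false]
    change _ + Γ.dist (k a • f.1) _ ≤ _ at h1
    change Γ.dist (j (Φ' a)) (j (Φ' b)) < Γ.dist (j (Φ a)) (j (Φ b))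
    have h1' : Γ.dist (j (Φ a)) (k a • f.1) + Γ.dist (k a • f.1) (j (Φ b)) ≤ _ := h1
    rw [h5] at h4 ⊢
    omega
  have case_in : ∀ a b, (oneSkeleton K).Adj a b → a ∈ M → b ∈ M →
      new a b < old a b ∨ new a b ≤ 2 * R + 20 * δ := by
    intro a b hab ha hb
    have h3 := hnear a ha
    have h3' := hnear b hb
    have h4 := hq.connected.dist_triangle (u := j (Φ' a)) (v := k a • f.1) (w := j (Φ' b))
    have h5 := hq.connected.dist_triangle (u := k a • f.1) (v := k b • f.1) (w := j (Φ' b))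
    rw [Γ.dist_comm (u := k b • f.1) (v := j (Φ' b))] at h5
    change Γ.dist (j (Φ' a)) (j (Φ' b)) < Γ.dist (j (Φ a)) (j (Φ b)) ∨
      Γ.dist (j (Φ' a)) (j (Φ' b)) ≤ _
    by_cases hfar2 : 20 * δ < Γ.dist (k a • f.1) (k b • f.1)
    · left
      -- The two translates may coincide as sets while their types differ. Then `k b * (k a)⁻¹`
      -- preserves the set of inner endpoints and carries one distance function to the other, so
      -- neither is smaller everywhere.
      have hsame : k a • S = k b • S →
          (¬ ∀ c d, IsExit K (k a • S) c d →
            Γ.dist (j (Φ c)) (k a • f.1) < Γ.dist (j (Φ c)) (k b • f.1)) ∧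
          ¬ ∀ c d, IsExit K (k a • S) c d →
            Γ.dist (j (Φ c)) (k b • f.1) < Γ.dist (j (Φ c)) (k a • f.1) := by
        intro heq
        have hZ := not_forall_lt_of_smul_eq (Z := {c | ∃ d, IsExit K (k a • S) c d})
          ((htrack (k a)).finite.subset fun c hc => hc.choose_spec.2.1)
          (let ⟨c, d, h⟩ := (htrack (k a)).nonempty; ⟨c, d, h⟩) (k b * (k a)⁻¹) (by
            rintro c ⟨d, h⟩
            refine ⟨(k b * (k a)⁻¹) • d, hadj _ _ _ h.1, ?_, ?_⟩
            · rw [heq, mul_smul]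
              exact Set.smul_mem_smul_set (Set.mem_smul_set_iff_inv_smul_mem.mp h.2.1)
            · rw [heq, mul_smul, Set.smul_mem_smul_set_iff, ← Set.mem_smul_set_iff_inv_smul_mem]
              exact h.2.2)
          (fun c => Γ.dist (j (Φ c)) (k a • f.1)) (fun c => Γ.dist (j (Φ c)) (k b • f.1)) (by
            intro c
            rw [hjΦ, ← hdist (k b * (k a)⁻¹) (j (Φ c)), mul_smul _ _ (k a • f.1), inv_smul_smul])
        exact ⟨fun h => hZ.1 fun c ⟨d, hd⟩ => h c d hd, fun h => hZ.2 fun c ⟨d, hd⟩ => h c d hd⟩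
      obtain ⟨hdisj, horder⟩ := (htrack (k a)).disjoint_of_far hq hK (htrack (k b)) hfar2
        (by rw [Set.ncard_smul_set, Set.ncard_smul_set]) (fun h => (hsame h).1)
        (fun h => (hsame h).2)
      have hlt : Γ.dist (j (Φ a)) (k a • f.1) < Γ.dist (j (Φ a)) (k b • f.1) :=
        horder a b hab (hkS a ha) (hkS b hb)
      have he : IsExit K (k a • S) a b :=
        ⟨hab, hkS a ha, Set.disjoint_right.mp hdisj (hkS b hb)⟩
      have he' : IsExit K (k b • S) b a :=
        ⟨hab.symm, hkS b hb, Set.disjoint_left.mp hdisj (hkS a ha)⟩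
      have n1 : IsNearGeodesics Γ δ (j (Φ a)) (j (Φ b)) (k a • f.1) :=
        hq.near_fst _ _ _ ((htrack (k a)).cross a b he)
      have n2 : IsNearGeodesics Γ δ (j (Φ a)) (j (Φ b)) (k b • f.1) :=
        (hq.near_fst _ _ _ ((htrack (k b)).cross b a he')).symm
      -- Along the old edge the points occur coarsely in the order `a`, `k a • f.1`, `k b • f.1`,
      -- `b`. Both end pieces exceed `4 * R + 40 * δ + 10`, and replacing each by a piece of length
      -- at most `R` outweighs the errors.
      have e1 := n1.dist_le hq.connected n2
      have e2 := n2.dist_add_dist_le hq.connected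
      have e3 := hfar' _ a b he
      have e4 := hfar' _ b a he'
      rw [Γ.dist_comm (u := k b • f.1)] at e2
      omega
    · right
      omega
  have hnew : ∀ a b, (oneSkeleton K).Adj a b →
      new a b = old a b ∨ new a b < old a b ∨ new a b ≤ 2 * R + 20 * δ := by
    intro a b hab
    by_cases ha : a ∈ M <;> by_cases hb : b ∈ M
    · exact Or.inr (case_in a b hab ha hb)
    · exact Or.inr (Or.inl (case_out a b hab ha hb))
    · refine Or.inr (Or.inl ?_)
      have := case_out b a hab.symm hb ha
      simp only [new, old] at this ⊢
      rwa [Γ.dist_comm, Γ.dist_comm (u := j (Φ a))]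
    · left
      simp only [new, old, Φ', ha, hb, if_false]
  obtain ⟨a, b, hab⟩ := hS.nonempty
  have haM : a ∈ M := ⟨1, by rw [one_smul]; exact hab.2.1⟩
  -- An exit edge is longer than the threshold, so it is strictly shortened in either case; its
  -- representative in `E₀` is the term that decreases the energy.
  have hold : 2 * R + 20 * δ < old a b := by
    have h1 := (hq.near_fst _ _ _ (hS.cross a b hab)).dist_add_dist_le hq.connected
    have h2 := hfar a b hab
    simp only [old]
    omega
  have hlt : new a b < old a b := by
    by_cases hb : b ∈ M
    · rcases case_in a b hab.1 haM hb with h | h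
      · exact h
      · omega
    · exact case_out a b hab.1 haM hb
  obtain ⟨g, hg⟩ := hE₀ a b hab.1
  have hinv : ∀ (Φ : W → V), (∀ (g : G) a, Φ (g • a) = g • Φ a) →
      Γ.dist (j (Φ (g • a))) (j (Φ (g • b))) = Γ.dist (j (Φ a)) (j (Φ b)) := fun Φ hΦ => by
    rw [hΦ, hΦ, hj, hj, hdist]
  refine absurd (hmin Φ' hΦ') (not_le.mpr ?_)
  refine sum_pow_lt_sum_pow E₀ (fun e => old e.1 e.2) (fun e => new e.1 e.2) (2 * R + 20 * δ)
    (fun e he => ?_) hg ?_ ?_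
  · rcases hnew e.1 e.2 (hE₁ e he) with h | h | h
    · exact Or.inl h.le
    · exact Or.inl h.le
    · exact Or.inr h
  · simp only [new, old, hinv Φ hΦ, hinv Φ' hΦ']
    exact hlt
  · simp only [old, hinv Φ hΦ]
    exact hold

end Energy

/-! ### Barycentric coordinates and segments -/

section Points

variable {G : Type u} [Group G] {W : Type w} [MulAction G W]

theorem pointSMul_apply (g : G) (c : W →₀ ℝ) (a : W) : pointSMul g c a = c (g⁻¹ • a) := by
  simp [pointSMul, Finsupp.equivMapDomain_apply]

theorem pointSMul_inv_smul (g : G) (c : W →₀ ℝ) : pointSMul g (pointSMul g⁻¹ c) = c := by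
  ext a
  simp [pointSMul_apply]

/-- The point of the edge from `a` to `b` with coordinate `t` at `b`. -/
noncomputable def edgePoint (a b : W) (t : ℝ) : W →₀ ℝ :=
  Finsupp.single a (1 - t) + Finsupp.single b t

theorem edgePoint_swap (a b : W) (t : ℝ) : edgePoint b a (1 - t) = edgePoint a b t := by
  simp [edgePoint, add_comm]

theorem edgePoint_apply_right {a b : W} (h : a ≠ b) (t : ℝ) : edgePoint a b t b = t := by
  simp [edgePoint, h]

theorem edgePoint_apply_left {a b : W} (h : a ≠ b) (t : ℝ) : edgePoint a b t a = 1 - t := by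
  simp [edgePoint, h.symm]

theorem pointSMul_combo (g : G) (α β : ℝ) (c d : W →₀ ℝ) :
    pointSMul g (α • c + β • d) = α • pointSMul g c + β • pointSMul g d := by
  ext a
  simp [pointSMul_apply]

theorem pointSMul_mem_segment (g : G) {p c d : W →₀ ℝ} (h : p ∈ segment ℝ c d) :
    pointSMul g p ∈ segment ℝ (pointSMul g c) (pointSMul g d) := by
  obtain ⟨α, β, hα, hβ, hαβ, rfl⟩ := h
  exact ⟨α, β, hα, hβ, hαβ, (pointSMul_combo g α β c d).symm⟩

/-- A short initial piece of the segment from `x` to `m` does not meet a segment which does not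
contain `x`. -/
theorem exists_short_segment_disjoint {x m c d : W →₀ ℝ} (hx : x ∉ segment ℝ c d) :
    ∃ η : ℝ, 0 < η ∧ ∀ t : ℝ, 0 ≤ t → t ≤ η → (1 - t) • x + t • m ∉ segment ℝ c d := by
  -- In the product topology on functions the segment is compact, hence closed, and the path from
  -- `x` towards `m` is continuous.
  let Z : Set (W → ℝ) := (fun t : ℝ => fun a => (1 - t) * c a + t * d a) '' Set.Icc 0 1
  have hZ : IsClosed Z := (isCompact_Icc.image (by fun_prop)).isClosed
  have hmem : ∀ p : W →₀ ℝ, (p : W → ℝ) ∈ Z → p ∈ segment ℝ c d := by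
    rintro p ⟨t, ht, hp⟩
    refine ⟨1 - t, t, by linarith [ht.2], ht.1, by ring, ?_⟩
    ext a
    simpa using congrFun hp a
  let φ : ℝ → (W → ℝ) := fun t a => (1 - t) * x a + t * m a
  have hφ : Continuous φ := by fun_prop
  have h0 : φ 0 ∈ Zᶜ := by
    intro h
    refine hx (hmem x ?_)
    have : φ 0 = x := by funext a; simp [φ]
    rwa [← this]
  have hnhds : φ ⁻¹' Zᶜ ∈ nhds (0 : ℝ) := (hZ.isOpen_compl.preimage hφ).mem_nhds h0
  obtain ⟨η, hη, hball⟩ := Metric.mem_nhds_iff.mp hnhds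
  refine ⟨η / 2, by linarith, fun t ht0 ht1 hmem' => ?_⟩
  have ht : t ∈ Metric.ball (0 : ℝ) η := by
    rw [Metric.mem_ball, Real.dist_eq, sub_zero, abs_of_nonneg ht0]; linarith
  refine hball ht ?_
  obtain ⟨α, β, hα, hβ, hαβ, he⟩ := hmem'
  refine ⟨β, ⟨hβ, by linarith⟩, ?_⟩
  funext a
  have := DFunLike.congr_fun he a
  simp only [Finsupp.add_apply, Finsupp.smul_apply, smul_eq_mul] at this
  simp only [φ]
  rw [← this, ← hαβ]
  ring

variable [DecidableEq W]

theorem support_pointSMul (g : G) (c : W →₀ ℝ) : (pointSMul g c).support = g • c.support := by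
  ext a
  rw [Finsupp.mem_support_iff, pointSMul_apply, ← Finset.inv_smul_mem_iff,
    Finsupp.mem_support_iff]

theorem pointSMul_edgePoint (g : G) (a b : W) (t : ℝ) :
    pointSMul g (edgePoint a b t) = edgePoint (g • a) (g • b) t := by
  ext c
  simp only [pointSMul_apply, edgePoint, Finsupp.add_apply, Finsupp.single_apply,
    eq_inv_smul_iff]

theorem edgePoint_mem_openSimplex {a b : W} (h : a ≠ b) {t : ℝ} (h0 : 0 < t) (h1 : t < 1) :
    edgePoint a b t ∈ openSimplex ({a, b} : Finset W) := by
  have hsup : (edgePoint a b t).support = {a, b} := by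
    ext c
    rw [Finsupp.mem_support_iff, Finset.mem_insert, Finset.mem_singleton]
    by_cases hca : c = a
    · subst hca; rw [edgePoint_apply_left h]; simp; linarith
    · by_cases hcb : c = b
      · subst hcb; rw [edgePoint_apply_right h]; simp; linarith
      · simp [edgePoint, hca, hcb]
  refine ⟨hsup, fun c => ?_, ?_⟩
  · simp only [edgePoint, Finsupp.add_apply, Finsupp.single_apply]
    split_ifs <;> linarith
  · rw [Finsupp.sum, hsup, Finset.sum_pair h, edgePoint_apply_left h, edgePoint_apply_right h]
    ring

theorem openSegment_subset_openSimplex {s t : Finset W} {c d : W →₀ ℝ} (hc : c ∈ openSimplex s)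
    (hd : d ∈ openSimplex t) : openSegment ℝ c d ⊆ openSimplex (s ∪ t) := by
  rintro _ ⟨α, β, hα, hβ, hαβ, rfl⟩
  refine ⟨?_, fun a => ?_, ?_⟩
  · ext a
    rw [Finsupp.mem_support_iff, Finset.mem_union, ← hc.1, ← hd.1, Finsupp.mem_support_iff,
      Finsupp.mem_support_iff]
    have h1 := hc.2.1 a
    have h2 := hd.2.1 a
    simp only [Finsupp.add_apply, Finsupp.smul_apply, smul_eq_mul]
    constructor
    · intro h
      by_contra! hcon
      exact h (by rw [hcon.1, hcon.2]; ring)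
    · rintro (h | h)
      · have : 0 < α * c a := mul_pos hα (lt_of_le_of_ne h1 (Ne.symm h))
        have : 0 ≤ β * d a := mul_nonneg hβ.le h2
        linarith
      · have : 0 ≤ α * c a := mul_nonneg hα.le h1
        have : 0 < β * d a := mul_pos hβ (lt_of_le_of_ne h2 (Ne.symm h))
        linarith
  · have h1 := hc.2.1 a
    have h2 := hd.2.1 a
    simp only [Finsupp.add_apply, Finsupp.smul_apply, smul_eq_mul]
    positivity
  · rw [Finsupp.sum_add_index' (fun _ => rfl) (fun _ _ _ => rfl),
      Finsupp.sum_smul_index' (fun _ => rfl), Finsupp.sum_smul_index' (fun _ => rfl)]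
    simp only [smul_eq_mul, ← Finsupp.mul_sum]
    rw [hc.2.2, hd.2.2]
    linarith

/-- The barycentre of a simplex. -/
noncomputable def baryPoint (s : Finset W) : W →₀ ℝ :=
  ∑ a ∈ s, Finsupp.single a ((s.card : ℝ)⁻¹)

theorem baryPoint_apply (s : Finset W) (a : W) :
    baryPoint s a = if a ∈ s then (s.card : ℝ)⁻¹ else 0 := by
  simp [baryPoint, Finsupp.finsetSum_apply, Finsupp.single_apply]

theorem baryPoint_mem_openSimplex {s : Finset W} (hs : s.Nonempty) :
    baryPoint s ∈ openSimplex s := by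
  have hpos : (0 : ℝ) < (s.card : ℝ)⁻¹ := inv_pos.mpr (by exact_mod_cast hs.card_pos)
  have hsup : (baryPoint s).support = s := by
    ext a
    rw [Finsupp.mem_support_iff, baryPoint_apply]
    by_cases h : a ∈ s
    · simp [h, hs.ne_empty]
    · simp [h]
  refine ⟨hsup, fun a => ?_, ?_⟩
  · rw [baryPoint_apply]; split_ifs <;> linarith
  · rw [Finsupp.sum, hsup, Finset.sum_congr rfl fun a ha => by rw [baryPoint_apply, if_pos ha],
      Finset.sum_const, nsmul_eq_mul]
    exact mul_inv_cancel₀ (inv_pos.mp hpos).ne'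

theorem pointSMul_baryPoint (g : G) (s : Finset W) :
    pointSMul g (baryPoint s) = baryPoint (g • s) := by
  ext a
  rw [pointSMul_apply, baryPoint_apply, baryPoint_apply, Finset.card_smul_finset]
  simp only [Finset.inv_smul_mem_iff]

theorem support_subset_of_mem_segment {s : Finset W} {p c d : W →₀ ℝ} (hc : c.support ⊆ s)
    (hd : d.support ⊆ s) (h : p ∈ segment ℝ c d) : p.support ⊆ s := by
  obtain ⟨α, β, _, _, _, rfl⟩ := h
  intro a ha
  by_contra has
  rw [Finsupp.mem_support_iff] at ha
  have h1 : c a = 0 := by_contra fun h => has (hc (Finsupp.mem_support_iff.mpr h))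
  have h2 : d a = 0 := by_contra fun h => has (hd (Finsupp.mem_support_iff.mpr h))
  exact ha (by simp [h1, h2])

/-- The segments from two boundary points of a simplex to its barycentre only meet there. -/
theorem eq_of_combo_bary_eq {s : Finset W} {x y : W →₀ ℝ} (hx0 : ∀ a, 0 ≤ x a)
    (hy0 : ∀ a, 0 ≤ y a) (hx : ∃ a ∈ s, x a = 0) (hy : ∃ a ∈ s, y a = 0) {t t' : ℝ}
    (ht : t < 1) (ht' : t' < 1)
    (h : (1 - t) • x + t • baryPoint s = (1 - t') • y + t' • baryPoint s) : x = y := by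
  have happ : ∀ a, (1 - t) * x a + t * baryPoint s a = (1 - t') * y a + t' * baryPoint s a :=
    fun a => by simpa using DFunLike.congr_fun h a
  obtain ⟨a, ha, hxa⟩ := hx
  obtain ⟨b, hb, hyb⟩ := hy
  have hpos : (0 : ℝ) < (s.card : ℝ)⁻¹ := inv_pos.mpr (by exact_mod_cast Finset.card_pos.mpr ⟨a, ha⟩)
  have h1 := happ a
  have h2 := happ b
  rw [baryPoint_apply, if_pos ha, hxa] at h1
  rw [baryPoint_apply, if_pos hb, hyb] at h2
  have h3 : 0 ≤ (1 - t') * y a := mul_nonneg (by linarith) (hy0 a)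
  have h4 : 0 ≤ (1 - t) * x b := mul_nonneg (by linarith) (hx0 b)
  -- At a coordinate where `x` vanishes only the barycentre contributes on the left, which gives `t'
  -- ≤ t`; a vanishing coordinate of `y` gives the converse.
  have htt : t = t' := by
    apply le_antisymm
    · by_contra hlt
      push Not at hlt
      have : t' * (s.card : ℝ)⁻¹ < t * (s.card : ℝ)⁻¹ := mul_lt_mul_of_pos_right hlt hpos
      linarith
    · by_contra hlt
      push Not at hlt
      have : t * (s.card : ℝ)⁻¹ < t' * (s.card : ℝ)⁻¹ := mul_lt_mul_of_pos_right hlt hpos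
      linarith
  subst htt
  ext c
  have := happ c
  have h5 : (1 - t) * x c = (1 - t) * y c := by linarith
  exact mul_left_cancel₀ (by linarith : (1 - t) ≠ 0) h5

end Points

/-! ### Equivariant placement of regular connectors -/

section Positions

variable {G : Type u} [Group G] {Y : Type y} [MulAction G Y] {Γ : SimpleGraph Y}
  {q : Y → Y → (Y × Y →₀ ℚ)} {δ : ℕ} {W : Type w} [DecidableEq W] [MulAction G W]
  {K : AbstractSimplicialComplex W}

/-- Rank lexicographically by `u` and then by an injective numbering that breaks ties, and rescale
the ranks into the open unit interval. -/
theorem exists_monotone_injection {E : Type*} {Z : Set E} (hZ : Z.Finite) (u : E → ℕ) :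
    ∃ p : E → ℝ, (∀ e, 0 < p e ∧ p e < 1) ∧ Set.InjOn p Z ∧
      ∀ e ∈ Z, ∀ e' ∈ Z, u e < u e' → p e < p e' := by
  classical
  obtain ⟨i, hi⟩ := Set.countable_iff_exists_injOn.mp hZ.countable
  obtain ⟨n, hn⟩ := (hZ.image i).bddAbove
  let r : E → ℕ := fun e => u e * (n + 1) + i e
  have hin : ∀ e ∈ Z, i e ≤ n := fun e he => hn ⟨e, he, rfl⟩
  have hlt : ∀ e ∈ Z, ∀ e' ∈ Z, u e < u e' → r e < r e' := fun e he e' he' h => by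
    have h1 := hin e he
    have h2 : (u e + 1) * (n + 1) ≤ u e' * (n + 1) := Nat.mul_le_mul_right _ h
    simp only [r]
    linarith
  have hinj : Set.InjOn r Z := fun e he e' he' h => by
    rcases lt_trichotomy (u e) (u e') with hu | hu | hu
    · exact absurd h (hlt e he e' he' hu).ne
    · simp only [r, hu, Nat.add_left_cancel_iff] at h
      exact hi he he' h
    · exact absurd h (hlt e' he' e he hu).ne'
  obtain ⟨M, hM⟩ := (hZ.image r).bddAbove
  have hpos : (0 : ℝ) < M + 2 := by positivity
  have hp : ∀ e ∈ Z, (if e ∈ Z then ((r e : ℝ) + 1) / (M + 2) else 1 / 2) =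
      ((r e : ℝ) + 1) / (M + 2) := fun e he => if_pos he
  refine ⟨fun e => if e ∈ Z then ((r e : ℝ) + 1) / (M + 2) else 1 / 2, fun e => ?_,
    fun e he e' he' h => ?_, fun e he e' he' h => ?_⟩
  · by_cases he : e ∈ Z
    · simp only [he, if_true]
      have : (r e : ℝ) ≤ M := by exact_mod_cast hM ⟨e, he, rfl⟩
      refine ⟨by positivity, (div_lt_one hpos).mpr (by linarith)⟩
    · simp only [he, if_false]; norm_num
  · simp only [he, he', if_true] at h
    rw [div_left_inj' hpos.ne'] at h
    exact hinj he he' (by exact_mod_cast add_right_cancel h)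
  · simp only [he, he', if_true]
    have : (r e : ℝ) < r e' := by exact_mod_cast hlt e he e' he' h
    exact div_lt_div_of_pos_right (by linarith) hpos

/-- The positions `τ a b f` on the edges of `K` of the connectors of a resolution. -/
structure IsPositioning (G : Type u) [Group G] [MulAction G Y] [MulAction G W] (Γ : SimpleGraph Y)
    (q : Y → Y → (Y × Y →₀ ℚ)) (K : AbstractSimplicialComplex W) (Φ : W → Y) (δ₀ : ℝ)
    (τ : W → W → Y × Y → ℝ) : Prop where
  pos : ∀ a b f, 0 < τ a b f
  lt_one : ∀ a b f, τ a b f < 1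
  swap : ∀ a b, (oneSkeleton K).Adj a b → ∀ f, τ b a f.swap = 1 - τ a b f
  smul : ∀ a b, (oneSkeleton K).Adj a b → ∀ f (g : G), τ (g • a) (g • b) (g • f) = τ a b f
  inj : ∀ a b, (oneSkeleton K).Adj a b → Set.InjOn (τ a b) (chainSupp (q (Φ a) (Φ b)))
  order : ∀ a b, (oneSkeleton K).Adj a b →
    ∀ f ∈ chainSupp (q (Φ a) (Φ b)), ∀ f' ∈ chainSupp (q (Φ a) (Φ b)),
      (distToEdge Γ (Φ a) f : ℝ) < distToEdge Γ (Φ a) f' - δ₀ → τ a b f < τ a b f'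

theorem distToEdge_swap (Γ : SimpleGraph Y) (a : Y) (f : Y × Y) :
    distToEdge Γ a f.swap = distToEdge Γ a f :=
  min_comm _ _

theorem distToEdge_add_le (hq : IsUniformBicombing G Γ q δ) {a b : Y} {f : Y × Y}
    (hf : f ∈ chainSupp (q a b)) :
    distToEdge Γ a f + distToEdge Γ b f ≤ Γ.dist a b + 2 * δ := by
  have h1 := (hq.near_fst a b f hf).dist_add_dist_le hq.connected
  have h2 : distToEdge Γ a f ≤ Γ.dist a f.1 := min_le_left _ _
  have h3 : distToEdge Γ b f ≤ Γ.dist b f.1 := min_le_left _ _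
  rw [Γ.dist_comm (u := f.1)] at h1
  omega

theorem le_distToEdge_add (hq : IsUniformBicombing G Γ q δ) {a b : Y} {f : Y × Y}
    (hf : f ∈ chainSupp (q a b)) :
    Γ.dist a b ≤ distToEdge Γ a f + distToEdge Γ b f + 1 := by
  have h0 := SimpleGraph.dist_eq_one_iff_adj.mpr (hq.adj a b f hf)
  have h1 := hq.connected.dist_triangle (u := a) (v := f.1) (w := b)
  have h2 := hq.connected.dist_triangle (u := a) (v := f.2) (w := b)
  have h3 := hq.connected.dist_triangle (u := f.1) (v := f.2) (w := b)
  have h4 := hq.connected.dist_triangle (u := f.2) (v := f.1) (w := b)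
  rw [Γ.dist_comm (u := f.2) (v := f.1)] at h4
  rw [Γ.dist_comm (u := f.1) (v := b)] at h1 h3 h4
  rw [Γ.dist_comm (u := f.2) (v := b)] at h2 h3 h4
  unfold distToEdge
  omega

theorem distToEdge_smul (hq : IsUniformBicombing G Γ q δ) (g : G) (a : Y) (f : Y × Y) :
    distToEdge Γ (g • a) (g • f) = distToEdge Γ a f := by
  unfold distToEdge
  rw [Prod.smul_fst, Prod.smul_snd, dist_smul_smul hq.adj_smul, dist_smul_smul hq.adj_smul]

theorem IsFreeCocompactAction.adj_smul (hK : IsFreeCocompactAction G K) (g : G) {a b : W}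
    (h : (oneSkeleton K).Adj a b) : (oneSkeleton K).Adj (g • a) (g • b) :=
  ⟨fun he => h.1 (MulAction.injective g he), by
    have := hK.simplicial g _ h.2
    rwa [Finset.smul_finset_insert, Finset.smul_finset_singleton] at this⟩

/-- Positions must be reversed with the orientation of the edge, while monotonicity is measured from
its origin. Distances from the two ends add up to the length of the edge with errors `2 * δ` above
and `1` below, so ordering from the wrong end costs `2 * δ + 1`. -/
theorem exists_isPositioning (hq : IsUniformBicombing G Γ q δ) (hK : IsFreeCocompactAction G K)
    {Φ : W → Y} (hΦ : ∀ (g : G) a, Φ (g • a) = g • Φ a) :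
    ∃ τ, IsPositioning G Γ q K Φ (2 * δ + 1) τ := by
  classical
  obtain ⟨r, hr⟩ := exists_wellFoundedLT W
  choose p hp01 hpinj hporder using fun a b : W =>
    exists_monotone_injection (chainSupp_finite (q (Φ a) (Φ b))) (distToEdge Γ (Φ a))
  -- An arbitrary linear order on `W` selects one orientation of each edge; the other orientation
  -- gets the mirrored positions.
  let τ₀ : W → W → Y × Y → ℝ := fun a b f => if a < b then p a b f else 1 - p b a f.swap
  have h01 : ∀ a b f, 0 < τ₀ a b f ∧ τ₀ a b f < 1 := fun a b f => by
    simp only [τ₀]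
    split_ifs
    · exact hp01 a b f
    · have := hp01 b a f.swap
      constructor <;> linarith
  have hswap : ∀ a b, a ≠ b → ∀ f, τ₀ b a f.swap = 1 - τ₀ a b f := fun a b hab f => by
    rcases lt_or_gt_of_ne hab with h | h
    · simp [τ₀, h, h.not_gt]
    · simp [τ₀, h, h.not_gt]
  have hinj : ∀ a b, Set.InjOn (τ₀ a b) (chainSupp (q (Φ a) (Φ b))) := fun a b f hf f' hf' h => by
    simp only [τ₀] at h
    split_ifs at h
    · exact hpinj a b hf hf' h
    · exact Prod.swap_injective (hpinj b a (hq.mem_swap_iff.mpr hf) (hq.mem_swap_iff.mpr hf')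
        (by linarith))
  have horder : ∀ a b, ∀ f ∈ chainSupp (q (Φ a) (Φ b)), ∀ f' ∈ chainSupp (q (Φ a) (Φ b)),
      distToEdge Γ (Φ a) f + (2 * δ + 1) < distToEdge Γ (Φ a) f' → τ₀ a b f < τ₀ a b f' := by
    intro a b f hf f' hf' h
    simp only [τ₀]
    split_ifs
    · exact hporder a b f hf f' hf' (by omega)
    · have h1 := le_distToEdge_add hq hf
      have h2 := distToEdge_add_le hq hf'
      have := hporder b a _ (hq.mem_swap_iff.mpr hf') _ (hq.mem_swap_iff.mpr hf)
        (by rw [distToEdge_swap, distToEdge_swap]; omega)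
      linarith
  -- Choosing translations for unoriented edges keeps the reversal rule. Freeness on simplices
  -- excludes inversions, so their stabilizers are trivial.
  obtain ⟨γ, hγ⟩ := exists_equivariant_choice G (Finset W)
  have hγe : ∀ a b, (oneSkeleton K).Adj a b → ∀ g : G, γ {g • a, g • b} = g * γ {a, b} :=
    fun a b hab g => by
      have := hγ {a, b} (fun g => hK.free g _ hab.2) g
      rwa [Finset.smul_finset_insert, Finset.smul_finset_singleton] at this
  refine ⟨fun a b f => τ₀ ((γ {a, b})⁻¹ • a) ((γ {a, b})⁻¹ • b) ((γ {a, b})⁻¹ • f),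
    fun a b f => (h01 _ _ _).1, fun a b f => (h01 _ _ _).2, fun a b hab f => ?_,
    fun a b hab f g => ?_, fun a b hab f hf f' hf' h => ?_, fun a b hab f hf f' hf' h => ?_⟩
  · rw [Finset.pair_comm b a]
    exact hswap ((γ {a, b})⁻¹ • a) ((γ {a, b})⁻¹ • b)
      (fun h => hab.1 (MulAction.injective (γ {a, b})⁻¹ h)) ((γ {a, b})⁻¹ • f)
  · simp only [hγe a b hab, mul_inv_rev, mul_smul, inv_smul_smul]
  · have hm : ∀ f, f ∈ chainSupp (q (Φ a) (Φ b)) → (γ {a, b})⁻¹ • f ∈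
        chainSupp (q (Φ ((γ {a, b})⁻¹ • a)) (Φ ((γ {a, b})⁻¹ • b))) := fun f hf => by
      rw [hΦ, hΦ]; exact (hq.smul_mem_iff _).mpr hf
    exact MulAction.injective _ (hinj _ _ (hm f hf) (hm f' hf') h)
  · have hm : ∀ f, f ∈ chainSupp (q (Φ a) (Φ b)) → (γ {a, b})⁻¹ • f ∈
        chainSupp (q (Φ ((γ {a, b})⁻¹ • a)) (Φ ((γ {a, b})⁻¹ • b))) := fun f hf => by
      rw [hΦ, hΦ]; exact (hq.smul_mem_iff _).mpr hf
    refine horder _ _ _ (hm f hf) _ (hm f' hf') ?_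
    rw [hΦ, distToEdge_smul hq, distToEdge_smul hq]
    have : (distToEdge Γ (Φ a) f : ℝ) + (2 * δ + 1) < distToEdge Γ (Φ a) f' := by linarith
    exact_mod_cast this

end Positions

/-! ### Adjacency of connectors and short singular segments -/

section Connectors

variable {G : Type u} [Group G] {Y : Type y} [MulAction G Y] {Γ : SimpleGraph Y}
  {q : Y → Y → (Y × Y →₀ ℚ)} {δ : ℕ} {W : Type w} [DecidableEq W] [MulAction G W]
  {K : AbstractSimplicialComplex W} {Φ : W → Y} {δ₀ : ℝ} {τ : W → W → Y × Y → ℝ}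

theorem IsTriangle.of_face {a b d : W} (hs : {a, b, d} ∈ K.faces)
    (hcard : ({a, b, d} : Finset W).card = 3) : IsTriangle K a b d := by
  have hne : a ≠ b ∧ b ≠ d ∧ a ≠ d := by
    have h2 : ∀ x y : W, ({x, y} : Finset W).card ≤ 2 := fun x y => Finset.card_le_two
    refine ⟨?_, ?_, ?_⟩ <;> rintro rfl
    · have := h2 a d; simp at hcard; omega
    · have := h2 a b; simp at hcard; omega
    · have h' : ({a, b, a} : Finset W) = {b, a} := by ext; simp
      have := h2 b a; rw [h'] at hcard; omega
  have hsub : ∀ t : Finset W, t ⊆ {a, b, d} → t.Nonempty → t ∈ K.faces :=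
    fun t ht hne => (K.isRelLowerSet_faces hs).2 ht hne
  exact ⟨⟨hne.1, hsub _ (by intro x; simp; tauto) (by simp)⟩,
    ⟨hne.2.1, hsub _ (by intro x; simp; tauto) (by simp)⟩,
    ⟨hne.2.2, hsub _ (by intro x; simp; tauto) (by simp)⟩, hs⟩

theorem IsTriangle.card {a b d : W} (h : IsTriangle K a b d) :
    ({a, b, d} : Finset W).card = 3 :=
  Finset.card_eq_three.mpr ⟨a, b, d, h.1.1, h.2.2.1.1, h.2.1.1, rfl⟩

theorem IsTriangle.swap {a b d : W} (h : IsTriangle K a b d) : IsTriangle K d b a :=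
  ⟨h.2.1.symm, h.1.symm, h.2.2.1.symm, by
    have he : ({d, b, a} : Finset W) = {a, b, d} := by ext; simp; tauto
    rw [he]; exact h.2.2.2⟩

theorem IsTriangle.rotate {a b d : W} (h : IsTriangle K a b d) : IsTriangle K b d a :=
  ⟨h.2.1, h.2.2.1.symm, h.1.symm, by
    have he : ({b, d, a} : Finset W) = {a, b, d} := by ext; simp; tauto
    rw [he]; exact h.2.2.2⟩

theorem IsTriangle.smul (hK : IsFreeCocompactAction G K) (g : G) {a b d : W}
    (h : IsTriangle K a b d) : IsTriangle K (g • a) (g • b) (g • d) :=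
  ⟨hK.adj_smul g h.1, hK.adj_smul g h.2.1, hK.adj_smul g h.2.2.1, by
    have := hK.simplicial g _ h.2.2.2
    rwa [Finset.smul_finset_insert, Finset.smul_finset_insert,
      Finset.smul_finset_singleton] at this⟩

/-- The regular connectors with the given positions. -/
def IsReg (q : Y → Y → (Y × Y →₀ ℚ)) (K : AbstractSimplicialComplex W) (Φ : W → Y)
    (τ : W → W → Y × Y → ℝ) (c : W →₀ ℝ) : Prop :=
  ∃ a b f, (oneSkeleton K).Adj a b ∧ f ∈ chainSupp (q (Φ a) (Φ b)) ∧ c = edgePoint a b (τ a b f)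

/-- The regular connectors `c` and `c'` are joined by a regular segment. -/
def RegAdj (q : Y → Y → (Y × Y →₀ ℚ)) (K : AbstractSimplicialComplex W) (Φ : W → Y)
    (τ : W → W → Y × Y → ℝ) (c c' : W →₀ ℝ) : Prop :=
  ∃ a b d f, IsTriangle K a b d ∧ f ∈ chainSupp (q (Φ a) (Φ b)) ∧
    f.swap ∈ chainSupp (q (Φ b) (Φ d)) ∧ f ∉ chainSupp (q (Φ d) (Φ a)) ∧
    f.swap ∉ chainSupp (q (Φ d) (Φ a)) ∧
    c = edgePoint a b (τ a b f) ∧ c' = edgePoint b d (τ b d f.swap)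

/-- The regular connector `c` on the boundary of the 2-simplex `s` is not joined to any other one
in `s`. -/
def IsSing (q : Y → Y → (Y × Y →₀ ℚ)) (K : AbstractSimplicialComplex W) (Φ : W → Y)
    (τ : W → W → Y × Y → ℝ) (s : Finset W) (c : W →₀ ℝ) : Prop :=
  s ∈ K.faces ∧ s.card = 3 ∧ IsReg q K Φ τ c ∧ c.support ⊆ s ∧
    ∀ c', RegAdj q K Φ τ c c' → ¬ c'.support ⊆ s

/-- The singular connector joined to `c` in `s`. -/
noncomputable def singPoint (ε : Finset W → ℝ) (s : Finset W) (c : W →₀ ℝ) : W →₀ ℝ :=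
  (1 - ε s) • c + ε s • baryPoint s

/-- The data from which a resolution is constructed. -/
structure IsResolutionDatum (G : Type u) [Group G] [MulAction G Y] [MulAction G W]
    (Γ : SimpleGraph Y) (q : Y → Y → (Y × Y →₀ ℚ)) (δ : ℕ) (K : AbstractSimplicialComplex W)
    (Φ : W → Y) (δ₀ : ℝ) (τ : W → W → Y × Y → ℝ) : Prop where
  bicombing : IsUniformBicombing G Γ q δ
  action : IsFreeCocompactAction G K
  map_smul : ∀ (g : G) a, Φ (g • a) = g • Φ a
  positioning : IsPositioning G Γ q K Φ δ₀ τ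

namespace IsResolutionDatum

theorem mem_openSimplex (h : IsResolutionDatum G Γ q δ K Φ δ₀ τ) {a b : W}
    (hab : (oneSkeleton K).Adj a b) (f : Y × Y) :
    edgePoint a b (τ a b f) ∈ openSimplex ({a, b} : Finset W) :=
  edgePoint_mem_openSimplex hab.1 (h.positioning.pos a b f) (h.positioning.lt_one a b f)

theorem support_eq (h : IsResolutionDatum G Γ q δ K Φ δ₀ τ) {a b : W}
    (hab : (oneSkeleton K).Adj a b) (f : Y × Y) :
    (edgePoint a b (τ a b f)).support = {a, b} :=
  (h.mem_openSimplex hab f).1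

theorem edgePoint_swap (h : IsResolutionDatum G Γ q δ K Φ δ₀ τ) {a b : W}
    (hab : (oneSkeleton K).Adj a b) (f : Y × Y) :
    edgePoint b a (τ b a f.swap) = edgePoint a b (τ a b f) := by
  rw [h.positioning.swap a b hab f, _root_.edgePoint_swap]

theorem pointSMul_edgePoint (h : IsResolutionDatum G Γ q δ K Φ δ₀ τ) {a b : W}
    (hab : (oneSkeleton K).Adj a b) (f : Y × Y) (g : G) :
    pointSMul g (edgePoint a b (τ a b f)) =
      edgePoint (g • a) (g • b) (τ (g • a) (g • b) (g • f)) := by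
  rw [_root_.pointSMul_edgePoint, h.positioning.smul a b hab]

theorem mem_supp_smul (h : IsResolutionDatum G Γ q δ K Φ δ₀ τ) (g : G) {a b : W} {f : Y × Y} :
    g • f ∈ chainSupp (q (Φ (g • a)) (Φ (g • b))) ↔ f ∈ chainSupp (q (Φ a) (Φ b)) := by
  rw [h.map_smul, h.map_smul, h.bicombing.smul_mem_iff]

theorem eq_of_edgePoint_eq (h : IsResolutionDatum G Γ q δ K Φ δ₀ τ) {a b : W}
    (hab : (oneSkeleton K).Adj a b) {f f' : Y × Y} (hf : f ∈ chainSupp (q (Φ a) (Φ b)))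
    (hf' : f' ∈ chainSupp (q (Φ a) (Φ b)))
    (he : edgePoint a b (τ a b f) = edgePoint a b (τ a b f')) : f = f' := by
  refine h.positioning.inj a b hab hf hf' ?_
  have := DFunLike.congr_fun he b
  rwa [edgePoint_apply_right hab.1, edgePoint_apply_right hab.1] at this

theorem eq_or_eq_of_edgePoint_eq (h : IsResolutionDatum G Γ q δ K Φ δ₀ τ) {a b a' b' : W}
    (hab : (oneSkeleton K).Adj a b) (hab' : (oneSkeleton K).Adj a' b') {f f' : Y × Y}
    (hf : f ∈ chainSupp (q (Φ a) (Φ b))) (hf' : f' ∈ chainSupp (q (Φ a') (Φ b')))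
    (he : edgePoint a b (τ a b f) = edgePoint a' b' (τ a' b' f')) :
    (a' = a ∧ b' = b ∧ f' = f) ∨ (a' = b ∧ b' = a ∧ f' = f.swap) := by
  have hs : ({a, b} : Finset W) = {a', b'} := by
    rw [← h.support_eq hab f, he, h.support_eq hab']
  have ha : a ∈ ({a', b'} : Finset W) := hs ▸ by simp
  have hb : b ∈ ({a', b'} : Finset W) := hs ▸ by simp
  simp only [Finset.mem_insert, Finset.mem_singleton] at ha hb
  rcases ha with rfl | rfl
  · have hb' : b = b' := hb.resolve_left fun hba => hab.1 hba.symm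
    subst hb'
    exact Or.inl ⟨rfl, rfl, (h.eq_of_edgePoint_eq hab hf hf' he).symm⟩
  · have hb' : b = a' := hb.resolve_right fun hba => hab.1 hba.symm
    subst hb'
    right
    refine ⟨rfl, rfl, ?_⟩
    rw [← h.edgePoint_swap hab] at he
    exact (h.eq_of_edgePoint_eq hab.symm (h.bicombing.mem_swap_iff.mpr hf) hf' he).symm

theorem regAdj_symm (h : IsResolutionDatum G Γ q δ K Φ δ₀ τ) {c c' : W →₀ ℝ}
    (hc : RegAdj q K Φ τ c c') : RegAdj q K Φ τ c' c := by
  obtain ⟨a, b, d, f, ht, h1, h2, h3, h4, rfl, rfl⟩ := hc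
  refine ⟨d, b, a, f, ht.swap, h.bicombing.mem_swap_iff.mp h2, h.bicombing.mem_swap_iff.mpr h1,
    fun hf => h4 (h.bicombing.mem_swap_iff.mpr hf),
    fun hf => h3 (h.bicombing.mem_swap_iff.mp hf), ?_, ?_⟩
  · rw [h.edgePoint_swap ht.2.1.symm]
  · rw [h.edgePoint_swap ht.1]

theorem isReg_left {c c' : W →₀ ℝ} (hc : RegAdj q K Φ τ c c') : IsReg q K Φ τ c := by
  obtain ⟨a, b, d, f, ht, h1, -, -, -, rfl, -⟩ := hc
  exact ⟨a, b, f, ht.1, h1, rfl⟩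

theorem isReg_right {c c' : W →₀ ℝ} (hc : RegAdj q K Φ τ c c') : IsReg q K Φ τ c' := by
  obtain ⟨a, b, d, f, ht, -, h2, -, -, -, rfl⟩ := hc
  exact ⟨b, d, f.swap, ht.2.1, h2, rfl⟩

theorem card_support (h : IsResolutionDatum G Γ q δ K Φ δ₀ τ) {c : W →₀ ℝ}
    (hc : IsReg q K Φ τ c) : c.support.card = 2 := by
  obtain ⟨a, b, f, hab, _, rfl⟩ := hc
  rw [h.support_eq hab, Finset.card_pair hab.1]

theorem isReg_mem (h : IsResolutionDatum G Γ q δ K Φ δ₀ τ) {c : W →₀ ℝ}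
    (hc : IsReg q K Φ τ c) : c.support ∈ K.faces ∧ c ∈ openSimplex c.support := by
  obtain ⟨a, b, f, hab, _, rfl⟩ := hc
  rw [h.support_eq hab]
  exact ⟨hab.2, h.mem_openSimplex hab f⟩

/-- The 2-simplex spanned by the supports of two joined regular connectors. -/
theorem regAdj_support (h : IsResolutionDatum G Γ q δ K Φ δ₀ τ) {c c' : W →₀ ℝ}
    (hc : RegAdj q K Φ τ c c') :
    c.support ∪ c'.support ∈ K.faces ∧ (c.support ∪ c'.support).card = 3 := by
  obtain ⟨a, b, d, f, ht, -, -, -, -, rfl, rfl⟩ := hc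
  rw [h.support_eq ht.1, h.support_eq ht.2.1]
  have he : ({a, b} ∪ {b, d} : Finset W) = {a, b, d} := by ext; simp
  rw [he]
  exact ⟨ht.2.2.2, ht.card⟩

/-- A connector determines its edge and `f` up to simultaneous reversal. Partners on both other
sides would put `f` over all three sides, which the condition on the third side in `RegAdj`
excludes. -/
theorem regAdj_unique (h : IsResolutionDatum G Γ q δ K Φ δ₀ τ) {c c' c'' : W →₀ ℝ}
    {s : Finset W} (hs : s.card = 3) (h1 : RegAdj q K Φ τ c c') (h2 : RegAdj q K Φ τ c c'')
    (hc : c.support ⊆ s) (hc' : c'.support ⊆ s) (hc'' : c''.support ⊆ s) : c' = c'' := by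
  obtain ⟨a, b, d, f, ht, i1, i2, i3, i4, rfl, rfl⟩ := h1
  obtain ⟨a', b', d', f', ht', i1', i2', i3', i4', he, rfl⟩ := h2
  rw [h.support_eq ht.1] at hc
  rw [h.support_eq ht.2.1] at hc'
  rw [h.support_eq ht'.2.1] at hc''
  have hsub : ({a, b, d} : Finset W) ⊆ s := by
    intro x hx
    simp only [Finset.mem_insert, Finset.mem_singleton] at hx
    rcases hx with rfl | rfl | rfl
    · exact hc (by simp)
    · exact hc (by simp)
    · exact hc' (by simp)
  have hseq : ({a, b, d} : Finset W) = s :=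
    Finset.eq_of_subset_of_card_le hsub (by rw [hs, ht.card])
  have hd' : d' ∈ ({a, b, d} : Finset W) := hseq ▸ hc'' (by simp)
  simp only [Finset.mem_insert, Finset.mem_singleton] at hd'
  rcases h.eq_or_eq_of_edgePoint_eq ht.1 ht'.1 i1 i1' he with ⟨rfl, rfl, rfl⟩ | ⟨rfl, rfl, rfl⟩
  · have : d' = d := (hd'.resolve_left ht'.2.2.1.1.symm).resolve_left ht'.2.1.1.symm
    subst this; rfl
  · have : d' = d :=
      (hd'.resolve_left ht'.2.1.1.symm).resolve_left ht'.2.2.1.1.symm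
    subst this
    exact absurd (h.bicombing.mem_swap_iff.mp i2) i4'

theorem isReg_smul (h : IsResolutionDatum G Γ q δ K Φ δ₀ τ) (g : G) {c : W →₀ ℝ}
    (hc : IsReg q K Φ τ c) : IsReg q K Φ τ (pointSMul g c) := by
  obtain ⟨a, b, f, hab, hf, rfl⟩ := hc
  exact ⟨g • a, g • b, g • f, h.action.adj_smul g hab, (h.mem_supp_smul g).mpr hf,
    h.pointSMul_edgePoint hab f g⟩

theorem regAdj_smul (h : IsResolutionDatum G Γ q δ K Φ δ₀ τ) (g : G) {c c' : W →₀ ℝ}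
    (hc : RegAdj q K Φ τ c c') : RegAdj q K Φ τ (pointSMul g c) (pointSMul g c') := by
  obtain ⟨a, b, d, f, ht, h1, h2, h3, h4, rfl, rfl⟩ := hc
  exact ⟨g • a, g • b, g • d, g • f, ht.smul h.action g, (h.mem_supp_smul g).mpr h1,
    (h.mem_supp_smul g).mpr h2, fun h' => h3 ((h.mem_supp_smul g).mp h'),
    fun h' => h4 ((h.mem_supp_smul g).mp h'), h.pointSMul_edgePoint ht.1 f g,
    h.pointSMul_edgePoint ht.2.1 f.swap g⟩

theorem isSing_smul (h : IsResolutionDatum G Γ q δ K Φ δ₀ τ) (g : G) {s : Finset W}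
    {c : W →₀ ℝ} (hc : IsSing q K Φ τ s c) : IsSing q K Φ τ (g • s) (pointSMul g c) := by
  obtain ⟨h1, h2, h3, h4, h5⟩ := hc
  refine ⟨h.action.simplicial g s h1, by rw [Finset.card_smul_finset, h2], h.isReg_smul g h3,
    by rw [support_pointSMul]; exact Finset.smul_finset_subset_smul_finset h4, ?_⟩
  intro c' hc' hsub
  have := h.regAdj_smul g⁻¹ hc'
  have e : pointSMul g⁻¹ (pointSMul g c) = c := by simpa using pointSMul_inv_smul g⁻¹ c
  rw [e] at this
  refine h5 _ this ?_
  rw [support_pointSMul]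
  intro x hx
  rw [Finset.mem_inv_smul_finset_iff] at hx
  simpa using hsub hx

theorem finite_isReg (h : IsResolutionDatum G Γ q δ K Φ δ₀ τ) (s : Finset W) :
    {c | IsReg q K Φ τ c ∧ c.support ⊆ s}.Finite := by
  refine (s.finite_toSet.biUnion fun a _ => s.finite_toSet.biUnion fun b _ =>
    (chainSupp_finite (q (Φ a) (Φ b))).image fun f => edgePoint a b (τ a b f)).subset ?_
  rintro c ⟨⟨a, b, f, hab, hf, rfl⟩, hc⟩
  rw [h.support_eq hab] at hc
  exact Set.mem_biUnion (hc (by simp : a ∈ _)) (Set.mem_biUnion (hc (by simp : b ∈ _)) ⟨f, hf, rfl⟩)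

end IsResolutionDatum

/-- Singular segments of relative length at most `ε` in the 2-simplex `s` do not meet the regular
segments. -/
structure IsShort (q : Y → Y → (Y × Y →₀ ℚ)) (K : AbstractSimplicialComplex W) (Φ : W → Y)
    (τ : W → W → Y × Y → ℝ) (s : Finset W) (ε : ℝ) : Prop where
  pos : 0 < ε
  lt_one : ε < 1
  notMem : ∀ x c c', IsReg q K Φ τ x → RegAdj q K Φ τ c c' → x.support ⊆ s → c.support ⊆ s →
    c'.support ⊆ s → x ≠ c → x ≠ c' → ∀ t : ℝ, 0 ≤ t → t ≤ ε →
      (1 - t) • x + t • baryPoint s ∉ segment ℝ c c'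

namespace IsResolutionDatum

theorem notMem_segment (h : IsResolutionDatum G Γ q δ K Φ δ₀ τ) {x c c' : W →₀ ℝ}
    (hx : IsReg q K Φ τ x) (hc : RegAdj q K Φ τ c c') (h1 : x ≠ c) (h2 : x ≠ c') :
    x ∉ segment ℝ c c' := by
  rw [← insert_endpoints_openSegment]
  rintro (he | he | he)
  · exact h1 he
  · exact h2 he
  · have := openSegment_subset_openSimplex (h.isReg_mem (isReg_left hc)).2
      (h.isReg_mem (isReg_right hc)).2 he
    have h3 := (h.regAdj_support hc).2
    rw [← this.1, h.card_support hx] at h3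
    omega

/-- A regular connector lies on no regular segment of which it is not an endpoint, because open
segments lie inside a 2-simplex. Hence a short enough piece towards the barycentre avoids each of
the finitely many segments. -/
theorem exists_isShort (h : IsResolutionDatum G Γ q δ K Φ δ₀ τ) (s : Finset W) :
    ∃ ε, IsShort q K Φ τ s ε := by
  let T : Set ((W →₀ ℝ) × (W →₀ ℝ) × (W →₀ ℝ)) := {p | IsReg q K Φ τ p.1 ∧
    RegAdj q K Φ τ p.2.1 p.2.2 ∧ p.1.support ⊆ s ∧ p.2.1.support ⊆ s ∧ p.2.2.support ⊆ s ∧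
    p.1 ≠ p.2.1 ∧ p.1 ≠ p.2.2}
  have hT : T.Finite := by
    refine ((h.finite_isReg s).prod ((h.finite_isReg s).prod (h.finite_isReg s))).subset ?_
    rintro p ⟨h1, h2, h3, h4, h5, -⟩
    exact ⟨⟨h1, h3⟩, ⟨isReg_left h2, h4⟩, ⟨isReg_right h2, h5⟩⟩
  have hη : ∀ p ∈ T, ∀ᶠ ε in nhdsWithin (0 : ℝ) (Set.Ioi 0), ∀ t : ℝ, 0 ≤ t → t ≤ ε →
      (1 - t) • p.1 + t • baryPoint s ∉ segment ℝ p.2.1 p.2.2 := by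
    rintro p ⟨h1, h2, -, -, -, h6, h7⟩
    obtain ⟨η, hη, hd⟩ := exists_short_segment_disjoint (m := baryPoint s)
      (h.notMem_segment h1 h2 h6 h7)
    filter_upwards [Ioo_mem_nhdsGT hη] with ε hε t h0 h1
    exact hd t h0 (h1.trans hε.2.le)
  obtain ⟨ε, hε1, hε2⟩ := (((Filter.eventually_all_finite hT).mpr hη).and
    (Ioo_mem_nhdsGT (zero_lt_one (α := ℝ)))).exists
  exact ⟨ε, hε2.1, hε2.2, fun x c c' h1 h2 h3 h4 h5 h6 h7 =>
    hε1 (x, c, c') ⟨h1, h2, h3, h4, h5, h6, h7⟩⟩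

theorem isShort_smul (h : IsResolutionDatum G Γ q δ K Φ δ₀ τ) (g : G) {s : Finset W} {ε : ℝ}
    (hs : IsShort q K Φ τ s ε) : IsShort q K Φ τ (g • s) ε := by
  refine ⟨hs.pos, hs.lt_one, ?_⟩
  intro x c c' h1 h2 h3 h4 h5 h6 h7 t ht0 ht1 hmem
  have hsub : ∀ {x : W →₀ ℝ}, x.support ⊆ g • s → (pointSMul g⁻¹ x).support ⊆ s := by
    intro x hx y hy
    rw [support_pointSMul, Finset.mem_inv_smul_finset_iff] at hy
    simpa using hx hy
  have hinj : ∀ {x y : W →₀ ℝ}, x ≠ y → pointSMul g⁻¹ x ≠ pointSMul g⁻¹ y := by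
    intro x y hxy he
    refine hxy ?_
    rw [← pointSMul_inv_smul g x, he, pointSMul_inv_smul]
  refine hs.notMem _ _ _ (h.isReg_smul g⁻¹ h1) (h.regAdj_smul g⁻¹ h2) (hsub h3) (hsub h4)
    (hsub h5) (hinj h6) (hinj h7) t ht0 ht1 ?_
  have := pointSMul_mem_segment g⁻¹ hmem
  rwa [pointSMul_combo, pointSMul_baryPoint, inv_smul_smul] at this

/-- The length is chosen at one simplex of each orbit and transported; trivial stabilizers of faces
make it invariant. -/
theorem exists_isShort_invariant (h : IsResolutionDatum G Γ q δ K Φ δ₀ τ) :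
    ∃ ε : Finset W → ℝ, (∀ s, IsShort q K Φ τ s (ε s)) ∧
      ∀ (g : G), ∀ s ∈ K.faces, ε (g • s) = ε s := by
  choose ε₀ hε₀ using h.exists_isShort
  obtain ⟨γ, hγ⟩ := exists_equivariant_choice G (Finset W)
  refine ⟨fun s => ε₀ ((γ s)⁻¹ • s), fun s => ?_, fun g s hs => ?_⟩
  · have := h.isShort_smul (γ s) (hε₀ ((γ s)⁻¹ • s))
    rwa [smul_inv_smul] at this
  · simp only [hγ s (fun g => h.action.free g s hs), mul_inv_rev, mul_smul, inv_smul_smul]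

end IsResolutionDatum

end Connectors

/-! ### Existence of a resolution -/

section Construction

variable {G : Type u} [Group G] {Y : Type y} [MulAction G Y] {Γ : SimpleGraph Y}
  {q : Y → Y → (Y × Y →₀ ℚ)} {δ : ℕ} {W : Type w} [DecidableEq W] [MulAction G W]
  {K : AbstractSimplicialComplex W} {Φ : W → Y} {δ₀ : ℝ} {τ : W → W → Y × Y → ℝ}
  {ε : Finset W → ℝ}

/-- The singular connector `y` is joined to the regular connector `c`. -/
def SingAdj (q : Y → Y → (Y × Y →₀ ℚ)) (K : AbstractSimplicialComplex W) (Φ : W → Y)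
    (τ : W → W → Y × Y → ℝ) (ε : Finset W → ℝ) (c y : W →₀ ℝ) : Prop :=
  ∃ s, IsSing q K Φ τ s c ∧ y = singPoint ε s c

open Classical in
/-- The weight of the connectors of a resolution. -/
noncomputable def connWeight (q : Y → Y → (Y × Y →₀ ℚ)) (K : AbstractSimplicialComplex W)
    (Φ : W → Y) (τ : W → W → Y × Y → ℝ) (c : W →₀ ℝ) : ℝ≥0 :=
  if hc : IsReg q K Φ τ c then
    Real.toNNReal (q (Φ hc.choose) (Φ hc.choose_spec.choose) hc.choose_spec.choose_spec.choose)
  else 0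

namespace IsResolutionDatum

/-- The chosen data of the connector can differ from `a`, `b`, `f` only by reversing both the edge
and `f`, and the two signs this produces cancel. -/
theorem connWeight_eq (h : IsResolutionDatum G Γ q δ K Φ δ₀ τ) {a b : W} {f : Y × Y}
    (hab : (oneSkeleton K).Adj a b) (hf : f ∈ chainSupp (q (Φ a) (Φ b))) :
    (connWeight q K Φ τ (edgePoint a b (τ a b f)) : ℝ) = q (Φ a) (Φ b) f := by
  have hc : IsReg q K Φ τ (edgePoint a b (τ a b f)) := ⟨a, b, f, hab, hf, rfl⟩
  have hval : ∀ a' b' f', (oneSkeleton K).Adj a' b' → f' ∈ chainSupp (q (Φ a') (Φ b')) →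
      edgePoint a b (τ a b f) = edgePoint a' b' (τ a' b' f') →
      q (Φ a') (Φ b') f' = q (Φ a) (Φ b) f := by
    intro a' b' f' hab' hf' he
    rcases h.eq_or_eq_of_edgePoint_eq hab hab' hf hf' he with ⟨rfl, rfl, rfl⟩ | ⟨rfl, rfl, rfl⟩
    · rfl
    · rw [h.bicombing.swap, h.bicombing.symm (Φ b'), neg_neg]
  obtain ⟨h1, h2, h3⟩ := hc.choose_spec.choose_spec.choose_spec
  rw [connWeight, dif_pos hc, hval _ _ _ h1 h2 h3]
  have : 0 < q (Φ a) (Φ b) f := hf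
  exact Real.coe_toNNReal _ (by exact_mod_cast this.le)

theorem singPoint_mem (h : IsResolutionDatum G Γ q δ K Φ δ₀ τ)
    (hε : ∀ s, IsShort q K Φ τ s (ε s)) {s : Finset W} {c : W →₀ ℝ}
    (hc : IsSing q K Φ τ s c) : singPoint ε s c ∈ openSimplex s := by
  have hne : s.Nonempty := Finset.card_pos.mp (by rw [hc.2.1]; norm_num)
  have := openSegment_subset_openSimplex (h.isReg_mem hc.2.2.1).2 (baryPoint_mem_openSimplex hne)
    (⟨1 - ε s, ε s, by linarith [(hε s).lt_one], (hε s).pos, by ring, rfl⟩ :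
      singPoint ε s c ∈ openSegment ℝ c (baryPoint s))
  rwa [Finset.union_eq_right.mpr hc.2.2.2.1] at this

theorem exists_coord_eq_zero (h : IsResolutionDatum G Γ q δ K Φ δ₀ τ) {s : Finset W}
    {c : W →₀ ℝ} (hc : IsSing q K Φ τ s c) : ∃ a ∈ s, c a = 0 := by
  by_contra! hcon
  have : s ⊆ c.support := fun a ha => Finsupp.mem_support_iff.mpr (hcon a ha)
  have := Finset.card_le_card this
  rw [hc.2.1, h.card_support hc.2.2.1] at this
  omega

/-- Both segments lie on rays from boundary points to the barycentre and stop before reaching it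
because `ε s < 1`; such rays meet only at the barycentre. -/
theorem eq_of_mem_sing_segments (h : IsResolutionDatum G Γ q δ K Φ δ₀ τ)
    (hε : ∀ s, IsShort q K Φ τ s (ε s)) {s : Finset W} {x y p : W →₀ ℝ}
    (hx : IsSing q K Φ τ s x) (hy : IsSing q K Φ τ s y)
    (hpx : p ∈ segment ℝ x (singPoint ε s x)) (hpy : p ∈ segment ℝ y (singPoint ε s y)) :
    x = y := by
  have key : ∀ x, p ∈ segment ℝ x (singPoint ε s x) →
      ∃ t : ℝ, t < 1 ∧ p = (1 - t) • x + t • baryPoint s := by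
    rintro x ⟨α, β, hα, hβ, hαβ, rfl⟩
    refine ⟨β * ε s, ?_, ?_⟩
    · have := (hε s).lt_one
      have := (hε s).pos
      nlinarith
    · have : α = 1 - β := by linarith
      subst this
      simp only [singPoint, smul_add, smul_smul]
      rw [← add_assoc, ← add_smul]
      congr 2
      ring
  obtain ⟨t, ht, h1⟩ := key x hpx
  obtain ⟨t', ht', h2⟩ := key y hpy
  exact eq_of_combo_bary_eq (h.isReg_mem hx.2.2.1).2.2.1 (h.isReg_mem hy.2.2.1).2.2.1
    (h.exists_coord_eq_zero hx) (h.exists_coord_eq_zero hy) ht ht' (h1.symm.trans h2)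

theorem singPoint_smul (hε : ∀ (g : G), ∀ s ∈ K.faces, ε (g • s) = ε s) (g : G)
    {s : Finset W} (hs : s ∈ K.faces) (c : W →₀ ℝ) :
    pointSMul g (singPoint ε s c) = singPoint ε (g • s) (pointSMul g c) := by
  rw [singPoint, pointSMul_combo, pointSMul_baryPoint, singPoint, hε g s hs]

theorem singAdj_smul (h : IsResolutionDatum G Γ q δ K Φ δ₀ τ)
    (hε : ∀ (g : G), ∀ s ∈ K.faces, ε (g • s) = ε s) (g : G) {c y : W →₀ ℝ}
    (hc : SingAdj q K Φ τ ε c y) : SingAdj q K Φ τ ε (pointSMul g c) (pointSMul g y) := by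
  obtain ⟨s, hs, rfl⟩ := hc
  exact ⟨g • s, h.isSing_smul g hs, singPoint_smul hε g hs.1 c⟩

/-- The pattern of a resolution. -/
noncomputable def pattern (h : IsResolutionDatum G Γ q δ K Φ δ₀ τ)
    (hε : ∀ s, IsShort q K Φ τ s (ε s)) : WeightedSingularPattern K where
  connectors := {c | IsReg q K Φ τ c ∨ ∃ c', SingAdj q K Φ τ ε c' c}
  graph :=
    { Adj := fun c d => RegAdj q K Φ τ c d ∨ SingAdj q K Φ τ ε c d ∨ SingAdj q K Φ τ ε d c
      symm := ⟨fun c d hcd => by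
        rcases hcd with hcd | hcd | hcd
        · exact Or.inl (h.regAdj_symm hcd)
        · exact Or.inr (Or.inr hcd)
        · exact Or.inr (Or.inl hcd)⟩
      loopless := ⟨fun c hc => by
        have hsing : ¬ SingAdj q K Φ τ ε c c := by
          rintro ⟨s, hs, he⟩
          have h1 := (h.singPoint_mem hε hs).1
          rw [← he] at h1
          have h2 := h.card_support hs.2.2.1
          rw [h1, hs.2.1] at h2
          omega
        rcases hc with hc | hc | hc
        · have h1 := (h.regAdj_support hc).2
          rw [Finset.union_self, h.card_support (isReg_left hc)] at h1
          omega
        · exact hsing hc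
        · exact hsing hc⟩ }
  mem_of_adj := by
    rintro c d (hcd | ⟨s, hs, he⟩ | ⟨s, hs, he⟩)
    · exact ⟨Or.inl (isReg_left hcd), Or.inl (isReg_right hcd)⟩
    · exact ⟨Or.inl hs.2.2.1, Or.inr ⟨c, s, hs, he⟩⟩
    · exact ⟨Or.inr ⟨d, s, hs, he⟩, Or.inl hs.2.2.1⟩
  connector_mem := by
    rintro c (hc | ⟨c', s, hs, rfl⟩)
    · exact ⟨c.support, (h.isReg_mem hc).1, Or.inl (h.card_support hc), (h.isReg_mem hc).2⟩
    · exact ⟨s, hs.1, Or.inr hs.2.1, h.singPoint_mem hε hs⟩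
  segment_interior := by
    have key : ∀ c s, IsSing q K Φ τ s c →
        openSegment ℝ c (singPoint ε s c) ⊆ openSimplex s := by
      intro c s hs
      have := openSegment_subset_openSimplex (h.isReg_mem hs.2.2.1).2 (h.singPoint_mem hε hs)
      rwa [Finset.union_eq_right.mpr hs.2.2.2.1] at this
    rintro c d (hcd | ⟨s, hs, rfl⟩ | ⟨s, hs, rfl⟩)
    · exact ⟨_, (h.regAdj_support hcd).1, (h.regAdj_support hcd).2,
        openSegment_subset_openSimplex (h.isReg_mem (isReg_left hcd)).2
          (h.isReg_mem (isReg_right hcd)).2⟩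
    · exact ⟨s, hs.1, hs.2.1, key c s hs⟩
    · exact ⟨s, hs.1, hs.2.1, by rw [openSegment_symm]; exact key d s hs⟩
  regular_of_singular := by
    rintro c d (hcd | ⟨s, hs, rfl⟩ | ⟨s, hs, rfl⟩) hc
    · exact h.card_support (isReg_right hcd)
    · have h1 : c.support.card = 3 := hc
      rw [h.card_support hs.2.2.1] at h1
      omega
    · exact h.card_support hs.2.2.1
  singular_disjoint := by
    rintro c d hcd hc c' d' hcd' hne p hp hp' hpc
    have hp3 : p.support.card = 3 := hpc
    obtain ⟨s, hs, rfl⟩ : SingAdj q K Φ τ ε d c := by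
      have h1 : c.support.card = 3 := hc
      rcases hcd with hcd | ⟨s, hs, he⟩ | hcd
      · rw [h.card_support (isReg_left hcd)] at h1; omega
      · rw [h.card_support hs.2.2.1] at h1; omega
      · exact hcd
    rw [segment_symm] at hp
    have hps : p.support = s :=
      Finset.eq_of_subset_of_card_le (support_subset_of_mem_segment hs.2.2.2.1
        (h.singPoint_mem hε hs).1.subset hp) (by rw [hs.2.1, hp3])
    have hsing : ∀ y s', IsSing q K Φ τ s' y → p ∈ segment ℝ y (singPoint ε s' y) →
        s' = s ∧ y = d := by
      intro y s' hs' hy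
      have he : p.support = s' :=
        Finset.eq_of_subset_of_card_le (support_subset_of_mem_segment hs'.2.2.2.1
          (h.singPoint_mem hε hs').1.subset hy) (by rw [hs'.2.1, hp3])
      rw [hps] at he
      subst he
      exact ⟨rfl, h.eq_of_mem_sing_segments hε hs' hs hy hp⟩
    -- A regular segment in `s` cannot end at `d`, which has no regular partner there, so shortness
    -- excludes a meeting point. A singular segment through `p` lies in the same `s` and starts at
    -- `d`, so it is the same segment.
    rcases hcd' with hcd' | ⟨s', hs', rfl⟩ | ⟨s', hs', rfl⟩
    · have he : p.support = c'.support ∪ d'.support :=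
        Finset.eq_of_subset_of_card_le (support_subset_of_mem_segment Finset.subset_union_left
          Finset.subset_union_right hp') (by rw [(h.regAdj_support hcd').2, hp3])
      rw [hps] at he
      have h1 : d ≠ c' := by
        rintro rfl
        exact hs.2.2.2.2 d' hcd' (he ▸ Finset.subset_union_right)
      have h2 : d ≠ d' := by
        rintro rfl
        exact hs.2.2.2.2 c' (h.regAdj_symm hcd') (he ▸ Finset.subset_union_left)
      obtain ⟨α, β, hα, hβ, hαβ, rfl⟩ := hp
      refine (hε s).notMem d c' d' hs.2.2.1 hcd' hs.2.2.2.1 (he ▸ Finset.subset_union_left)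
        (he ▸ Finset.subset_union_right) h1 h2 (β * ε s)
        (mul_nonneg hβ (hε s).pos.le)
        (mul_le_of_le_one_left (hε s).pos.le (by linarith)) ?_
      convert hp' using 1
      have : α = 1 - β := by linarith
      subst this
      simp only [singPoint, smul_add, smul_smul]
      rw [← add_assoc, ← add_smul]
      congr 2
      ring
    · obtain ⟨rfl, rfl⟩ := hsing c' s' hs' hp'
      exact hne Sym2.eq_swap
    · rw [segment_symm] at hp'
      obtain ⟨rfl, rfl⟩ := hsing d' s' hs' hp'
      exact hne rfl
  finite_connectors := by
    intro s hs
    refine ((h.finite_isReg s).union ((h.finite_isReg s).image (singPoint ε s))).subset ?_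
    rintro c ⟨hc | ⟨c', s', hs', rfl⟩, hcs⟩
    · exact Or.inl ⟨hc, hcs.subset⟩
    · rw [(h.singPoint_mem hε hs').1] at hcs
      subst hcs
      exact Or.inr ⟨c', ⟨hs'.2.2.1, hs'.2.2.2.1⟩, rfl⟩
  unique_segment := by
    rintro c hc s hsK hs3 hcs
    rcases hc with hc | ⟨c', s', hs', rfl⟩
    · have hnot : ∀ y, ¬ SingAdj q K Φ τ ε y c := by
        rintro y ⟨s', hs', rfl⟩
        have h1 := h.card_support hc
        rw [(h.singPoint_mem hε hs').1, hs'.2.1] at h1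
        omega
      have hsing : ∀ y, SingAdj q K Φ τ ε c y → y.support ⊆ s →
          IsSing q K Φ τ s c ∧ y = singPoint ε s c := by
        rintro y ⟨s', hs', rfl⟩ hsub
        rw [(h.singPoint_mem hε hs').1] at hsub
        have : s' = s := Finset.eq_of_subset_of_card_le hsub (by rw [hs3, hs'.2.1])
        subst this
        exact ⟨hs', rfl⟩
      -- A regular connector has either its unique regular partner in `s` or, by the definition of
      -- `IsSing`, the singular one, but never both.
      by_cases hex : ∃ d, RegAdj q K Φ τ c d ∧ d.support ⊆ s
      · obtain ⟨d, hd, hds⟩ := hex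
        refine ⟨d, ⟨Or.inl hd, hds⟩, ?_⟩
        rintro d' ⟨hd' | hd' | hd', hds'⟩
        · exact h.regAdj_unique hs3 hd' hd hcs hds' hds
        · exact absurd hds ((hsing d' hd' hds').1.2.2.2.2 d hd)
        · exact absurd hd' (hnot d')
      · push Not at hex
        have hs : IsSing q K Φ τ s c := ⟨hsK, hs3, hc, hcs, hex⟩
        refine ⟨singPoint ε s c, ⟨Or.inr (Or.inl ⟨s, hs, rfl⟩),
          (h.singPoint_mem hε hs).1.subset⟩, ?_⟩
        rintro d' ⟨hd' | hd' | hd', hds'⟩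
        · exact absurd hds' (hex d' hd')
        · exact (hsing d' hd' hds').2
        · exact absurd hd' (hnot d')
    · have hnot : ¬ IsReg q K Φ τ (singPoint ε s' c') := fun hr => by
        have h1 := h.card_support hr
        rw [(h.singPoint_mem hε hs').1, hs'.2.1] at h1
        omega
      rw [(h.singPoint_mem hε hs').1] at hcs
      have : s' = s := Finset.eq_of_subset_of_card_le hcs (by rw [hs3, hs'.2.1])
      subst this
      refine ⟨c', ⟨Or.inr (Or.inr ⟨s', hs', rfl⟩), hs'.2.2.2.1⟩, ?_⟩
      rintro d' ⟨hd' | ⟨s, hs, _⟩ | ⟨s, hs, he⟩, _⟩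
      · exact absurd (isReg_left hd') hnot
      · exact absurd hs.2.2.1 hnot
      · have hss : s' = s := by
          rw [← (h.singPoint_mem hε hs').1, he, (h.singPoint_mem hε hs).1]
        subst hss
        exact h.eq_of_mem_sing_segments hε hs hs' (right_mem_segment ℝ _ _)
          (he ▸ right_mem_segment ℝ _ _)
  weight := connWeight q K Φ τ
  weight_singular := by
    intro c _ hc
    have hnot : ¬ IsReg q K Φ τ c := fun hr => by
      have h1 : c.support.card = 3 := hc
      rw [h.card_support hr] at h1
      omega
    rw [connWeight, dif_neg hnot]

theorem pattern_isInvariant (h : IsResolutionDatum G Γ q δ K Φ δ₀ τ)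
    (hε : ∀ s, IsShort q K Φ τ s (ε s)) (hε' : ∀ (g : G), ∀ s ∈ K.faces, ε (g • s) = ε s) :
    (h.pattern hε).IsInvariant G where
  connectors := by
    rintro g c (hc | ⟨c', hc⟩)
    · exact Or.inl (h.isReg_smul g hc)
    · exact Or.inr ⟨_, h.singAdj_smul hε' g hc⟩
  segments := by
    rintro g c d (hcd | hcd | hcd)
    · exact Or.inl (h.regAdj_smul g hcd)
    · exact Or.inr (Or.inl (h.singAdj_smul hε' g hcd))
    · exact Or.inr (Or.inr (h.singAdj_smul hε' g hcd))
  weight := by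
    intro g c _
    change connWeight q K Φ τ (pointSMul g c) = connWeight q K Φ τ c
    by_cases hc : IsReg q K Φ τ c
    · obtain ⟨a, b, f, hab, hf, rfl⟩ := hc
      rw [← NNReal.coe_inj, h.connWeight_eq hab hf, h.pointSMul_edgePoint hab,
        h.connWeight_eq (h.action.adj_smul g hab) ((h.mem_supp_smul g).mpr hf), h.map_smul,
        h.map_smul, h.bicombing.smul]
    · have hc' : ¬ IsReg q K Φ τ (pointSMul g c) := fun hr => hc (by
        have := h.isReg_smul g⁻¹ hr
        have e : pointSMul g⁻¹ (pointSMul g c) = c := by simpa using pointSMul_inv_smul g⁻¹ c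
        rwa [e] at this)
      rw [connWeight, connWeight, dif_neg hc, dif_neg hc']

/-- The pattern has the required properties because regular and singular connectors are told apart
by the size of their supports, and a regular connector recovers its oriented data up to reversal. -/
theorem nonempty_resolution (h : IsResolutionDatum G Γ q δ K Φ δ₀ τ) :
    Nonempty (Resolution G Γ q K Φ δ₀) := by
  obtain ⟨ε, hε, hε'⟩ := h.exists_isShort_invariant
  have hreg : ∀ c, (IsReg q K Φ τ c ∨ ∃ c', SingAdj q K Φ τ ε c' c) → c.support.card = 2 →
      IsReg q K Φ τ c := by
    rintro c (hc | ⟨c', s, hs, rfl⟩) hcard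
    · exact hc
    · rw [(h.singPoint_mem hε hs).1, hs.2.1] at hcard
      omega
  refine ⟨{ toWeightedSingularPattern := h.pattern hε
            invariant := h.pattern_isInvariant hε hε'
            conn := fun a b f => edgePoint a b (τ a b f)
            conn_bijOn := fun a b hab => ⟨?_, ?_, ?_⟩
            conn_symm := fun a b hab f _ => h.edgePoint_swap hab f
            conn_equivariant := fun a b hab f _ g => h.pointSMul_edgePoint hab f g
            quasi_ordered := fun a b hab f hf f' hf' hlt => ?_
            weight_conn := fun a b hab f hf => h.connWeight_eq hab hf
            adj_iff := fun s hs hs3 c hc c' hc' hcr hcr' hcs hcs' => ⟨?_, ?_⟩ }⟩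
  · exact fun f hf => ⟨Or.inl ⟨a, b, f, hab, hf, rfl⟩, h.support_eq hab f⟩
  · exact fun f hf f' hf' he => h.eq_of_edgePoint_eq hab hf hf' he
  · rintro c ⟨hc, hcs⟩
    obtain ⟨a', b', f, hab', hf, rfl⟩ := hreg c hc (by rw [hcs, Finset.card_pair hab.1])
    rw [h.support_eq hab'] at hcs
    have ha : a' ∈ ({a, b} : Finset W) := hcs ▸ by simp
    have hb : b' ∈ ({a, b} : Finset W) := hcs ▸ by simp
    simp only [Finset.mem_insert, Finset.mem_singleton] at ha hb
    rcases ha with rfl | rfl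
    · have : b' = b := hb.resolve_left hab'.1.symm
      subst this
      exact ⟨f, hf, rfl⟩
    · have : b' = a := hb.resolve_right hab'.1.symm
      subst this
      exact ⟨f.swap, h.bicombing.mem_swap_iff.mpr hf, h.edgePoint_swap hab' f⟩
  · rw [edgePoint_apply_right hab.1, edgePoint_apply_right hab.1]
    exact h.positioning.order a b hab f hf f' hf' hlt
  · intro hadj
    have hnot : ∀ x y, IsReg q K Φ τ y → ¬ SingAdj q K Φ τ ε x y := by
      rintro x y hy ⟨s, hs, rfl⟩
      have h1 := h.card_support hy
      rw [(h.singPoint_mem hε hs).1, hs.2.1] at h1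
      omega
    rcases hadj with hadj | hadj | hadj
    · obtain ⟨a, b, d, f, ht, h1, h2, h3, h4, rfl, rfl⟩ := hadj
      refine ⟨a, b, d, f, ?_, h1, h2, h3, h4, rfl, rfl⟩
      rw [h.support_eq ht.1] at hcs
      rw [h.support_eq ht.2.1] at hcs'
      refine (Finset.eq_of_subset_of_card_le ?_ (by rw [hs3, ht.card])).symm
      intro x hx
      simp only [Finset.mem_insert, Finset.mem_singleton] at hx
      rcases hx with rfl | rfl | rfl
      · exact hcs (by simp)
      · exact hcs (by simp)
      · exact hcs' (by simp)
    · exact absurd hadj (hnot _ _ (hreg c' hc' hcr'))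
    · exact absurd hadj (hnot _ _ (hreg c hc hcr))
  · rintro ⟨a, b, d, f, rfl, h1, h2, h3, h4, rfl, rfl⟩
    exact Or.inl ⟨a, b, d, f, IsTriangle.of_face hs hs3, h1, h2, h3, h4, rfl, rfl⟩

end IsResolutionDatum

end Construction

/-! ### A resolution inside one 2-simplex -/

section LocalStructure

variable {G : Type u} [Group G] {Y : Type y} [MulAction G Y] {Γ : SimpleGraph Y}
  {q : Y → Y → (Y × Y →₀ ℚ)} {δ : ℕ} {W : Type w} [DecidableEq W] [MulAction G W]
  {K : AbstractSimplicialComplex W} {Φ : W → Y} {δ₀ : ℝ}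

namespace SingularPattern

theorem not_isSingularPoint_of_isRegularPoint {c : W →₀ ℝ} (h : IsRegularPoint c) :
    ¬ IsSingularPoint c := by
  unfold IsRegularPoint IsSingularPoint at *
  omega

theorem isRegularPoint_or_isSingularPoint (F : SingularPattern K) {c : W →₀ ℝ}
    (hc : c ∈ F.connectors) : IsRegularPoint c ∨ IsSingularPoint c := by
  obtain ⟨s, _, h, hs⟩ := F.connector_mem c hc
  unfold IsRegularPoint IsSingularPoint
  rwa [hs.1]

/-- A segment lies in the 2-simplex spanned by the supports of its endpoints. -/
theorem union_support_of_adj (F : SingularPattern K) {c d : W →₀ ℝ} (h : F.graph.Adj c d) :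
    c.support ∪ d.support ∈ K.faces ∧ (c.support ∪ d.support).card = 3 := by
  obtain ⟨s, hs, hs3, hseg⟩ := F.segment_interior c d h
  obtain ⟨hc, hd⟩ := F.mem_of_adj c d h
  obtain ⟨sc, _, _, hc⟩ := F.connector_mem c hc
  obtain ⟨sd, _, _, hd⟩ := F.connector_mem d hd
  have hmid : (2⁻¹ : ℝ) • c + (2⁻¹ : ℝ) • d ∈ openSegment ℝ c d :=
    ⟨2⁻¹, 2⁻¹, by norm_num, by norm_num, by norm_num, rfl⟩
  have h1 := (hseg hmid).1
  rw [(openSegment_subset_openSimplex hc hd hmid).1] at h1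
  rw [hc.1, hd.1, h1]
  exact ⟨hs, hs3⟩

end SingularPattern

/-- Three edges of a 2-simplex with the same edge `f` (up to orientation) in their supports. -/
def IsTriple (q : Y → Y → (Y × Y →₀ ℚ)) (Φ : W → Y) (a b d : W) (f : Y × Y) : Prop :=
  f ∈ chainSupp (q (Φ a) (Φ b)) ∧
    (f ∈ chainSupp (q (Φ b) (Φ d)) ∨ f.swap ∈ chainSupp (q (Φ b) (Φ d))) ∧
    (f ∈ chainSupp (q (Φ a) (Φ d)) ∨ f.swap ∈ chainSupp (q (Φ a) (Φ d)))

namespace Resolution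

variable (F : Resolution G Γ q K Φ δ₀)

theorem conn_mem {a b : W} {f : Y × Y} (hab : (oneSkeleton K).Adj a b)
    (hf : f ∈ chainSupp (q (Φ a) (Φ b))) :
    F.conn a b f ∈ F.connectors ∧ (F.conn a b f).support = {a, b} :=
  (F.conn_bijOn a b hab).mapsTo hf

theorem isRegularPoint_conn {a b : W} {f : Y × Y} (hab : (oneSkeleton K).Adj a b)
    (hf : f ∈ chainSupp (q (Φ a) (Φ b))) : IsRegularPoint (F.conn a b f) := by
  unfold IsRegularPoint
  rw [(F.conn_mem hab hf).2, Finset.card_pair hab.1]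

theorem eq_or_eq_of_conn_eq {a b a' b' : W} (hab : (oneSkeleton K).Adj a b)
    (hab' : (oneSkeleton K).Adj a' b') {f f' : Y × Y} (hq : IsUniformBicombing G Γ q δ)
    (hf : f ∈ chainSupp (q (Φ a) (Φ b))) (hf' : f' ∈ chainSupp (q (Φ a') (Φ b')))
    (he : F.conn a b f = F.conn a' b' f') :
    (a' = a ∧ b' = b ∧ f' = f) ∨ (a' = b ∧ b' = a ∧ f' = f.swap) := by
  have hs : ({a, b} : Finset W) = {a', b'} := by
    rw [← (F.conn_mem hab hf).2, he, (F.conn_mem hab' hf').2]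
  have ha : a ∈ ({a', b'} : Finset W) := hs ▸ by simp
  have hb : b ∈ ({a', b'} : Finset W) := hs ▸ by simp
  simp only [Finset.mem_insert, Finset.mem_singleton] at ha hb
  rcases ha with rfl | rfl
  · obtain rfl := hb.resolve_left hab.1.symm
    exact Or.inl ⟨rfl, rfl, ((F.conn_bijOn a b hab).injOn hf hf' he).symm⟩
  · obtain rfl := hb.resolve_right hab.1.symm
    have hf'' : f'.swap ∈ chainSupp (q (Φ a) (Φ b)) := hq.mem_swap_iff.mpr hf'
    rw [← F.conn_symm _ _ hab' f' hf'] at he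
    have := (F.conn_bijOn a b hab).injOn hf hf'' he
    exact Or.inr ⟨rfl, rfl, by rw [this, Prod.swap_swap]⟩

theorem adj_right (hq : IsUniformBicombing G Γ q δ) {a b d : W} {f : Y × Y}
    (ht : IsTriangle K a b d) (hf : f ∈ chainSupp (q (Φ a) (Φ b)))
    (hf' : f ∈ chainSupp (q (Φ a) (Φ d))) (h1 : f ∉ chainSupp (q (Φ b) (Φ d)))
    (h2 : f.swap ∉ chainSupp (q (Φ b) (Φ d))) :
    F.graph.Adj (F.conn a b f) (F.conn a d f) := by
  have c1 := F.conn_mem ht.1 hf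
  have c2 := F.conn_mem ht.2.2.1 hf'
  refine (F.adj_iff {a, b, d} ht.2.2.2 ht.card _ c1.1 _ c2.1 (F.isRegularPoint_conn ht.1 hf)
    (F.isRegularPoint_conn ht.2.2.1 hf') ?_ ?_).mpr ⟨b, a, d, f.swap, ?_, hq.mem_swap_iff.mpr hf,
      by rwa [Prod.swap_swap], fun h => h1 ?_, fun h => h2 ?_, (F.conn_symm a b ht.1 f hf).symm,
      by rw [Prod.swap_swap]⟩
  · rw [c1.2]; intro z; simp; tauto
  · rw [c2.2]; intro z; simp; tauto
  · exact Finset.insert_comm a b {d}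
  · exact hq.mem_swap_iff.mp h
  · exact hq.mem_swap_iff.mp h

theorem adj_left (hq : IsUniformBicombing G Γ q δ) {a b d : W} {f : Y × Y}
    (ht : IsTriangle K a b d) (hf : f ∈ chainSupp (q (Φ a) (Φ b)))
    (hf' : f ∈ chainSupp (q (Φ d) (Φ b))) (h1 : f ∉ chainSupp (q (Φ a) (Φ d)))
    (h2 : f.swap ∉ chainSupp (q (Φ a) (Φ d))) :
    F.graph.Adj (F.conn a b f) (F.conn d b f) := by
  have ht' : IsTriangle K b a d := ht.rotate.rotate.swap
  have := F.adj_right hq ht' (f := f.swap) (hq.mem_swap_iff.mpr hf) (hq.mem_swap_iff.mpr hf') h2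
    (by rwa [Prod.swap_swap])
  rwa [F.conn_symm a b ht.1 f hf, F.conn_symm d b ht.2.1.symm f hf'] at this

/-- The connectors which may be joined to a regular one in a given 2-simplex. -/
theorem eq_of_adj (hq : IsUniformBicombing G Γ q δ) {a b d : W} {f : Y × Y} {c : W →₀ ℝ}
    (ht : IsTriangle K a b d) (hf : f ∈ chainSupp (q (Φ a) (Φ b)))
    (hc : F.graph.Adj (F.conn a b f) c) (hcs : c.support ⊆ {a, b, d}) :
    IsSingularPoint c ∨
    (f ∈ chainSupp (q (Φ d) (Φ b)) ∧ f ∉ chainSupp (q (Φ a) (Φ d)) ∧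
      f.swap ∉ chainSupp (q (Φ a) (Φ d)) ∧ c = F.conn d b f) ∨
    (f ∈ chainSupp (q (Φ a) (Φ d)) ∧ f ∉ chainSupp (q (Φ b) (Φ d)) ∧
      f.swap ∉ chainSupp (q (Φ b) (Φ d)) ∧ c = F.conn a d f) := by
  have hcm := (F.mem_of_adj _ _ hc).2
  rcases F.isRegularPoint_or_isSingularPoint hcm with hreg | hsing
  swap
  · exact Or.inl hsing
  right
  have c1 := F.conn_mem ht.1 hf
  obtain ⟨a', b', d', f', hs, h1, h2, h3, h4, he, rfl⟩ := (F.adj_iff {a, b, d} ht.2.2.2 ht.card _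
    c1.1 _ hcm (F.isRegularPoint_conn ht.1 hf) hreg
    (by rw [c1.2]; intro z; simp; tauto) hcs).mp hc
  have ht' : IsTriangle K a' b' d' := IsTriangle.of_face (hs ▸ ht.2.2.2) (hs ▸ ht.card)
  have hd : d ∈ ({a', b', d'} : Finset W) := hs ▸ by simp
  simp only [Finset.mem_insert, Finset.mem_singleton] at hd
  rcases F.eq_or_eq_of_conn_eq ht.1 ht'.1 hq hf h1 he with ⟨rfl, rfl, rfl⟩ | ⟨rfl, rfl, rfl⟩
  · obtain rfl : d = d' :=
      (hd.resolve_left ht.2.2.1.1.symm).resolve_left ht.2.1.1.symm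
    refine Or.inl ⟨by simpa using hq.mem_swap_iff.mpr h2, fun h => h4 (hq.mem_swap_iff.mpr h),
      fun h => h3 (hq.mem_swap_iff.mp h), ?_⟩
    have := F.conn_symm _ _ ht.2.1 _ h2
    rw [← this, Prod.swap_swap]
  · obtain rfl : d = d' :=
      (hd.resolve_left ht.2.1.1.symm).resolve_left ht.2.2.1.1.symm
    rw [Prod.swap_swap] at h2 h4
    refine Or.inr ⟨h2, fun h => h3 (hq.mem_swap_iff.mpr h), fun h => h4 (hq.mem_swap_iff.mp h), ?_⟩
    rw [Prod.swap_swap]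

theorem weight_le (hq : IsUniformBicombing G Γ q δ) {a b : W} {f : Y × Y}
    (hab : (oneSkeleton K).Adj a b) (hf : f ∈ chainSupp (q (Φ a) (Φ b))) :
    F.weight (F.conn a b f) ≤ δ := by
  have h : (F.weight (F.conn a b f) : ℝ) ≤ δ := by
    rw [F.weight_conn a b hab f hf]
    exact_mod_cast (le_abs_self _).trans (hq.bounded _ _ f)
  exact_mod_cast h

/-- The weights of the endpoints of a segment differ at most by the defect of `q`, unless the
corresponding edge is in the support over the three edges of the 2-simplex. -/
theorem abs_weight_sub_le (hq : IsUniformBicombing G Γ q δ) {a b d : W} {f : Y × Y}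
    {c : W →₀ ℝ} (ht : IsTriangle K a b d) (hf : f ∈ chainSupp (q (Φ a) (Φ b)))
    (hc : F.graph.Adj (F.conn a b f) c) (hcs : c.support ⊆ {a, b, d})
    (htr : ¬ IsTriple q Φ a b d f) :
    |(F.weight (F.conn a b f) : ℝ) - F.weight c| ≤
      (|q (Φ a) (Φ b) f + q (Φ b) (Φ d) f + q (Φ d) (Φ a) f| : ℚ) := by
  have hzero : ∀ x y, f ∉ chainSupp (q x y) → f.swap ∉ chainSupp (q x y) → q x y f = 0 := by
    intro x y h1 h2
    have h1' : ¬ 0 < q x y f := h1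
    have h2' : ¬ 0 < q x y f.swap := h2
    rw [hq.swap] at h2'
    linarith
  have hpos : 0 < q (Φ a) (Φ b) f := hf
  rcases F.eq_of_adj hq ht hf hc hcs with hsing | ⟨h1, h2, h3, rfl⟩ | ⟨h1, h2, h3, rfl⟩
  · have hsup : (F.conn a b f).support ⊆ {a, b, d} := by
      rw [(F.conn_mem ht.1 hf).2]; intro z; simp; tauto
    have huniq : ∀ c', IsRegularPoint c' → c'.support ⊆ {a, b, d} →
        ¬ F.graph.Adj (F.conn a b f) c' := by
      intro c' hc' hs' hadj
      have := (F.unique_segment _ (F.conn_mem ht.1 hf).1 _ ht.2.2.2 ht.card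
        hsup).unique ⟨hc, hcs⟩ ⟨hadj, hs'⟩
      subst this
      exact SingularPattern.not_isSingularPoint_of_isRegularPoint hc' hsing
    rw [F.weight_singular c (F.mem_of_adj _ _ hc).2 hsing, F.weight_conn a b ht.1 f hf]
    -- A negative contribution from one of the other two sides would yield a regular partner, unless
    -- `f` lies over all three sides. Neither can happen here, so the two contributions have
    -- nonnegative sum.
    have key : q (Φ a) (Φ b) f ≤ q (Φ a) (Φ b) f + q (Φ b) (Φ d) f + q (Φ d) (Φ a) f := by
      have hbd := hq.symm (Φ b) (Φ d) f
      have had := hq.symm (Φ a) (Φ d) f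
      by_cases hB : f ∈ chainSupp (q (Φ b) (Φ d)) ∨ f.swap ∈ chainSupp (q (Φ b) (Φ d))
      · by_cases hA : f ∈ chainSupp (q (Φ a) (Φ d)) ∨ f.swap ∈ chainSupp (q (Φ a) (Φ d))
        · exact absurd ⟨hf, hB, hA⟩ htr
        · push Not at hA
          have h0 := hzero _ _ hA.1 hA.2
          rcases hB with hB | hB
          · have : 0 < q (Φ b) (Φ d) f := hB
            linarith
          · have hB' : f ∈ chainSupp (q (Φ d) (Φ b)) := by simpa using hq.mem_swap_iff.mpr hB
            refine absurd (F.adj_left hq ht hf hB' hA.1 hA.2)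
              (huniq _ (F.isRegularPoint_conn ht.2.1.symm hB') ?_)
            rw [(F.conn_mem ht.2.1.symm hB').2]; intro z; simp; tauto
      · push Not at hB
        have h0 := hzero _ _ hB.1 hB.2
        by_cases hA : f ∈ chainSupp (q (Φ a) (Φ d))
        · refine absurd (F.adj_right hq ht hf hA hB.1 hB.2)
            (huniq _ (F.isRegularPoint_conn ht.2.2.1 hA) ?_)
          rw [(F.conn_mem ht.2.2.1 hA).2]; intro z; simp; tauto
        · have hA' : ¬ 0 < q (Φ a) (Φ d) f := hA
          linarith
    have habs := key.trans (le_abs_self _)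
    rw [NNReal.coe_zero, sub_zero, abs_of_pos (by exact_mod_cast hpos)]
    exact_mod_cast habs
  · have h0 := hzero _ _ h2 h3
    have hbd := hq.symm (Φ d) (Φ b) f
    have had := hq.symm (Φ a) (Φ d) f
    rw [F.weight_conn a b ht.1 f hf, F.weight_conn d b ht.2.1.symm f h1, hbd, had, h0]
    push_cast
    rw [neg_zero, add_zero, sub_eq_add_neg]
  · have h0 := hzero _ _ h2 h3
    have had := hq.symm (Φ a) (Φ d) f
    rw [F.weight_conn a b ht.1 f hf, F.weight_conn a d ht.2.2.1 f h1, had, h0]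
    push_cast
    rw [add_zero, sub_eq_add_neg]

end Resolution

end LocalStructure

/-! ### Tracks in the quotient -/

section QuotientTracks

variable {G : Type u} [Group G] {W : Type w} [DecidableEq W] [MulAction G W]
  {K : AbstractSimplicialComplex W}

/-- The connector `c` belongs to `S` and to the track `t` of the pattern induced by `S` on the
quotient. -/
def InTrack {F : WeightedSingularPattern K} {S : Set (W →₀ ℝ)}
    (t : Quotient (F.quotientTracks G S)) (c : W →₀ ℝ) : Prop :=
  ∃ h : c ∈ S, Quotient.mk (F.quotientTracks G S) ⟨c, h⟩ = t

namespace InTrack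

variable {F : WeightedSingularPattern K} {S : Set (W →₀ ℝ)}
  {t t' : Quotient (F.quotientTracks G S)} {c d : W →₀ ℝ}

theorem eq (h : InTrack t c) (h' : InTrack t' c) : t = t' := by
  obtain ⟨_, rfl⟩ := h
  obtain ⟨_, rfl⟩ := h'
  rfl

theorem adj (h : InTrack t c) (hcd : F.graph.Adj c d) (hd : d ∈ S) : InTrack t d := by
  obtain ⟨hc, rfl⟩ := h
  exact ⟨hd, Quotient.sound (Relation.EqvGen.symm _ _ (Relation.EqvGen.rel _ _ (Or.inl hcd)))⟩

theorem smul (h : InTrack t c) (g : G) (hd : pointSMul g c ∈ S) : InTrack t (pointSMul g c) := by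
  obtain ⟨hc, rfl⟩ := h
  exact ⟨hd, Quotient.sound (Relation.EqvGen.symm _ _
    (Relation.EqvGen.rel _ _ (Or.inr ⟨g, rfl⟩)))⟩

/-- A reflexive, symmetric and transitive relation which holds for adjacent and for equivalent
connectors of a track holds for any two of its connectors. -/
theorem induction (h : InTrack t c) (h' : InTrack t d) (Q : (W →₀ ℝ) → (W →₀ ℝ) → Prop)
    (hrefl : ∀ c, Q c c) (hsymm : ∀ c d, Q c d → Q d c) (htrans : ∀ c d e, Q c d → Q d e → Q c e)
    (hadj : ∀ c d, InTrack t c → InTrack t d → F.graph.Adj c d → Q c d)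
    (hsmul : ∀ (g : G) c, InTrack t c → InTrack t (pointSMul g c) → Q c (pointSMul g c)) :
    Q c d := by
  obtain ⟨hc, rfl⟩ := h
  obtain ⟨hd, h'⟩ := h'
  have key : ∀ x y : S, Relation.EqvGen (fun c d : S => F.graph.Adj c.1 d.1 ∨
      ∃ g : G, pointSMul g c.1 = d.1) x y →
      Quotient.mk (F.quotientTracks G S) x = Quotient.mk (F.quotientTracks G S) ⟨c, hc⟩ →
      Q x.1 y.1 := by
    intro x y hxy
    induction hxy with
    | rel x y hxy =>
      intro hx
      have hy : Quotient.mk (F.quotientTracks G S) y =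
          Quotient.mk (F.quotientTracks G S) ⟨c, hc⟩ := by
        rw [← hx]
        exact Quotient.sound (Relation.EqvGen.symm _ _ (Relation.EqvGen.rel _ _ hxy))
      rcases hxy with hxy | ⟨g, hg⟩
      · exact hadj _ _ ⟨x.2, hx⟩ ⟨y.2, hy⟩ hxy
      · have h1 : InTrack (Quotient.mk (F.quotientTracks G S) ⟨c, hc⟩) y.1 := ⟨y.2, hy⟩
        rw [← hg] at h1 ⊢
        exact hsmul g _ ⟨x.2, hx⟩ h1
    | refl x => exact fun _ => hrefl _
    | symm x y hxy ih =>
      intro hy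
      refine hsymm _ _ (ih ?_)
      rw [← hy]
      exact Quotient.sound hxy
    | trans x y z hxy _ ih₁ ih₂ =>
      intro hx
      refine htrans _ _ _ (ih₁ hx) (ih₂ ?_)
      rw [← hx]
      exact Quotient.sound (Relation.EqvGen.symm _ _ hxy)
  exact key ⟨c, hc⟩ ⟨d, hd⟩ (Quotient.exact h'.symm) rfl

end InTrack

end QuotientTracks

/-! ### Tracks without singular connectors as cuts -/

section RegularTracks

variable {G : Type u} [Group G] {Y : Type y} [MulAction G Y] {Γ : SimpleGraph Y}
  {q : Y → Y → (Y × Y →₀ ℚ)} {δ : ℕ} {W : Type w} [DecidableEq W] [MulAction G W]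
  {K : AbstractSimplicialComplex W} {Φ : W → Y} {δ₀ : ℝ}

/-- Up to translation there are finitely many edges of `K` with finite supports, and by properness
only finitely many elements move `f` into them. -/
theorem finite_edges_of_mem_supp (hq : IsUniformBicombing G Γ q δ)
    (hstab : ∀ a : Y, (MulAction.stabilizer G a : Set G).Finite)
    (hΦ : ∀ (g : G) a, Φ (g • a) = g • Φ a) {E₀ : Finset (W × W)}
    (hE₀ : ∀ a b, (oneSkeleton K).Adj a b → ∃ g : G, (g • a, g • b) ∈ E₀) (f : Y × Y) :
    {p : W × W | (oneSkeleton K).Adj p.1 p.2 ∧ f ∈ chainSupp (q (Φ p.1) (Φ p.2))}.Finite := by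
  have h1 : (⋃ e ∈ (E₀ : Set (W × W)), ⋃ f' ∈ chainSupp (q (Φ e.1) (Φ e.2)),
      (fun g : G => g⁻¹ • e) '' {g | g • f.1 = f'.1}).Finite :=
    E₀.finite_toSet.biUnion fun e _ => (chainSupp_finite _).biUnion fun f' _ =>
      (finite_smul_eq (hstab f.1) f'.1).image _
  refine h1.subset ?_
  rintro ⟨a, b⟩ ⟨hab, hf⟩
  obtain ⟨g, hg⟩ := hE₀ a b hab
  simp only [Set.mem_iUnion]
  refine ⟨_, hg, g • f, ?_, g, rfl, by simp⟩
  simp only [hΦ]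
  exact (hq.smul_mem_iff g).mpr hf

/-- Two edges of a 2-simplex with `f`, but not the third one, in their supports, and the same
orientation with respect to it. -/
def TrackStep (q : Y → Y → (Y × Y →₀ ℚ)) (K : AbstractSimplicialComplex W) (Φ : W → Y)
    (f : Y × Y) (p p' : W × W) : Prop :=
  ∃ a b d, IsTriangle K a b d ∧ p = (a, b) ∧ f ∈ chainSupp (q (Φ a) (Φ b)) ∧
    ((p' = (a, d) ∧ f ∈ chainSupp (q (Φ a) (Φ d)) ∧ f ∉ chainSupp (q (Φ b) (Φ d)) ∧
        f.swap ∉ chainSupp (q (Φ b) (Φ d))) ∨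
      (p' = (d, b) ∧ f ∈ chainSupp (q (Φ d) (Φ b)) ∧ f ∉ chainSupp (q (Φ a) (Φ d)) ∧
        f.swap ∉ chainSupp (q (Φ a) (Φ d))))

theorem TrackStep.symm (hq : IsUniformBicombing G Γ q δ) {f : Y × Y} {p p' : W × W}
    (h : TrackStep q K Φ f p p') : TrackStep q K Φ f p' p := by
  obtain ⟨a, b, d, ht, rfl, hf, ⟨rfl, h1, h2, h3⟩ | ⟨rfl, h1, h2, h3⟩⟩ := h
  · exact ⟨a, d, b, ht.swap.rotate.rotate, rfl, h1, Or.inl ⟨rfl, hf,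
      fun h => h3 (hq.mem_swap_iff.mpr h), fun h => h2 (hq.mem_swap_iff.mp h)⟩⟩
  · exact ⟨d, b, a, ht.swap, rfl, h1, Or.inr ⟨rfl, hf,
      fun h => h3 (hq.mem_swap_iff.mpr h), fun h => h2 (hq.mem_swap_iff.mp h)⟩⟩

/-- The edges related to a given one by a sequence of steps, when a step is possible in every
2-simplex, are those leaving a set of vertices. -/
theorem exists_cut (hq : IsUniformBicombing G Γ q δ) (hK : IsSimplyConnectedComplex K)
    {f : Y × Y} {T : Set (W × W)}
    (hT : ∀ p ∈ T, (oneSkeleton K).Adj p.1 p.2 ∧ f ∈ chainSupp (q (Φ p.1) (Φ p.2)))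
    (hstep : ∀ a b d, (a, b) ∈ T → IsTriangle K a b d →
      ((a, d) ∈ T ∧ f ∉ chainSupp (q (Φ b) (Φ d)) ∧ f.swap ∉ chainSupp (q (Φ b) (Φ d))) ∨
      ((d, b) ∈ T ∧ f ∉ chainSupp (q (Φ a) (Φ d)) ∧ f.swap ∉ chainSupp (q (Φ a) (Φ d))))
    (hconn : ∀ p ∈ T, ∀ p' ∈ T, Relation.ReflTransGen (TrackStep q K Φ f) p p')
    (hclosed : ∀ p ∈ T, ∀ p', TrackStep q K Φ f p p' → p' ∈ T) (hne : T.Nonempty) :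
    ∃ S : Set W, ∀ a b, IsExit K S a b ↔ (a, b) ∈ T := by
  classical
  have hanti : ∀ a b, (a, b) ∈ T → (b, a) ∉ T := fun a b h h' =>
    hq.swap_notMem (hT _ h).2 (hT _ h').2
  -- The signed indicator of crossing the track. By `hstep` the track crosses a 2-simplex through
  -- exactly two sides with opposite signs, so this is a cocycle.
  let η : W → W → ℤ := fun a b => if (a, b) ∈ T then 1 else if (b, a) ∈ T then -1 else 0
  have η_pos : ∀ a b, (a, b) ∈ T → η a b = 1 := fun a b h => if_pos h
  have η_neg : ∀ a b, η b a = - η a b := by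
    intro a b
    by_cases h : (a, b) ∈ T
    · simp [η, h, hanti a b h]
    · by_cases h' : (b, a) ∈ T <;> simp [η, h, h']
  have η_zero : ∀ a b, f ∉ chainSupp (q (Φ a) (Φ b)) → f.swap ∉ chainSupp (q (Φ a) (Φ b)) →
      η a b = 0 := by
    intro a b h1 h2
    have h3 : (a, b) ∉ T := fun h => h1 (hT _ h).2
    have h4 : (b, a) ∉ T := fun h => h2 (hq.mem_swap_iff.mpr (hT _ h).2)
    simp [η, h3, h4]
  have key : ∀ a b d, IsTriangle K a b d → (a, b) ∈ T → η a b + η b d + η d a = 0 := by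
    intro a b d ht h
    rcases hstep a b d h ht with ⟨h1, h2, h3⟩ | ⟨h1, h2, h3⟩
    · rw [η_pos _ _ h, η_zero _ _ h2 h3, η_neg a d, η_pos _ _ h1]; rfl
    · rw [η_pos _ _ h, η_neg a d, η_zero _ _ h2 h3, η_neg d b, η_pos _ _ h1]; rfl
  have hcoc : ∀ a b d, IsTriangle K a b d → η a b + η b d + η d a = 0 := by
    intro a b d ht
    have e1 := η_neg a b
    have e2 := η_neg b d
    have e3 := η_neg d a
    by_cases h1 : (a, b) ∈ T
    · exact key a b d ht h1
    by_cases h2 : (b, d) ∈ T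
    · have := key b d a ht.rotate h2; omega
    by_cases h3 : (d, a) ∈ T
    · have := key d a b ht.rotate.rotate h3; omega
    by_cases h4 : (b, a) ∈ T
    · have := key b a d ht.rotate.rotate.swap h4; omega
    by_cases h5 : (d, b) ∈ T
    · have := key d b a ht.swap h5; omega
    by_cases h6 : (a, d) ∈ T
    · have := key a d b ht.swap.rotate.rotate h6; omega
    simp [η, h1, h2, h3, h4, h5, h6]
  obtain ⟨h, hh⟩ := exists_potential hK η_neg (fun a b d h1 h2 h3 h4 => by
    have := hcoc a b d ⟨h1, h2, h3, h4⟩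
    have e3 := η_neg a d
    omega)
  have hup : ∀ a b, (a, b) ∈ T → h b = h a + 1 := fun a b hab => by
    rw [hh a b (hT _ hab).1, η_pos _ _ hab]
  obtain ⟨p₀, hp₀⟩ := hne
  -- Every edge of the track raises the potential by one. A step keeps the origin or the target of
  -- the edge, hence also the level of the origin.
  have hlev : ∀ p, Relation.ReflTransGen (TrackStep q K Φ f) p₀ p → p ∈ T ∧ h p.1 = h p₀.1 := by
    intro p hp
    induction hp with
    | refl => exact ⟨hp₀, rfl⟩
    | tail _ hst ih =>
      have hmem := hclosed _ ih.1 _ hst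
      refine ⟨hmem, ?_⟩
      obtain ⟨a, b, d, ht, rfl, hf, ⟨rfl, _⟩ | ⟨rfl, _⟩⟩ := hst
      · exact ih.2
      · have h1 := hup _ _ ih.1
        have h2 := hup _ _ hmem
        have h3 := ih.2
        simp only at h3 ⊢
        omega
  -- The potential increases only across edges of `T`, all of which start at the level of `p₀`, so
  -- they are exactly the edges leaving this sublevel set.
  refine ⟨{x | h x ≤ h p₀.1}, fun a b => ⟨?_, fun hab => ?_⟩⟩
  · rintro ⟨hadj, ha, hb⟩
    have ha' : h a ≤ h p₀.1 := ha
    have hb' : ¬ h b ≤ h p₀.1 := hb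
    have h1 := hh a b hadj
    by_contra hab
    have h2 : η a b ≤ 0 := by
      simp only [η, if_neg hab]
      split_ifs <;> norm_num
    omega
  · have h1 := (hlev _ (hconn _ hp₀ _ hab)).2
    have h2 := hup _ _ hab
    simp only at h1
    refine ⟨(hT _ hab).1, h1.le, fun hb => ?_⟩
    have hb' : h b ≤ h p₀.1 := hb
    omega

/-- The connectedness condition for the edges leaving `S` passes to the complement. -/
theorem finTrack_compl (hq : IsUniformBicombing G Γ q δ) {f : Y × Y} {S : Set W}
    (hfin : Sᶜ.Finite) (hne : ∃ a b, IsExit K S a b)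
    (hcross : ∀ a b, IsExit K S a b → f ∈ chainSupp (q (Φ a) (Φ b)))
    (hconn : ∀ Q : W → W → Prop,
      (∀ a b d, IsTriangle K a b d → IsExit K S a b →
        (d ∉ S → f ∉ chainSupp (q (Φ b) (Φ d)) → f.swap ∉ chainSupp (q (Φ b) (Φ d)) →
          Q a b → Q a d) ∧
        (d ∈ S → f ∉ chainSupp (q (Φ a) (Φ d)) → f.swap ∉ chainSupp (q (Φ a) (Φ d)) →
          Q a b → Q d b)) →
      ∀ a b a' b', IsExit K S a b → IsExit K S a' b' → Q a b → Q a' b') :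
    FinTrack q K Φ f.swap Sᶜ := by
  have hiff : ∀ a b, IsExit K Sᶜ a b ↔ IsExit K S b a := fun a b =>
    ⟨fun h => ⟨h.1.symm, by simpa using h.2.2, h.2.1⟩,
      fun h => ⟨h.1.symm, h.2.2, by simpa using h.2.1⟩⟩
  refine ⟨hfin, ?_, fun a b h => hq.mem_swap_iff.mpr (hcross b a ((hiff a b).mp h)), ?_⟩
  · obtain ⟨a, b, h⟩ := hne
    exact ⟨b, a, (hiff b a).mpr h⟩
  · intro Q hQ a b a' b' h h' hab
    refine hconn (fun a b => Q b a) ?_ b a b' a' ((hiff _ _).mp h) ((hiff _ _).mp h') hab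
    intro a b d ht hexit
    have := hQ b a d ht.rotate.rotate.swap ((hiff _ _).mpr hexit)
    refine ⟨fun hd h1 h2 => this.2 hd h2 (by rwa [Prod.swap_swap]),
      fun hd h1 h2 => this.1 (by simpa using hd) h2 (by rwa [Prod.swap_swap])⟩

end RegularTracks

/-! ### Finite inner sets and inner vertices -/

section ChargingTracks

variable {G : Type u} [Group G] {Y : Type y} [MulAction G Y] {Γ : SimpleGraph Y}
  {q : Y → Y → (Y × Y →₀ ℚ)} {δ : ℕ} {W : Type w} [DecidableEq W] [MulAction G W]
  {K : AbstractSimplicialComplex W} {Φ : W → Y} {δ₀ : ℝ}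

namespace Resolution

variable (F : Resolution G Γ q K Φ δ₀) {depth : Y → ℕ} {R : ℝ}

theorem conn_mem_connectorsLE {a b : W} {f : Y × Y} (hab : (oneSkeleton K).Adj a b)
    (hf : f ∈ chainSupp (q (Φ a) (Φ b))) (h1 : depth f.1 ≤ R) (h2 : depth f.2 ≤ R) :
    F.conn a b f ∈ F.connectorsLE depth R :=
  ⟨a, b, f, hab, hf, h1, h2, Or.inl rfl⟩

theorem pointSMul_mem_connectorsLE (hq : IsUniformBicombing G Γ q δ)
    (hK : IsFreeCocompactAction G K) (hΦ : ∀ (g : G) a, Φ (g • a) = g • Φ a)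
    (hdepth : ∀ (g : G) y, depth (g • y) = depth y) (g : G) {c : W →₀ ℝ}
    (hc : c ∈ F.connectorsLE depth R) : pointSMul g c ∈ F.connectorsLE depth R := by
  obtain ⟨a, b, f, hab, hf, h1, h2, h⟩ := hc
  refine ⟨g • a, g • b, g • f, hK.adj_smul g hab, ?_, ?_, ?_, ?_⟩
  · rw [hΦ, hΦ]; exact (hq.smul_mem_iff g).mpr hf
  · rw [Prod.smul_fst, hdepth]; exact h1
  · rw [Prod.smul_snd, hdepth]; exact h2
  · rw [← F.conn_equivariant a b hab f hf]
    refine h.imp (fun h => by rw [h]) fun h => ⟨?_, F.invariant.segments g _ _ h.2⟩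
    have := h.1
    unfold IsSingularPoint at this ⊢
    rwa [support_pointSMul, Finset.card_smul_finset]

theorem mem_connectors_of_mem_connectorsLE {c : W →₀ ℝ} (hc : c ∈ F.connectorsLE depth R) :
    c ∈ F.connectors := by
  obtain ⟨a, b, f, hab, hf, _, _, rfl | h⟩ := hc
  · exact (F.conn_mem hab hf).1
  · exact (F.mem_of_adj _ _ h.2).1

/-- A track without singular connectors is given by the edges leaving a finite set of vertices. -/
theorem exists_finTrack (hq : IsUniformBicombing G Γ q δ) (hend : IsOneEnded G)
    (hsc : IsSimplyConnectedComplex K) (hK : IsFreeCocompactAction G K)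
    (hfree : ∀ (g : G) (a : W), g • a = a → g = 1)
    (hcoc : ∃ Z : Set W, Z.Finite ∧ ∀ a, ∃ g : G, g • a ∈ Z)
    (hstab : ∀ a : Y, (MulAction.stabilizer G a : Set G).Finite)
    (hΦ : ∀ (g : G) a, Φ (g • a) = g • Φ a) {E₀ : Finset (W × W)}
    (hE₀ : ∀ a b, (oneSkeleton K).Adj a b → ∃ g : G, (g • a, g • b) ∈ E₀)
    {t : Quotient (F.quotientTracks G (F.connectorsLE depth R))}
    (hreg : ∀ c, InTrack t c → ¬ IsSingularPoint c) :
    ∃ f S, FinTrack q K Φ f S ∧ depth f.1 ≤ R ∧ depth f.2 ≤ R ∧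
      ∀ a b, IsExit K S a b → InTrack t (F.conn a b f) := by
  obtain ⟨⟨c, hc⟩, rfl⟩ := Quotient.exists_rep t
  set t := Quotient.mk (F.quotientTracks G (F.connectorsLE depth R)) ⟨c, hc⟩
  have hct : InTrack t c := ⟨hc, rfl⟩
  have hc' := hc
  obtain ⟨a₀, b₀, f, hab₀, hf₀, hd1, hd2, h⟩ := hc'
  obtain rfl := h.resolve_right fun h => hreg c hct h.1
  -- the track of the given edge in `K`
  let T : Set (W × W) := {p | Relation.ReflTransGen (TrackStep q K Φ f) (a₀, b₀) p}
  have hT : ∀ p ∈ T, (oneSkeleton K).Adj p.1 p.2 ∧ f ∈ chainSupp (q (Φ p.1) (Φ p.2)) ∧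
      InTrack t (F.conn p.1 p.2 f) := by
    intro p hp
    induction hp with
    | refl => exact ⟨hab₀, hf₀, hct⟩
    | tail _ hst ih =>
      obtain ⟨a, b, d, ht, rfl, hf, ⟨rfl, h1, h2, h3⟩ | ⟨rfl, h1, h2, h3⟩⟩ := hst
      · exact ⟨ht.2.2.1, h1, ih.2.2.adj (F.adj_right hq ht hf h1 h2 h3)
          (F.conn_mem_connectorsLE ht.2.2.1 h1 hd1 hd2)⟩
      · exact ⟨ht.2.1.symm, h1, ih.2.2.adj (F.adj_left hq ht hf h1 h2 h3)
          (F.conn_mem_connectorsLE ht.2.1.symm h1 hd1 hd2)⟩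
  have hclosed : ∀ p ∈ T, ∀ p', TrackStep q K Φ f p p' → p' ∈ T := fun p hp p' h => hp.tail h
  have hstep : ∀ a b d, (a, b) ∈ T → IsTriangle K a b d →
      ((a, d) ∈ T ∧ f ∉ chainSupp (q (Φ b) (Φ d)) ∧ f.swap ∉ chainSupp (q (Φ b) (Φ d))) ∨
      ((d, b) ∈ T ∧ f ∉ chainSupp (q (Φ a) (Φ d)) ∧ f.swap ∉ chainSupp (q (Φ a) (Φ d))) := by
    intro a b d hab ht
    obtain ⟨hadj, hf, hin⟩ := hT _ hab
    simp only at hadj hf hin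
    -- The segment of the connector in this 2-simplex cannot end at a singular connector, since that
    -- one would belong to the same track; so it gives a step inside `T`.
    obtain ⟨c, ⟨hc1, hc2⟩, -⟩ := F.unique_segment _ (F.conn_mem hadj hf).1 {a, b, d} ht.2.2.2
      ht.card (by rw [(F.conn_mem hadj hf).2]; intro z; simp; tauto)
    rcases F.eq_of_adj hq ht hf hc1 hc2 with hs | ⟨h1, h2, h3, -⟩ | ⟨h1, h2, h3, -⟩
    · exact absurd hs (hreg c (hin.adj hc1 ⟨a, b, f, hadj, hf, hd1, hd2, Or.inr ⟨hs, hc1.symm⟩⟩))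
    · exact Or.inr ⟨hclosed _ hab _ ⟨a, b, d, ht, rfl, hf, Or.inr ⟨rfl, h1, h2, h3⟩⟩, h2, h3⟩
    · exact Or.inl ⟨hclosed _ hab _ ⟨a, b, d, ht, rfl, hf, Or.inl ⟨rfl, h1, h2, h3⟩⟩, h2, h3⟩
  have hconn : ∀ p ∈ T, ∀ p' ∈ T, Relation.ReflTransGen (TrackStep q K Φ f) p p' :=
    fun p hp p' hp' =>
      have : Std.Symm (TrackStep q K Φ f) := ⟨fun _ _ h => h.symm hq⟩
      (Std.Symm.symm _ _ hp).trans hp'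
  obtain ⟨S, hS⟩ := exists_cut hq hsc (fun p hp => ⟨(hT p hp).1, (hT p hp).2.1⟩) hstep hconn
    hclosed ⟨_, Relation.ReflTransGen.refl⟩
  -- All edges of the cut carry the same `f`, so properness makes the coboundary finite and
  -- one-endedness applies.
  have hfin : {p : W × W | (oneSkeleton K).Adj p.1 p.2 ∧ p.1 ∈ S ∧ p.2 ∉ S}.Finite :=
    (finite_edges_of_mem_supp hq hstab hΦ hE₀ f).subset fun p hp =>
      have := hT p ((hS p.1 p.2).mp hp)
      ⟨this.1, this.2.1⟩
  have hne : ∃ a b, IsExit K S a b := ⟨a₀, b₀, (hS _ _).mpr Relation.ReflTransGen.refl⟩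
  have hcross : ∀ a b, IsExit K S a b → f ∈ chainSupp (q (Φ a) (Φ b)) :=
    fun a b h => (hT _ ((hS a b).mp h)).2.1
  have hSconn : ∀ Q : W → W → Prop,
      (∀ a b d, IsTriangle K a b d → IsExit K S a b →
        (d ∉ S → f ∉ chainSupp (q (Φ b) (Φ d)) → f.swap ∉ chainSupp (q (Φ b) (Φ d)) →
          Q a b → Q a d) ∧
        (d ∈ S → f ∉ chainSupp (q (Φ a) (Φ d)) → f.swap ∉ chainSupp (q (Φ a) (Φ d)) →
          Q a b → Q d b)) →
      ∀ a b a' b', IsExit K S a b → IsExit K S a' b' → Q a b → Q a' b' := by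
    intro Q hQ a b a' b' h h' hab
    have key : ∀ p, Relation.ReflTransGen (TrackStep q K Φ f) (a, b) p →
        p ∈ T ∧ Q p.1 p.2 := by
      intro p hp
      induction hp with
      | refl => exact ⟨(hS _ _).mp h, hab⟩
      | tail _ hst ih =>
        have hmem := hclosed _ ih.1 _ hst
        refine ⟨hmem, ?_⟩
        obtain ⟨x, y, z, ht, rfl, hf, ⟨rfl, h1, h2, h3⟩ | ⟨rfl, h1, h2, h3⟩⟩ := hst
        · exact (hQ x y z ht ((hS _ _).mpr ih.1)).1 ((hS _ _).mpr hmem).2.2 h2 h3 ih.2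
        · exact (hQ x y z ht ((hS _ _).mpr ih.1)).2 ((hS _ _).mpr hmem).2.1 h2 h3 ih.2
    exact (key (a', b') (hconn _ ((hS _ _).mp h) _ ((hS _ _).mp h'))).2
  -- If it is the complement that is finite, it becomes the inner set, and `f` is reversed so as to
  -- point outwards again.
  rcases hend.finite_or_finite_compl (oneSkeleton K) hsc.1 (fun g a b => hK.adj_smul g) hfree hcoc
    S hfin with hS' | hS'
  · exact ⟨f, S, ⟨hS', hne, hcross, hSconn⟩, hd1, hd2, fun a b h => (hT _ ((hS a b).mp h)).2.2⟩
  · refine ⟨f.swap, Sᶜ, finTrack_compl hq hS' hne hcross hSconn, hd2, hd1, fun a b h => ?_⟩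
    have h' : IsExit K S b a := ⟨h.1.symm, by simpa using h.2.2, h.2.1⟩
    have := hT _ ((hS b a).mp h')
    rw [F.conn_symm b a this.1 f this.2.1]
    exact this.2.2

end Resolution

/-- The track `t` consists of the edges leaving a finite set of vertices, all attached to `f`, and
`a` is the inner endpoint of one of them. -/
def IsInnerVertex {F : Resolution G Γ q K Φ δ₀} {C : Set (W →₀ ℝ)}
    (t : Quotient (F.quotientTracks G C)) (a : W) (f : Y × Y) : Prop :=
  ∃ S, FinTrack q K Φ f S ∧ (∃ b, IsExit K S a b) ∧
    ∀ a b, IsExit K S a b → InTrack t (F.conn a b f)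

/-- A track is determined by the edge attached to it and any of its inner vertices. -/
theorem IsInnerVertex.eq [Infinite W] (hq : IsUniformBicombing G Γ q δ)
    (hK : (oneSkeleton K).Connected) {F : Resolution G Γ q K Φ δ₀} {C : Set (W →₀ ℝ)}
    {t t' : Quotient (F.quotientTracks G C)} {a : W} {f : Y × Y} (h : IsInnerVertex t a f)
    (h' : IsInnerVertex t' a f) : t = t' := by
  obtain ⟨S, hS, ⟨b, hb⟩, ht⟩ := h
  obtain ⟨S', hS', ⟨b', hb'⟩, ht'⟩ := h'
  exact (ht a b hb).eq (ht' a b (hS.exit_of_exit hq hK hS' hb hb'))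

/-- The track lives in the quotient, so translation does not change it; this allows the inner vertex
to be moved into a finite set of representatives. -/
theorem IsInnerVertex.smul (hq : IsUniformBicombing G Γ q δ) (hK : IsFreeCocompactAction G K)
    (hΦ : ∀ (g : G) a, Φ (g • a) = g • Φ a) {depth : Y → ℕ} {R : ℝ}
    (hdepth : ∀ (g : G) y, depth (g • y) = depth y) {F : Resolution G Γ q K Φ δ₀}
    {t : Quotient (F.quotientTracks G (F.connectorsLE depth R))} {a : W} {f : Y × Y}
    (h : IsInnerVertex t a f) (g : G) : IsInnerVertex t (g • a) (g • f) := by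
  obtain ⟨S, hS, ⟨b, hb⟩, ht⟩ := h
  refine ⟨g • S, hS.smul hq hΦ hK.simplicial g, ⟨g • b, hK.adj_smul g hb.1,
    Set.smul_mem_smul_set hb.2.1, fun h => hb.2.2 ((Set.smul_mem_smul_set_iff).mp h)⟩, ?_⟩
  intro x y hxy
  have hxy' : IsExit K S (g⁻¹ • x) (g⁻¹ • y) :=
    ⟨hK.adj_smul g⁻¹ hxy.1, Set.mem_smul_set_iff_inv_smul_mem.mp hxy.2.1,
      fun h => hxy.2.2 (Set.mem_smul_set_iff_inv_smul_mem.mpr h)⟩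
  obtain ⟨hm, -⟩ := ht _ _ hxy'
  have := (ht _ _ hxy').smul g (F.pointSMul_mem_connectorsLE hq hK hΦ hdepth g hm)
  rwa [F.conn_equivariant _ _ hxy'.1 f (hS.cross _ _ hxy'), smul_inv_smul, smul_inv_smul] at this

end ChargingTracks

/-! ### Triple edges and the defect along a track -/

section Counting

variable {G : Type u} [Group G] {Y : Type y} [MulAction G Y] {Γ : SimpleGraph Y}
  {q : Y → Y → (Y × Y →₀ ℚ)} {δ : ℕ} {W : Type w} [DecidableEq W] [MulAction G W]
  {K : AbstractSimplicialComplex W} {Φ : W → Y} {δ₀ : ℝ}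

open Classical in
/-- If every index is related to at most one term, then the sums of the values of the indices
related to a term add up to at most the sum of all values. -/
theorem tsum_sum_ite_le {T I : Type*} (J : Finset I) (r : I → T → Prop) (val : I → ℝ≥0∞)
    (hr : ∀ i t t', r i t → r i t' → t = t') :
    ∑' t, ∑ i ∈ J, (if r i t then val i else 0) ≤ ∑ i ∈ J, val i := by
  rw [Summable.tsum_finsetSum fun _ _ => ENNReal.summable]
  refine Finset.sum_le_sum fun i _ => ?_
  by_cases h : ∃ t, r i t
  · obtain ⟨t, ht⟩ := h
    rw [tsum_eq_single t fun t' ht' => if_neg fun h => ht' (hr i t' t h ht), if_pos ht]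
  · push Not at h
    simp [h]

theorem exists_third_vertex {a b : W} {s : Finset W} (h : a ≠ b) (hab : {a, b} ⊆ s)
    (hs : s.card = 3) : ∃ d, s = {a, b, d} := by
  have h1 := Finset.card_sdiff_add_card_eq_card hab
  rw [Finset.card_pair h, hs] at h1
  obtain ⟨d, hd⟩ := Finset.card_eq_one.mp (show (s \ {a, b}).card = 1 by omega)
  refine ⟨d, ?_⟩
  rw [← Finset.union_sdiff_of_subset hab, hd]
  ext; simp

/-- The edges in the supports over the three edges of a 2-simplex are close to each other. -/
theorem IsTriple.dist_le (hq : IsUniformBicombing G Γ q δ) {a b d : W} {f f' : Y × Y}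
    (h : IsTriple q Φ a b d f) (h' : IsTriple q Φ a b d f') : Γ.dist f.1 f'.1 ≤ 7 * δ := by
  have near : ∀ x y (f : Y × Y), f ∈ chainSupp (q x y) ∨ f.swap ∈ chainSupp (q x y) →
      IsNearGeodesics Γ δ x y f.1 := by
    rintro x y f (h | h)
    · exact hq.near_fst _ _ _ h
    · exact hq.near_snd _ _ _ h
  have sums : ∀ f, IsTriple q Φ a b d f → IsNearGeodesics Γ δ (Φ a) (Φ b) f.1 ∧
      IsNearGeodesics Γ δ (Φ b) (Φ d) f.1 ∧ IsNearGeodesics Γ δ (Φ a) (Φ d) f.1 :=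
    fun f h => ⟨near _ _ _ (Or.inl h.1), near _ _ _ h.2.1, near _ _ _ h.2.2⟩
  have hd := (sums f h).1.dist_le hq.connected (sums f' h').1
  have key : ∀ f, IsTriple q Φ a b d f → ∀ x y, IsNearGeodesics Γ δ x y f.1 →
      Γ.dist x y ≤ Γ.dist x f.1 + Γ.dist y f.1 ∧
      Γ.dist x f.1 + Γ.dist y f.1 ≤ Γ.dist x y + 2 * δ := by
    intro f _ x y h
    have h1 := h.dist_add_dist_le hq.connected
    have h2 := hq.connected.dist_triangle (u := x) (v := f.1) (w := y)
    rw [Γ.dist_comm (u := y)]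
    exact ⟨h2, h1⟩
  -- The three pairwise sums of distances to the vertices determine the distance to `Φ a` up to `3 *
  -- δ`; comparison along the side from `a` to `b` adds `4 * δ`.
  have h1 := key f h _ _ (sums f h).1
  have h2 := key f h _ _ (sums f h).2.1
  have h3 := key f h _ _ (sums f h).2.2
  have h1' := key f' h' _ _ (sums f' h').1
  have h2' := key f' h' _ _ (sums f' h').2.1
  have h3' := key f' h' _ _ (sums f' h').2.2
  omega

namespace Resolution

variable (F : Resolution G Γ q K Φ δ₀) {depth : Y → ℕ} {R : ℝ}

theorem weight_le_of_mem (hq : IsUniformBicombing G Γ q δ) {c : W →₀ ℝ}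
    (hc : c ∈ F.connectorsLE depth R) : (F.weight c : ℝ≥0∞) ≤ δ := by
  obtain ⟨a, b, f, hab, hf, _, _, rfl | h⟩ := id hc
  · exact_mod_cast F.weight_le hq hab hf
  · rw [F.weight_singular c (F.mem_connectors_of_mem_connectorsLE hc) h.1]
    simp

/-- A segment of a track is a translate of one in a given set of representatives. -/
theorem exists_representative (hq : IsUniformBicombing G Γ q δ) (hK : IsFreeCocompactAction G K)
    (hΦ : ∀ (g : G) a, Φ (g • a) = g • Φ a) (hdepth : ∀ (g : G) y, depth (g • y) = depth y)
    {T₀ : Finset (W × W × W)}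
    (hT₀ : ∀ a b d, IsTriangle K a b d → ∃ g : G, (g • a, g • b, g • d) ∈ T₀)
    {t : Quotient (F.quotientTracks G (F.connectorsLE depth R))} {c c' : W →₀ ℝ}
    (hc : InTrack t c) (hreg : IsRegularPoint c) (hadj : F.graph.Adj c c') :
    ∃ a b d f, (a, b, d) ∈ T₀ ∧ IsTriangle K a b d ∧ f ∈ chainSupp (q (Φ a) (Φ b)) ∧
      InTrack t (F.conn a b f) ∧ F.weight (F.conn a b f) = F.weight c ∧
      ∃ c'', F.graph.Adj (F.conn a b f) c'' ∧ c''.support ⊆ {a, b, d} ∧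
        F.weight c'' = F.weight c' := by
  obtain ⟨hcS, -⟩ := id hc
  obtain ⟨a, b, f, hab, hf, h1, h2, h⟩ := id hcS
  obtain rfl := h.resolve_right
    fun h => SingularPattern.not_isSingularPoint_of_isRegularPoint hreg h.1
  obtain ⟨hs, hs3⟩ := F.union_support_of_adj hadj
  rw [(F.conn_mem hab hf).2] at hs hs3
  obtain ⟨d, hd⟩ := exists_third_vertex hab.1 Finset.subset_union_left hs3
  have ht : IsTriangle K a b d := IsTriangle.of_face (hd ▸ hs) (hd ▸ hs3)
  obtain ⟨g, hg⟩ := hT₀ a b d ht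
  have hconn := F.conn_equivariant a b hab f hf g
  refine ⟨g • a, g • b, g • d, g • f, hg, ht.smul hK g, ?_, ?_, ?_, pointSMul g c', ?_, ?_, ?_⟩
  · rw [hΦ, hΦ]; exact (hq.smul_mem_iff g).mpr hf
  · rw [← hconn]
    exact hc.smul g (F.pointSMul_mem_connectorsLE hq hK hΦ hdepth g hcS)
  · rw [← hconn, F.invariant.weight g _ (F.conn_mem hab hf).1]
  · rw [← hconn]
    exact F.invariant.segments g _ _ hadj
  · have : c'.support ⊆ {a, b, d} := hd ▸ Finset.subset_union_right
    rw [support_pointSMul]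
    have h3 := Finset.smul_finset_subset_smul_finset (a := g) this
    rwa [Finset.smul_finset_insert, Finset.smul_finset_insert,
      Finset.smul_finset_singleton] at h3
  · exact F.invariant.weight g _ (F.mem_of_adj _ _ hadj).2

open Classical MeasureTheory in
/-- The weights along a track with a singular connector are bounded by the sum of the defects of
`q` along the track. -/
theorem weight_le_sum_defect (hq : IsUniformBicombing G Γ q δ) (hK : IsFreeCocompactAction G K)
    (hΦ : ∀ (g : G) a, Φ (g • a) = g • Φ a) (hdepth : ∀ (g : G) y, depth (g • y) = depth y)
    {T₀ : Finset (W × W × W)}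
    (hT₀ : ∀ a b d, IsTriangle K a b d → ∃ g : G, (g • a, g • b, g • d) ∈ T₀)
    (hT₀' : ∀ τ ∈ T₀, IsTriangle K τ.1 τ.2.1 τ.2.2)
    {t : Quotient (F.quotientTracks G (F.connectorsLE depth R))}
    (htr : ∀ a b d f, IsTriangle K a b d → InTrack t (F.conn a b f) → ¬ IsTriple q Φ a b d f)
    {c₀ : W →₀ ℝ} (hc₀ : InTrack t c₀) (hs₀ : IsSingularPoint c₀) {c : W →₀ ℝ}
    (hc : InTrack t c) :
    (F.weight c : ℝ≥0∞) ≤ ∑ p ∈ T₀.sigma fun τ => (chainSupp_finite (q (Φ τ.1) (Φ τ.2.1))).toFinset,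
      if InTrack t (F.conn p.1.1 p.1.2.1 p.2) then
        ENNReal.ofReal (|q (Φ p.1.1) (Φ p.1.2.1) p.2 + q (Φ p.1.2.1) (Φ p.1.2.2) p.2 +
          q (Φ p.1.2.2) (Φ p.1.1) p.2| : ℚ) else 0 := by
  set J := T₀.sigma fun τ => (chainSupp_finite (q (Φ τ.1) (Φ τ.2.1))).toFinset with hJ
  -- Each segment contributes the interval between the weights of its endpoints. The intervals along
  -- the track cover the range of weights, so measure replaces the choice of a path to the singular
  -- connector.
  let I : ((_ : W × W × W) × (Y × Y)) → Set ℝ := fun p =>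
    {x | InTrack t (F.conn p.1.1 p.1.2.1 p.2) ∧ ∃ c', F.graph.Adj (F.conn p.1.1 p.1.2.1 p.2) c' ∧
      c'.support ⊆ {p.1.1, p.1.2.1, p.1.2.2} ∧
      x ∈ Set.uIcc (F.weight (F.conn p.1.1 p.1.2.1 p.2) : ℝ) (F.weight c')}
  let U : Set ℝ := ⋃ p ∈ J, I p
  have hreg : ∀ c d, InTrack t c → F.graph.Adj c d → IsRegularPoint c →
      Set.uIcc (F.weight c : ℝ) (F.weight d) ⊆ U := by
    intro c d hc hcd hcr
    obtain ⟨a, b, e, f, hm, _, hf, hin, hw, d', hadj, hsup, hw'⟩ :=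
      F.exists_representative hq hK hΦ hdepth hT₀ hc hcr hcd
    intro x hx
    refine Set.mem_biUnion (x := (⟨(a, b, e), f⟩ : (_ : W × W × W) × (Y × Y))) ?_ ⟨hin, d', hadj,
      hsup, by rwa [hw, hw']⟩
    exact Finset.mem_sigma.mpr ⟨hm, by simpa using hf⟩
  -- Null sets are allowed because a translation, like the reflexive case, joins equal weights, and
  -- their one-point interval need not lie in `U`.
  have hnull : volume (Set.uIcc (F.weight c : ℝ) (F.weight c₀) \ U) = 0 := by
    refine InTrack.induction hc hc₀
      (fun c d => volume (Set.uIcc (F.weight c : ℝ) (F.weight d) \ U) = 0) ?_ ?_ ?_ ?_ ?_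
    · intro c
      refine measure_mono_null Set.sdiff_subset ?_
      rw [Set.uIcc_self]
      exact Real.volume_singleton
    · intro c d h
      rwa [Set.uIcc_comm]
    · intro c d e h1 h2
      refine measure_mono_null ?_ (measure_union_null h1 h2)
      rw [← Set.union_sdiff_distrib]
      exact Set.sdiff_subset_sdiff_left Set.uIcc_subset_uIcc_union_uIcc
    · intro c d hc hd hcd
      have hsub : Set.uIcc (F.weight c : ℝ) (F.weight d) ⊆ U := by
        rcases F.isRegularPoint_or_isSingularPoint (F.mem_of_adj _ _ hcd).1 with h | h
        · exact hreg c d hc hcd h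
        · rw [Set.uIcc_comm]
          exact hreg d c hd hcd.symm (F.regular_of_singular _ _ hcd h)
      rw [Set.sdiff_eq_empty.mpr hsub, measure_empty]
    · intro g c hc _
      obtain ⟨hcS, -⟩ := hc
      rw [F.invariant.weight g c (F.mem_connectors_of_mem_connectorsLE hcS)]
      refine measure_mono_null Set.sdiff_subset ?_
      rw [Set.uIcc_self]
      exact Real.volume_singleton
  have hI : ∀ p ∈ J, volume (I p) ≤ if InTrack t (F.conn p.1.1 p.1.2.1 p.2) then
        ENNReal.ofReal (|q (Φ p.1.1) (Φ p.1.2.1) p.2 + q (Φ p.1.2.1) (Φ p.1.2.2) p.2 +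
          q (Φ p.1.2.2) (Φ p.1.1) p.2| : ℚ) else 0 := by
    rintro ⟨⟨a, b, d⟩, f⟩ hp
    rw [hJ, Finset.mem_sigma] at hp
    have ht : IsTriangle K a b d := hT₀' _ hp.1
    have hf : f ∈ chainSupp (q (Φ a) (Φ b)) := by simpa using hp.2
    split_ifs with hin
    -- Only one segment starts at this connector in the given 2-simplex, so the set is contained in
    -- a single interval whose length is at most the defect.
    · obtain ⟨c', ⟨h1, h2⟩, huniq⟩ := F.unique_segment _ (F.conn_mem ht.1 hf).1 _ ht.2.2.2 ht.card
        (by rw [(F.conn_mem ht.1 hf).2]; intro z; simp; tauto)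
      have hle := F.abs_weight_sub_le hq ht hf h1 h2 (htr a b d f ht hin)
      calc volume (I ⟨(a, b, d), f⟩)
          ≤ volume (Set.uIcc (F.weight (F.conn a b f) : ℝ) (F.weight c')) := by
            refine measure_mono ?_
            rintro x ⟨-, c'', h3, h4, hx⟩
            rwa [← huniq c'' ⟨h3, h4⟩]
        _ ≤ _ := by
            rw [Real.volume_interval, abs_sub_comm]
            exact ENNReal.ofReal_le_ofReal hle
    · have : I ⟨(a, b, d), f⟩ = ∅ := Set.eq_empty_of_forall_notMem fun x hx => hin hx.1
      rw [this, measure_empty]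
  have hw₀ : F.weight c₀ = 0 := by
    obtain ⟨hcS, -⟩ := hc₀
    exact F.weight_singular c₀ (F.mem_connectors_of_mem_connectorsLE hcS) hs₀
  calc (F.weight c : ℝ≥0∞) = volume (Set.uIcc (F.weight c : ℝ) (F.weight c₀)) := by
        rw [Real.volume_interval, hw₀, NNReal.coe_zero, zero_sub, abs_neg,
          NNReal.abs_eq, ENNReal.ofReal_coe_nnreal]
    _ ≤ volume (U ∪ (Set.uIcc (F.weight c : ℝ) (F.weight c₀) \ U)) :=
        measure_mono (by rw [Set.union_sdiff_self]; exact Set.subset_union_right)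
    _ ≤ volume U := by
        refine (measure_union_le _ _).trans ?_
        rw [hnull, add_zero]
    _ ≤ ∑ p ∈ J, volume (I p) := measure_biUnion_finset_le J I
    _ ≤ _ := Finset.sum_le_sum hI

end Resolution

end Counting

/-! ### The three charges and their sum -/

section TotalWeight

variable {G : Type u} [Group G] {Y : Type y} [MulAction G Y] {Γ : SimpleGraph Y}
  {q : Y → Y → (Y × Y →₀ ℚ)} {δ : ℕ} {V : Type v} [MulAction G V] {j : V → Y}
  {W : Type w} [DecidableEq W] [MulAction G W]
  {K : AbstractSimplicialComplex W} {δ₀ : ℝ}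

theorem card_near_edges_le {B : ℕ → ℕ}
    (hB : ∀ D (v : V), {y | Γ.dist (j v) y ≤ D}.Finite ∧ {y | Γ.dist (j v) y ≤ D}.ncard ≤ B D)
    {Z : Finset (Y × Y)} (v : V) (D : ℕ) (h : ∀ f ∈ Z, Γ.dist (j v) f.1 ≤ D ∧ Γ.dist (j v) f.2 ≤ D) :
    Z.card ≤ B D * B D := by
  obtain ⟨hfin, hcard⟩ := hB D v
  have hsub : (Z : Set (Y × Y)) ⊆ {y | Γ.dist (j v) y ≤ D} ×ˢ {y | Γ.dist (j v) y ≤ D} :=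
    fun f hf => h f hf
  rw [← Set.ncard_coe_finset]
  refine (Set.ncard_le_ncard hsub (hfin.prod hfin)).trans ?_
  rw [Set.ncard_prod]
  exact Nat.mul_le_mul hcard hcard

theorem dist_le_succ_of_adj (hΓ : Γ.Connected) {x a b : Y} {n : ℕ} (h : Γ.dist x a ≤ n)
    (hab : Γ.Adj a b) : Γ.dist x b ≤ n + 1 := by
  have h1 := hΓ.dist_triangle (u := x) (v := a) (w := b)
  rw [SimpleGraph.dist_eq_one_iff_adj.mpr hab] at h1
  omega

open Classical in
/-- The total weight of the part of bounded depth of a resolution via a map of minimal energy. -/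
theorem Resolution.quotientTotalWeight_le [Infinite W] {Φ : W → V}
    (F : Resolution G Γ q K (fun a => j (Φ a)) δ₀)
    (hq : IsUniformBicombing G Γ q δ) (hend : IsOneEnded G) (hsc : IsSimplyConnectedComplex K)
    (hK : IsFreeCocompactAction G K) (hfree : ∀ (g : G) (a : W), g • a = a → g = 1)
    (hstab : ∀ a : Y, (MulAction.stabilizer G a : Set G).Finite)
    (hj : ∀ (g : G) (a : V), j (g • a) = g • j a) {depth : Y → ℕ}
    (hdepth : ∀ (g : G) y, depth (g • y) = depth y)
    (hnear : ∀ y, ∃ v : V, Γ.dist (j v) y ≤ depth y) {B : ℕ → ℕ}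
    (hB : ∀ D (v : V), {y | Γ.dist (j v) y ≤ D}.Finite ∧ {y | Γ.dist (j v) y ≤ D}.ncard ≤ B D)
    {X₀ : Finset W} (hX₀ : ∀ a, ∃ g : G, g • a ∈ X₀) {E₀ : Finset (W × W)}
    (hE₀ : ∀ a b, (oneSkeleton K).Adj a b → ∃ g : G, (g • a, g • b) ∈ E₀)
    (hE₁ : ∀ e ∈ E₀, (oneSkeleton K).Adj e.1 e.2) {T₀ : Finset (W × W × W)}
    (hT₀ : ∀ a b d, IsTriangle K a b d → ∃ g : G, (g • a, g • b, g • d) ∈ T₀)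
    (hT₁ : ∀ τ ∈ T₀, IsTriangle K τ.1 τ.2.1 τ.2.2)
    (hΦ : ∀ (g : G) a, Φ (g • a) = g • Φ a)
    (hmin : ∀ Φ' : W → V, (∀ (g : G) a, Φ' (g • a) = g • Φ' a) →
      mapEnergy Γ j E₀ Φ ≤ mapEnergy Γ j E₀ Φ') (R : ℝ) :
    F.quotientTotalWeight G (F.connectorsLE depth R) ≤
      ((X₀.card * B (4 * ⌊R⌋₊ + 40 * δ + 11) ^ 2 * δ +
        T₀.card * B (⌊R⌋₊ + 7 * δ + 1) ^ 2 * δ + T₀.card * δ : ℕ) : ℝ≥0∞) := by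
  set m := ⌊R⌋₊ with hm
  have hle : ∀ n : ℕ, (n : ℝ) ≤ R → n ≤ m := fun n h => Nat.le_floor h
  have hΦ' : ∀ (g : G) a, j (Φ (g • a)) = g • j (Φ a) := fun g a => by rw [hΦ, hj]
  -- the edges close to a vertex, and those attached to the triple connectors of a triangle
  let N₁ : W → Finset (Y × Y) := fun a =>
    ((hB (4 * m + 40 * δ + 11) (Φ a)).1.prod (hB (4 * m + 40 * δ + 11) (Φ a)).1).toFinset
  have hN₁ : ∀ a f, f ∈ N₁ a ↔ Γ.dist (j (Φ a)) f.1 ≤ 4 * m + 40 * δ + 11 ∧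
      Γ.dist (j (Φ a)) f.2 ≤ 4 * m + 40 * δ + 11 := fun a f => by simp [N₁]
  let S : W × W × W → Finset (Y × Y) := fun τ =>
    (chainSupp_finite (q (j (Φ τ.1)) (j (Φ τ.2.1)))).toFinset
  let N₂ : W × W × W → Finset (Y × Y) := fun τ => (S τ).filter fun f =>
    IsTriple q (fun a => j (Φ a)) τ.1 τ.2.1 τ.2.2 f ∧ depth f.1 ≤ m ∧ depth f.2 ≤ m
  have hN₂ : ∀ τ, (N₂ τ).card ≤ B (m + 7 * δ + 1) ^ 2 := by
    intro τ
    -- One triple edge of depth at most `m` is within `m` of depth `0`; all others for this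
    -- 2-simplex are within `7 * δ` of it, so they lie in one controlled ball.
    rcases (N₂ τ).eq_empty_or_nonempty with he | ⟨f₀, hf₀⟩
    · rw [he]; exact Nat.zero_le _
    · obtain ⟨-, h₀, hd₀, -⟩ := Finset.mem_filter.mp hf₀
      obtain ⟨v, hv⟩ := hnear f₀.1
      rw [sq]
      refine card_near_edges_le hB v _ fun f hf => ?_
      obtain ⟨-, h, -, -⟩ := Finset.mem_filter.mp hf
      have h1 := h₀.dist_le (G := G) (Φ := fun a => j (Φ a)) hq h
      have h2 := hq.connected.dist_triangle (u := j v) (v := f₀.1) (w := f.1)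
      have h3 : Γ.dist (j v) f.1 ≤ m + 7 * δ := by omega
      exact ⟨by omega, dist_le_succ_of_adj hq.connected h3 (hq.adj _ _ f h.1)⟩
  let val : ((_ : W × W × W) × (Y × Y)) → ℝ≥0∞ := fun p =>
    ENNReal.ofReal (|q (j (Φ p.1.1)) (j (Φ p.1.2.1)) p.2 + q (j (Φ p.1.2.1)) (j (Φ p.1.2.2)) p.2 +
      q (j (Φ p.1.2.2)) (j (Φ p.1.1)) p.2| : ℚ)
  let T := Quotient (F.quotientTracks G (F.connectorsLE depth R))
  -- The charges of a track: `M₁` for inner vertices near `f`, `M₂` for triple edges, `M₃` for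
  -- defects. Each index of the sums belongs to at most one track, so summing over the tracks counts
  -- it at most once.
  let M₁ : T → ℝ≥0∞ := fun t => ∑ p ∈ X₀.sigma N₁,
    if IsInnerVertex t p.1 p.2 then (δ : ℝ≥0∞) else 0
  let M₂ : T → ℝ≥0∞ := fun t => ∑ p ∈ T₀.sigma N₂,
    if InTrack t (F.conn p.1.1 p.1.2.1 p.2) then (δ : ℝ≥0∞) else 0
  let M₃ : T → ℝ≥0∞ := fun t => ∑ p ∈ T₀.sigma S,
    if InTrack t (F.conn p.1.1 p.1.2.1 p.2) then val p else 0
  have hδ : ∀ (t : T) c, InTrack t c → (F.weight c : ℝ≥0∞) ≤ δ := by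
    rintro t c ⟨hc, -⟩
    exact F.weight_le_of_mem hq hc
  -- every track is charged
  have hM : ∀ (t : T) c, InTrack t c → (F.weight c : ℝ≥0∞) ≤ M₁ t + M₂ t + M₃ t := by
    intro t c hc
    by_cases hreg : ∀ c, InTrack t c → ¬ IsSingularPoint c
    · obtain ⟨f, S, hS, hd1, hd2, hin⟩ := F.exists_finTrack hq hend hsc hK hfree
        ⟨X₀, X₀.finite_toSet, hX₀⟩ hstab hΦ' hE₀ hreg
      obtain ⟨v, hv⟩ := hnear f.1
      obtain ⟨a, b, hab, hfa⟩ := hS.exists_exit_near hq hsc.1 hK.simplicial hfree hj hE₀ hE₁ hΦ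
        hmin (hv.trans (hle _ hd1))
      obtain ⟨g, hg⟩ := hX₀ a
      have hinner : IsInnerVertex t (g • a) (g • f) :=
        IsInnerVertex.smul hq hK hΦ' hdepth ⟨S, hS, ⟨b, hab⟩, hin⟩ g
      have hfa' : Γ.dist (j (Φ (g • a))) (g • f).1 ≤ 4 * m + 40 * δ + 10 := by
        rw [hΦ', Prod.smul_fst, dist_smul_smul hq.adj_smul]
        exact hfa
      have hadj : Γ.Adj (g • f).1 (g • f).2 :=
        hq.adj_smul g _ _ (hq.adj _ _ f (hS.cross a b hab))
      have hmem : (⟨g • a, g • f⟩ : (_ : W) × (Y × Y)) ∈ X₀.sigma N₁ :=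
        Finset.mem_sigma.mpr ⟨hg, (hN₁ _ _).mpr
          ⟨hfa'.trans (Nat.le_succ _), dist_le_succ_of_adj hq.connected hfa' hadj⟩⟩
      calc (F.weight c : ℝ≥0∞) ≤ δ := hδ t c hc
        _ = if IsInnerVertex t (g • a) (g • f) then (δ : ℝ≥0∞) else 0 := (if_pos hinner).symm
        _ ≤ M₁ t := Finset.single_le_sum
            (f := fun p : (_ : W) × (Y × Y) => if IsInnerVertex t p.1 p.2 then (δ : ℝ≥0∞) else 0)
            (fun _ _ => zero_le) hmem
        _ ≤ _ := by rw [add_assoc]; exact le_self_add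
    by_cases htr : ∀ a b d f, IsTriangle K a b d → InTrack t (F.conn a b f) →
        ¬ IsTriple q (fun a => j (Φ a)) a b d f
    · push Not at hreg
      obtain ⟨c₀, hc₀, hs₀⟩ := hreg
      exact (F.weight_le_sum_defect hq hK hΦ' hdepth hT₀ hT₁ htr hc₀ hs₀ hc).trans le_add_self
    · push Not at htr
      obtain ⟨a, b, d, f, ht, hin, htri⟩ := htr
      obtain ⟨g, hg⟩ := hT₀ a b d ht
      obtain ⟨hS, -⟩ := id hin
      obtain ⟨a', b', f', hab', hf', hd1, hd2, heq | hsing⟩ := id hS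
      swap
      · exact absurd hsing.1 (SingularPattern.not_isSingularPoint_of_isRegularPoint
          (F.isRegularPoint_conn ht.1 htri.1))
      -- Membership in `connectorsLE` bounds the depth of some edge inducing the connector, which is
      -- `f` up to orientation.
      have hdep : depth f.1 ≤ m ∧ depth f.2 ≤ m := by
        rcases F.eq_or_eq_of_conn_eq ht.1 hab' hq htri.1 hf' heq with ⟨_, _, rfl⟩ | ⟨_, _, rfl⟩
        · exact ⟨hle _ hd1, hle _ hd2⟩
        · exact ⟨hle _ hd2, hle _ hd1⟩
      have hsm : ∀ x y, g • f ∈ chainSupp (q (j (Φ (g • x))) (j (Φ (g • y)))) ↔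
          f ∈ chainSupp (q (j (Φ x)) (j (Φ y))) := fun x y => by
        rw [hΦ', hΦ', hq.smul_mem_iff]
      have hsm' : ∀ x y, (g • f).swap ∈ chainSupp (q (j (Φ (g • x))) (j (Φ (g • y)))) ↔
          f.swap ∈ chainSupp (q (j (Φ x)) (j (Φ y))) := fun x y => by
        rw [hΦ', hΦ', ← hq.smul_mem_iff g (f := f.swap), Prod.smul_swap]
      have hin' : InTrack t (F.conn (g • a) (g • b) (g • f)) := by
        rw [← F.conn_equivariant a b ht.1 f htri.1]
        exact hin.smul g (F.pointSMul_mem_connectorsLE hq hK hΦ' hdepth g hS)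
      have hmem : (⟨(g • a, g • b, g • d), g • f⟩ : (_ : W × W × W) × (Y × Y)) ∈ T₀.sigma N₂ := by
        refine Finset.mem_sigma.mpr ⟨hg, Finset.mem_filter.mpr ⟨?_, ⟨?_, ?_, ?_⟩, ?_, ?_⟩⟩
        · exact (Set.Finite.mem_toFinset _).mpr ((hsm a b).mpr htri.1)
        · exact (hsm a b).mpr htri.1
        · exact htri.2.1.imp (hsm b d).mpr (hsm' b d).mpr
        · exact htri.2.2.imp (hsm a d).mpr (hsm' a d).mpr
        · rw [Prod.smul_fst, hdepth]; exact hdep.1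
        · rw [Prod.smul_snd, hdepth]; exact hdep.2
      calc (F.weight c : ℝ≥0∞) ≤ δ := hδ t c hc
        _ = if InTrack t (F.conn (g • a) (g • b) (g • f)) then (δ : ℝ≥0∞) else 0 :=
            (if_pos hin').symm
        _ ≤ M₂ t := Finset.single_le_sum (f := fun p : (_ : W × W × W) × (Y × Y) =>
            if InTrack t (F.conn p.1.1 p.1.2.1 p.2) then (δ : ℝ≥0∞) else 0)
            (fun _ _ => zero_le) hmem
        _ ≤ _ := by rw [add_right_comm]; exact le_add_self
  have h₁ : ∑' t, M₁ t ≤ (X₀.card * B (4 * m + 40 * δ + 11) ^ 2 * δ : ℕ) := by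
    refine (tsum_sum_ite_le (X₀.sigma N₁) (fun p (t : T) => IsInnerVertex t p.1 p.2)
      (fun _ => (δ : ℝ≥0∞)) fun p t t' h h' => h.eq hq hsc.1 h').trans ?_
    rw [Finset.sum_const, Finset.card_sigma, nsmul_eq_mul, ← Nat.cast_mul, Nat.cast_le]
    refine Nat.mul_le_mul_right _ (Finset.sum_le_card_nsmul _ _ _ fun a _ => ?_)
    rw [sq]
    exact card_near_edges_le hB (Φ a) _ fun f hf => (hN₁ a f).mp hf
  have h₂ : ∑' t, M₂ t ≤ (T₀.card * B (m + 7 * δ + 1) ^ 2 * δ : ℕ) := by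
    refine (tsum_sum_ite_le (T₀.sigma N₂)
      (fun p (t : T) => InTrack t (F.conn p.1.1 p.1.2.1 p.2))
      (fun _ => (δ : ℝ≥0∞)) fun p t t' h h' => h.eq h').trans ?_
    rw [Finset.sum_const, Finset.card_sigma, nsmul_eq_mul, ← Nat.cast_mul, Nat.cast_le]
    exact Nat.mul_le_mul_right _ (Finset.sum_le_card_nsmul _ _ _ fun τ _ => hN₂ τ)
  -- For one 2-simplex, all the defects together are a part of the norm of a single boundary sum,
  -- bounded by stability with no restriction on depth.
  have h₃ : ∑' t, M₃ t ≤ (T₀.card * δ : ℕ) := by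
    refine (tsum_sum_ite_le (T₀.sigma S)
      (fun p (t : T) => InTrack t (F.conn p.1.1 p.1.2.1 p.2)) val
      fun p t t' h h' => h.eq h').trans ?_
    rw [Finset.sum_sigma, Nat.cast_mul, ← nsmul_eq_mul]
    refine Finset.sum_le_card_nsmul _ _ _ fun τ _ => ?_
    rw [← ENNReal.ofReal_sum_of_nonneg fun f _ => by exact_mod_cast abs_nonneg _,
      ← ENNReal.ofReal_natCast]
    refine ENNReal.ofReal_le_ofReal ?_
    exact_mod_cast hq.defect (j (Φ τ.1)) (j (Φ τ.2.1)) (j (Φ τ.2.2)) (S τ)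
  calc F.quotientTotalWeight G (F.connectorsLE depth R)
      ≤ ∑' t, (M₁ t + M₂ t + M₃ t) :=
        ENNReal.tsum_le_tsum fun t => iSup_le fun c => iSup_le fun hc => hM t c.1 ⟨c.2, hc⟩
    _ = ∑' t, M₁ t + ∑' t, M₂ t + ∑' t, M₃ t := by rw [ENNReal.tsum_add, ENNReal.tsum_add]
    _ ≤ _ := by
      push_cast at h₁ h₂ h₃ ⊢
      exact add_le_add (add_le_add h₁ h₂) h₃

end TotalWeight

/-! ### Representatives of cells and the conclusion -/

section Representatives

variable {G : Type u} [Group G] {W : Type w} [DecidableEq W] [MulAction G W]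
  {K : AbstractSimplicialComplex W}

theorem IsFreeCocompactAction.smul_eq_self (hK : IsFreeCocompactAction G K) (g : G) (a : W)
    (h : g • a = a) : g = 1 :=
  hK.free g {a} (K.singleton_mem a) (by rw [Finset.smul_finset_singleton, h])

/-- A set of representatives for the orbits of simplices. -/
theorem IsFreeCocompactAction.exists_representatives (hK : IsFreeCocompactAction G K) :
    ∃ Z : Finset (Finset W), Z.card ≤ quotientVolume G K ∧ ∀ s ∈ K.faces, ∃ g : G, g • s ∈ Z := by
  classical
  refine ⟨hK.cocompact.toFinset.image Quotient.out, ?_, fun s hs => ?_⟩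
  · refine Finset.card_image_le.trans ?_
    rw [quotientVolume, Set.ncard_eq_toFinset_card _ hK.cocompact]
  · have := Quotient.exact (s := MulAction.orbitRel G (Finset W))
      (Quotient.out_eq (Quotient.mk (MulAction.orbitRel G (Finset W)) s))
    obtain ⟨g, hg⟩ := MulAction.mem_orbit_iff.mp this
    exact ⟨g, hg ▸ Finset.mem_image_of_mem _ ((Set.Finite.mem_toFinset _).mpr ⟨s, hs, rfl⟩)⟩

end Representatives

theorem proposition4p1
    {G : Type u} [Group G] {ι : Type x} [Finite ι] {V : Type v} [MulAction G V]
    (P : ι → Subgroup G) (X : SimpleGraph V) (A : ι → X.Subgraph)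
    (hgeom : IsGeometricPair P X A)
    (hhyp : IsHyperbolicGraph (cuspedGraph P X A))
    (hend : IsOneEnded G)
    (q : CuspedVertex P A → CuspedVertex P A → (CuspedVertex P A × CuspedVertex P A →₀ ℚ))
    (hq : IsGloballyStableBicombing G (cuspedGraph P X A) q) :
    ∃ (δ₀ : ℝ) (δ : ℝ → ℝ≥0), (∀ R, 0 < δ R) ∧
      ∀ (W : Type w) [DecidableEq W] [MulAction G W] (K : AbstractSimplicialComplex W),
        (∀ s ∈ K.faces, s.card ≤ 3) →
        IsSimplyConnectedComplex K →
        IsFreeCocompactAction G K →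
        ∃ Φ : W → V, (∀ (g : G) (a : W), Φ (g • a) = g • Φ a) ∧
          ∃ F : Resolution G (cuspedGraph P X A) q K (fun a => Sum.inl (Φ a)) δ₀,
            ∀ R : ℝ,
              F.quotientTotalWeight G (F.connectorsLE cuspedDepth R) ≤
                ((δ R * (quotientVolume G K : ℝ≥0) : ℝ≥0) : ℝ≥0∞) := by
  classical
  have hconn := hhyp.1
  obtain ⟨n, hn⟩ := exists_isUniformBicombing hconn (cuspedGraph_adj_smul hgeom) hq
  choose B hB using fun D : ℕ => exists_ball_bound hgeom hconn D
  have : Infinite G := hend.infinite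
  have : Nonempty V := hgeom.connected.nonempty
  -- A cell has at most `3` vertices and at most `27` ordered triples of vertices, whence the
  -- factors; the final `1` only ensures positivity.
  refine ⟨2 * n + 1, fun R => ((3 * B (4 * ⌊R⌋₊ + 40 * n + 11) ^ 2 * n +
    27 * B (⌊R⌋₊ + 7 * n + 1) ^ 2 * n + 27 * n + 1 : ℕ) : ℝ≥0), fun R => ?_, ?_⟩
  · exact Nat.cast_pos.mpr (Nat.succ_pos _)
  intro W _ _ K hdim hsc hK
  have hfree := hK.smul_eq_self
  have : Nonempty W := hsc.1.nonempty
  have : Infinite W := by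
    obtain ⟨a⟩ := ‹Nonempty W›
    refine Infinite.of_injective (fun g : G => g • a) fun g g' h => ?_
    have := hfree (g'⁻¹ * g) a (by rw [mul_smul, inv_smul_eq_iff]; exact h)
    rwa [inv_mul_eq_one, eq_comm] at this
  obtain ⟨Z, hZ, hrep⟩ := hK.exists_representatives
  -- Orbit representatives are chosen among all finite sets; the filter records the dimension bound,
  -- which holds for every translate of a face.
  let Z' := Z.filter fun s => s.card ≤ 3
  have hZ' : Z'.card ≤ quotientVolume G K := (Finset.card_filter_le _ _).trans hZ
  have hrep' : ∀ s ∈ K.faces, ∃ g : G, g • s ∈ Z' := fun s hs => by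
    obtain ⟨g, hg⟩ := hrep s hs
    exact ⟨g, Finset.mem_filter.mpr ⟨hg, by rw [Finset.card_smul_finset]; exact hdim s hs⟩⟩
  let X₀ : Finset W := Z'.biUnion id
  let E₀ : Finset (W × W) := (X₀ ×ˢ X₀).filter fun e => (oneSkeleton K).Adj e.1 e.2
  let T₀ : Finset (W × W × W) := (Z'.biUnion fun s => s ×ˢ s ×ˢ s).filter fun τ =>
    IsTriangle K τ.1 τ.2.1 τ.2.2
  have hX₀ : ∀ a, ∃ g : G, g • a ∈ X₀ := fun a => by
    obtain ⟨g, hg⟩ := hrep' {a} (K.singleton_mem a)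
    exact ⟨g, Finset.mem_biUnion.mpr ⟨_, hg, by simp⟩⟩
  have hE₀ : ∀ a b, (oneSkeleton K).Adj a b → ∃ g : G, (g • a, g • b) ∈ E₀ := fun a b hab => by
    obtain ⟨g, hg⟩ := hrep' {a, b} hab.2
    refine ⟨g, Finset.mem_filter.mpr ⟨Finset.mem_product.mpr ⟨?_, ?_⟩, hK.adj_smul g hab⟩⟩ <;>
      exact Finset.mem_biUnion.mpr ⟨_, hg, Finset.smul_mem_smul_finset (by simp)⟩
  have hE₁ : ∀ e ∈ E₀, (oneSkeleton K).Adj e.1 e.2 := fun e he => (Finset.mem_filter.mp he).2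
  have hT₀ : ∀ a b d, IsTriangle K a b d → ∃ g : G, (g • a, g • b, g • d) ∈ T₀ := by
    intro a b d ht
    obtain ⟨g, hg⟩ := hrep' {a, b, d} ht.2.2.2
    refine ⟨g, Finset.mem_filter.mpr ⟨Finset.mem_biUnion.mpr ⟨_, hg, ?_⟩, ht.smul hK g⟩⟩
    simp only [Finset.mem_product]
    refine ⟨?_, ?_, ?_⟩ <;> exact Finset.smul_mem_smul_finset (by simp)
  have hT₁ : ∀ τ ∈ T₀, IsTriangle K τ.1 τ.2.1 τ.2.2 := fun τ hτ => (Finset.mem_filter.mp hτ).2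
  have hXcard : X₀.card ≤ 3 * quotientVolume G K := by
    refine (Finset.card_biUnion_le_card_mul _ _ 3 fun s hs => (Finset.mem_filter.mp hs).2).trans ?_
    rw [mul_comm]
    exact Nat.mul_le_mul_left _ hZ'
  have hTcard : T₀.card ≤ 27 * quotientVolume G K := by
    refine (Finset.card_filter_le _ _).trans ((Finset.card_biUnion_le_card_mul _ _ 27
      fun s hs => ?_).trans ?_)
    · have h3 := (Finset.mem_filter.mp hs).2
      rw [Finset.card_product, Finset.card_product]
      exact Nat.mul_le_mul h3 (Nat.mul_le_mul h3 h3)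
    · rw [mul_comm]
      exact Nat.mul_le_mul_left _ hZ'
  obtain ⟨Φ, hΦ, hmin⟩ := exists_minimal_energy (G := G) hfree (cuspedGraph P X A)
    (Sum.inl : V → CuspedVertex P A) E₀
  have hΦ' : ∀ (g : G) a, (Sum.inl (Φ (g • a)) : CuspedVertex P A) = g • Sum.inl (Φ a) :=
    fun g a => by rw [hΦ]; rfl
  obtain ⟨τ, hτ⟩ := exists_isPositioning (Φ := fun a => (Sum.inl (Φ a) : CuspedVertex P A))
    hn hK hΦ'
  have hdatum : IsResolutionDatum G (cuspedGraph P X A) q n K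
    (fun a => (Sum.inl (Φ a) : CuspedVertex P A)) _ τ := ⟨hn, hK, hΦ', hτ⟩
  obtain ⟨F⟩ := hdatum.nonempty_resolution
  refine ⟨Φ, hΦ, F, fun R => ?_⟩
  refine (F.quotientTotalWeight_le hn hend hsc hK hfree (cusped_stabilizer_finite hgeom)
    (fun _ _ => rfl) (by rintro g (a | a) <;> rfl) (exists_dist_le_depth hconn) hB hX₀ hE₀ hE₁
    hT₀ hT₁ hΦ hmin R).trans ?_
  have hle := add_le_add (add_le_add
    (Nat.mul_le_mul_right (B (4 * ⌊R⌋₊ + 40 * n + 11) ^ 2 * n) hXcard)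
    (Nat.mul_le_mul_right (B (⌊R⌋₊ + 7 * n + 1) ^ 2 * n) hTcard)) (Nat.mul_le_mul_right n hTcard)
  rw [← Nat.cast_mul, ENNReal.coe_natCast, Nat.cast_le]
  nlinarith
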